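/- Let $n\ge 4$. **Young walls.** The pattern of type $D_n$ has columns $0,1,2,\dots$ (left to right) and rows $0,1,2,\dots$ (bottom to top). A cell in a row divisible by $n-2$ consists of an upper-left and a lower-right half-block; every other cell is a full block. Along a column the labels are, with period $2(n-2)$: $0/1,\,2,\dots,n-2,\,(n-1)/n,\,n-2,\dots,2$. In even columns the upper-left half-blocks have labels $0$ and $n-1$ and the lower-right ones $1$ and $n$; in odd columns the two labels in each cell are interchanged. The lower-right half-blocks of row $0$ are grey, everything else is white. A *Young wall* is a subset $Y$ of the pattern such that: $Y$ contains all grey and finitely many white (half-)blocks; every (half-)block of the pattern in a lower row of the same column as a member of $Y$ is in $Y$; if a (half-)block outside the leftmost column is in $Y$, so is the (half-)block of the same row and shape in the column to its left; and no two full columns have the same height. Here a column is *full* if its top is a full block or both half-blocks, and heights and the size $|Y|$ count white blocks and half-blocks. Let $\mathcal Z_\Delta$ be the set of Young walls. A *bar* is a connected set of (half-)blocks containing each of the labels $0,1,n-1,n$ once and each of the labels $2,\dots,n-2$ twice; two (half-)blocks are adjacent if their columns differ by at most $1$ and their rows differ by at most $1$ (the pieces, viewed as boxes in space with half-blocks of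 half thickness, touch). A bar removal passes from a Young wall $Y$ to a Young wall $Y'\subset Y$ for which $Y\setminus Y'$ is a bar. Let $\mathcal C_\Delta\subset\mathcal Z_\Delta$ be the set of *cores*, the Young walls that admit no bar removal. **Abacus.** The positions are $1,2,3,\dots$; the ruler $R_k$ ($1\le k\le 2n-2$) consists of the positions congruent to $k$ modulo $2n-2$. A configuration consists of finitely many beads: at most one uncoloured bead at each position not divisible by $n-1$, and any number of coloured beads, all white or all black, at each position divisible by $n-1$. The abacus of $Y$ has a bead at position $h$ for each non-empty column of height $h$: uncoloured if the column is full; otherwise white if the top half-block is lower-right and the number of shorter full columns is even, or upper-left and that number is odd, and black in the remaining cases. Let $Y_1,Y_2$ be the Young walls whose abaci consist of the uncoloured, respectively the coloured, beads of $Y$ ($Y_1$ has only full columns, $Y_2$ only non-full ones); this is the decomposition $Y=Y_1\sqcup Y_2$. Position $0$ is regarded as occupied by invisible white beads, and beads moved to it disappear. A position accepts a colour if it carries no beads of the other colour. The moves are: 1. An uncoloured bead moves from $t+2n-2$ to a vacant $t>0$, provided that each multiple of $n-1$ strictly between carries at most one bead. 2. Two uncoloured beads at distinct positions with sum $2n-2$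 are removed, provided that position $n-1$ carries at most one bead. 3. A coloured bead moves from $t+2n-2$ to $t$, keeping its colour, if position $t+n-1$ is empty and $t$ accepts its colour. 4. A coloured bead moves from $t+2n-2$ to $t$, taking the opposite colour, if there is exactly one bead at position $t+n-1$ and $t$ accepts that opposite colour; the bead at $t+n-1$ changes its colour too. 5. Two coloured beads at the same position $t+n-1$ move together to $t$, taking any common colour that $t$ accepts. **Proposition.** The abacus is a bijection from $\mathcal Z_\Delta$ onto the set of all configurations. There is a map $\mathrm{core}:\mathcal Z_\Delta\to\mathcal C_\Delta$ such that: - For each $Y$, sequences of bar removals through Young walls lead from $Y$ to exactly one core, namely $\mathrm{core}(Y)$. - Each move on the abacus of a Young wall $Y$ gives the abacus of a Young wall obtained from $Y$ by a bar removal; $Y$ is a core if and only if no move is possible on its abacus; and sequences of moves lead from the abacus of $Y$ to exactly one configuration without possible moves, the abacus of $\mathrm{core}(Y)$. - $\mathrm{core}$ respects the decomposition: $\mathrm{core}(Y)_i=\mathrm{core}(Y_i)$ for $i=1,2$. - With $\mathcal P$ the set of all partitions, there is a bijection $\mathcal Z_\Delta\leftrightarrow\mathcal P^{n+1}\times\mathcal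 C_\Delta$, $Y\mapsto(\lambda_1,\dots,\lambda_{n+1},C)$, with $C=\mathrm{core}(Y)$, such that every sequence of bar removals from $Y$ to a core has exactly $\sum_i|\lambda_i|$ steps. It is compatible with the decomposition: $Y_1$ has the same $\lambda_1,\dots,\lambda_{n-2}$ as $Y$ and its other three partitions are empty; $Y_2$ has the same $\lambda_{n-1},\lambda_n,\lambda_{n+1}$ as $Y$ and its other partitions are empty. - There is a bijection $\mathcal C_\Delta\leftrightarrow\mathbb Z^n$, $C\mapsto(z_1,\dots,z_n)$, such that for $1\le i\le n-2$ the integer $z_i$ is the number of beads of $C$ on $R_i$ minus the number on $R_{2n-2-i}$; $z_{n-1},z_n$ depend only on the coloured beads of $C$; and $$|C|=\sum_{i=1}^{n-2}\bigl((n-1)z_i^2-(n-1-i)z_i\bigr)+(n-1)\sum_{i=n-1}^{n}(2z_i^2+z_i).$$ -/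

import Mathlib

/-! ## The Young wall pattern of type `D_n`

Columns are numbered `0, 1, 2, …` from left to right and rows `0, 1, 2, …` from bottom to top.
Rows divisible by `n - 2` are rows of half-blocks: each cell of such a row contains an upper-left
and a lower-right half-block.  All other cells contain one full block. -/

/-- The shape of a block: a full block, an upper-left half-block or a lower-right half-block. -/
inductive Piece
  | full
  | upper
  | lower
  deriving DecidableEq

/-- A (half-)block, given by its column, its row and its shape. -/
structure Block where
  col : ℕ
  row : ℕ
  piece : Piece

/-- The block belongs to the pattern: half-blocks lie exactly in the rows divisible by `n - 2`. -/
def Block.InPattern (n : ℕ) (b : Block) : Prop :=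
  b.piece = Piece.full ↔ ¬ (n - 2) ∣ b.row

/-- The grey half-blocks: the lower-right half-blocks of the bottom row. -/
def Block.IsGrey (b : Block) : Prop :=
  b.row = 0 ∧ b.piece = Piece.lower

/-- The label in `{0, …, n}` of a block of the pattern.  The rows are labelled periodically
`0/1, 2, …, n-2, (n-1)/n, n-2, …, 2`; in the even-numbered columns (the leftmost column being
number `0`) the upper-left half-blocks carry the labels `0` and `n-1`, and the two labels of a
cell of half-blocks are interchanged in the odd-numbered columns. -/
def Block.label (n : ℕ) (b : Block) : ℕ :=
  if b.row % (2 * (n - 2)) = 0 then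
    (if b.piece = Piece.upper ↔ Even b.col then 0 else 1)
  else if b.row % (2 * (n - 2)) = n - 2 then
    (if b.piece = Piece.upper ↔ Even b.col then n - 1 else n)
  else if b.row % (2 * (n - 2)) < n - 2 then b.row % (2 * (n - 2)) + 1
  else 2 * n - 3 - b.row % (2 * (n - 2))

/-! ## Young walls -/

/-- The column `x` of `Y` is full: at its top there is a full block or both half-blocks. -/
def IsFullColumn (n : ℕ) (Y : Set Block) (x : ℕ) : Prop :=
  ∃ r : ℕ, (∀ b : Block, b.InPattern n → b.col = x → b.row = r → b ∈ Y) ∧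
    ∀ b ∈ Y, b.col = x → b.row ≤ r

/-- The height of a column: the number of its white blocks and half-blocks. -/
noncomputable def columnHeight (Y : Set Block) (x : ℕ) : ℕ :=
  {b ∈ Y | b.col = x ∧ ¬ b.IsGrey}.ncard

/-- The (proper) Young walls of type `D_n`, as subsets of the pattern. -/
structure IsYoungWall (n : ℕ) (Y : Set Block) : Prop where
  subset_pattern : ∀ b ∈ Y, b.InPattern n
  grey_mem : ∀ b : Block, b.InPattern n → b.IsGrey → b ∈ Y
  finite_white : {b ∈ Y | ¬ b.IsGrey}.Finite
  supported : ∀ b ∈ Y, ∀ c : Block, c.InPattern n → c.col = b.col → c.row < b.row → c ∈ Y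
  left_closed : ∀ (x r : ℕ) (p : Piece), (⟨x + 1, r, p⟩ : Block) ∈ Y → (⟨x, r, p⟩ : Block) ∈ Y
  proper : ∀ x y : ℕ, IsFullColumn n Y x → IsFullColumn n Y y →
    columnHeight Y x = columnHeight Y y → x = y

/-- The set of Young walls of type `D_n`. -/
def YoungWall (n : ℕ) : Type :=
  {Y : Set Block // IsYoungWall n Y}

/-- The total weight: the number of white blocks and half-blocks. -/
noncomputable def YoungWall.size {n : ℕ} (Y : YoungWall n) : ℕ :=
  {b ∈ Y.1 | ¬ b.IsGrey}.ncard

/-! ## Bars and cores -/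

/-- Two blocks touch, that is, they meet as closed boxes in space: a full block is a unit cube, and
the two half-blocks of a cell are its front and its back half, of half the thickness. -/
def Block.Touch (b c : Block) : Prop :=
  b.col ≤ c.col + 1 ∧ c.col ≤ b.col + 1 ∧ b.row ≤ c.row + 1 ∧ c.row ≤ b.row + 1

/-- A set of blocks is connected if any two of its members are joined by a chain of members in
which consecutive blocks touch. -/
def BlocksConnected (B : Set Block) : Prop :=
  ∀ b ∈ B, ∀ c ∈ B, Relation.ReflTransGen (fun u v : Block => v ∈ B ∧ u.Touch v) b c

/-- A bar: a connected set of blocks in which each half-block label `0, 1, n-1, n` occurs once and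
each block label `2, …, n-2` occurs twice. -/
def IsBar (n : ℕ) (B : Set Block) : Prop :=
  BlocksConnected B ∧
    ∀ j ≤ n, {b ∈ B | b.label n = j}.ncard = if 2 ≤ j ∧ j ≤ n - 2 then 2 else 1

/-- The Young wall `Y'` arises from the Young wall `Y` by removing a bar. -/
def BarRemoval {n : ℕ} (Y Y' : YoungWall n) : Prop :=
  Y'.1 ⊆ Y.1 ∧ IsBar n (Y.1 \ Y'.1)

/-- `RemovesBars k Y Y'`: some sequence of exactly `k` bar removals through Young walls leads from
`Y` to `Y'`. -/
inductive RemovesBars {n : ℕ} : ℕ → YoungWall n → YoungWall n → Prop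
  | zero (Y : YoungWall n) : RemovesBars 0 Y Y
  | succ {k : ℕ} {Y Y' Y'' : YoungWall n} :
      BarRemoval Y Y' → RemovesBars k Y' Y'' → RemovesBars (k + 1) Y Y''

/-- A core Young wall: no bar can be removed from it. -/
def YoungWall.IsCore {n : ℕ} (Y : YoungWall n) : Prop :=
  ∀ Y' : YoungWall n, ¬ BarRemoval Y Y'

/-- The set of core Young walls of type `D_n`. -/
def CoreWall (n : ℕ) : Type :=
  {Y : YoungWall n // Y.IsCore}

/-! ## The abacus of type `D_n` -/

/-- The colours of the beads on the rulers `R_{n-1}` and `R_{2n-2}`. -/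
inductive Colour
  | white
  | black
  deriving DecidableEq

/-- The opposite colour. -/
def Colour.other : Colour → Colour
  | Colour.white => Colour.black
  | Colour.black => Colour.white

/-- An arrangement of beads on the positions `1, 2, 3, …`: the set of positions of the uncoloured
beads, and the number of beads of each colour at each position. -/
@[ext]
structure Beads where
  plain : Set ℕ
  coloured : Colour → ℕ → ℕ

/-- The number of coloured beads at position `s`. -/
def Beads.total (A : Beads) (s : ℕ) : ℕ :=
  A.coloured Colour.white s + A.coloured Colour.black s

/-- The rules of the abacus of type `D_n`. -/
structure Beads.IsConfig (n : ℕ) (A : Beads) : Prop where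
  plain_finite : A.plain.Finite
  plain_pos : ∀ s ∈ A.plain, 0 < s ∧ ¬ (n - 1) ∣ s
  coloured_finite : {s | A.total s ≠ 0}.Finite
  coloured_pos : ∀ s, A.total s ≠ 0 → 0 < s ∧ (n - 1) ∣ s
  one_colour : ∀ s, A.coloured Colour.white s = 0 ∨ A.coloured Colour.black s = 0

/-- The top of the column `x` is a single lower-right half-block. -/
def TopIsLower (Y : Set Block) (x : ℕ) : Prop :=
  ∃ r : ℕ, (⟨x, r, Piece.lower⟩ : Block) ∈ Y ∧ (⟨x, r, Piece.upper⟩ : Block) ∉ Y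

open Classical in
/-- The colour of the bead of a non-full column: white if its top half-block is lower-right and
the number of shorter full columns is even, or if its top half-block is upper-left and that number
is odd; black otherwise. -/
noncomputable def columnColour (n : ℕ) (Y : Set Block) (x : ℕ) : Colour :=
  if TopIsLower Y x ↔
      Even {y | IsFullColumn n Y y ∧ columnHeight Y y < columnHeight Y x}.ncard
  then Colour.white else Colour.black

/-- The abacus configuration of a Young wall: each non-empty column gives a bead at the position
equal to its height, uncoloured for a full column and coloured otherwise. -/
noncomputable def YoungWall.abacus {n : ℕ} (Y : YoungWall n) : Beads where
  plain := {s | ∃ x, IsFullColumn n Y.1 x ∧ columnHeight Y.1 x = s}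
  coloured := fun c s =>
    {x | ¬ IsFullColumn n Y.1 x ∧ 0 < columnHeight Y.1 x ∧ columnHeight Y.1 x = s ∧
      columnColour n Y.1 x = c}.ncard

/-- The uncoloured beads only. -/
def Beads.plainPart (A : Beads) : Beads := ⟨A.plain, fun _ _ => 0⟩

/-- The coloured beads only. -/
def Beads.colouredPart (A : Beads) : Beads := ⟨∅, A.coloured⟩

/-- The decomposition of a Young wall into its part `Y₁`, which has full columns only, and its part
`Y₂`, all of whose non-empty columns end in a single half-block: on the abacus, `Y₁` has the
uncoloured and `Y₂` the coloured beads of `Y`. -/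
def IsDecomp {n : ℕ} (Y Y₁ Y₂ : YoungWall n) : Prop :=
  Y₁.abacus = Y.abacus.plainPart ∧ Y₂.abacus = Y.abacus.colouredPart

/-- The number of beads on the ruler `R_k`, for `k` not divisible by `n - 1`. -/
noncomputable def Beads.onRuler (n : ℕ) (A : Beads) (k : ℕ) : ℕ :=
  {s ∈ A.plain | s ≡ k [MOD 2 * n - 2]}.ncard

/-! ## The moves on the abacus -/

/-- Take away `m` beads of colour `c` from position `s`. -/
def Beads.take (A : Beads) (c : Colour) (s m : ℕ) : Beads :=
  ⟨A.plain, fun d t => if d = c ∧ t = s then A.coloured d t - m else A.coloured d t⟩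

/-- Place `m` beads of colour `c` at position `s`; beads placed at position `0` disappear. -/
def Beads.put (A : Beads) (c : Colour) (s m : ℕ) : Beads :=
  ⟨A.plain, fun d t => if d = c ∧ t = s ∧ s ≠ 0 then A.coloured d t + m else A.coloured d t⟩

/-- A bead of colour `c` may be placed at position `s`: there is no bead of the other colour there,
where position `0` counts as occupied by (invisible) white beads. -/
def Beads.Accepts (A : Beads) (c : Colour) (s : ℕ) : Prop :=
  A.coloured c.other s = 0 ∧ (s = 0 → c = Colour.white)

/-- The moves on the abacus.
* `slide`: an uncoloured bead moves one place up on its ruler to a vacant position, if each position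
  divisible by `n - 1` on the way carries at most one bead.
* `cancel`: two uncoloured beads at positions with sum `2n-2` disappear, if position `n - 1` carries
  at most one bead.
* `jump`: a coloured bead moves `2n-2` positions up, keeping its colour, if the position half way is
  empty.
* `swap`: a coloured bead moves `2n-2` positions up and changes its colour, if there is exactly one
  bead at the position half way, which changes its colour as well.
* `pair`: two coloured beads at the same position move together `n-1` positions up. -/
inductive AbacusMove (n : ℕ) : Beads → Beads → Prop
  | slide (A : Beads) (t : ℕ) :
      0 < t → t + (2 * n - 2) ∈ A.plain → t ∉ A.plain →
      (∀ k, (n - 1) ∣ k → t < k → k < t + (2 * n - 2) → A.total k ≤ 1) →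
      AbacusMove n A ⟨insert t (A.plain \ {t + (2 * n - 2)}), A.coloured⟩
  | cancel (A : Beads) (s t : ℕ) :
      s ∈ A.plain → t ∈ A.plain → s < t → s + t = 2 * n - 2 → A.total (n - 1) ≤ 1 →
      AbacusMove n A ⟨A.plain \ {s, t}, A.coloured⟩
  | jump (A : Beads) (c : Colour) (t : ℕ) :
      1 ≤ A.coloured c (t + (2 * n - 2)) → A.total (t + (n - 1)) = 0 → A.Accepts c t →
      AbacusMove n A ((A.take c (t + (2 * n - 2)) 1).put c t 1)
  | swap (A : Beads) (c d : Colour) (t : ℕ) :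
      1 ≤ A.coloured c (t + (2 * n - 2)) → A.total (t + (n - 1)) = 1 →
      A.coloured d (t + (n - 1)) = 1 → A.Accepts c.other t →
      AbacusMove n A ((((A.take c (t + (2 * n - 2)) 1).put c.other t 1).take d
        (t + (n - 1)) 1).put d.other (t + (n - 1)) 1)
  | pair (A : Beads) (c d : Colour) (t : ℕ) :
      2 ≤ A.coloured c (t + (n - 1)) → A.Accepts d t →
      AbacusMove n A ((A.take c (t + (n - 1)) 2).put d t 2)

/-- No move is possible. -/
def Beads.IsFinal (n : ℕ) (A : Beads) : Prop :=
  ∀ A' : Beads, ¬ AbacusMove n A A'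

/-- The set `𝒫` of ordinary partitions (of arbitrary natural numbers). -/
abbrev OrdPartition : Type := Σ m : ℕ, Nat.Partition m

/-- The weight `|p|` of a partition. -/
def OrdPartition.weight (p : OrdPartition) : ℕ := p.1

/-!
Write `n = q + 2`.

**Walls as profiles.** Number the places of a column `0, 1, 2, …` from bottom to top, the two
half-blocks of a cell counting as two places. A Young wall is then given by a *profile*: the
decreasing function `G`, where `G v` is the number of columns of height at least `v`, and for each
row of half-blocks the shape that comes first (`IsYoungWall.exists_profile`). On the abacus, `G v` is
the number of beads at positions `≥ v` (for `v ≥ 1`), the condition that full columns have distinct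
heights says that uncoloured beads do not share a position, and the colours of the coloured beads
are a coding of the shapes. So every configuration belongs to exactly one Young wall (`wallOf`, `abacus_bijOn`).

**Configurations as charges and partitions.** The beads on the opposite rulers `R_i` and `R_{2n-2-i}`
form a Maya diagram, with the beads of the second ruler as holes at negative places; Maya diagrams
are classified by a charge in `ℤ` and a partition (`mayaEquiv`). The coloured beads are an integer
at each multiple of `n - 1`, with the sign for the colour. After the sign twist `twist`, which takes
the parity of the number of coloured beads beyond a position into account, split each integer into a
parity part and a number of pairs. The parity parts form two more Maya diagrams, one for the odd and
one for the even multiples of `n - 1`, and the pairs form a partition (`colouredEquiv`). The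
invisible beads at position `0` are what makes the sum of these two charges even, and so gives two
independent integers. Altogether Young walls correspond to `n` charges and `n + 1` partitions
(`wallCode`), and the size of the wall is the quadratic form in the charges plus `2n - 2` times the
total weight of the partitions (`size_eq`).

**Bars.** Removing a bar changes the numbers of blocks of the `n + 1` labels by fixed amounts. These
numbers determine the charges: a difference of numbers for successive labels is the difference of
the numbers of beads on two opposite rulers (Abel summation, `classCount_sub_classCount`), and the
differences for the labels `0, 1` and for `n - 1, n` are, up to signs and a shift that depend on the
parity of the number of uncoloured beads, the charges of the two Maya diagrams of the coloured beads
(`classDiff_one`, `classDiff_last`). Hence a bar removal preserves the charges, and,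
comparing sizes, lowers the total weight of the partitions by exactly one (`wallCode_of_barRemoval`).

**Moves.** Conversely each move on the abacus removes a set with one or two blocks in each of a
range of successive levels, which is connected (`IsStrip.connected`), and preserves the charges, so
that it removes a bar (`AbacusMove.exists_barRemoval`). If no move is possible, then all partitions
are empty (`wallWeight_eq_zero_of_isFinal`). So the cores are the walls with empty partitions, they
are parametrized by their charges, and every maximal sequence of moves or of bar removals leads to
the core with the charges of the given wall, in as many steps as the total weight says. The
compatibility with the decomposition into full and non-full columns is visible from the code.
-/

/-! ### Maya diagrams: charge and partition -/

open Finset in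
theorem strictMono_fin_add_le {k : ℕ} {f : Fin k → ℕ} (hf : StrictMono f) {i j : Fin k}
    (hij : i ≤ j) : f i + (j : ℕ) ≤ f j + (i : ℕ) := by
  obtain ⟨i, hi⟩ := i
  obtain ⟨j, hj⟩ := j
  obtain ⟨d, rfl⟩ := Nat.exists_eq_add_of_le (show i ≤ j from hij)
  induction d with
  | zero => simp
  | succ d ih =>
    have h1 := ih (by omega) (by simp)
    have h2 : f ⟨i + d, by omega⟩ < f ⟨i + (d + 1), hj⟩ := hf (by simp)
    simp only at h1 ⊢
    omega

theorem exists_equiv_finset_strictMono (k s : ℕ) :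
    Nonempty ({T : Finset ℕ // T.card = k ∧ ∑ t ∈ T, t = s} ≃
      {f : Fin k → ℕ // StrictMono f ∧ ∑ i, f i = s}) := by
  refine ⟨(Equiv.ofBijective (fun f => ⟨Finset.univ.map ⟨f.1, f.2.1.injective⟩, by simp,
    by simpa using f.2.2⟩) ⟨?_, ?_⟩).symm⟩
  · rintro ⟨f, hf, _⟩ ⟨g, hg, _⟩ h
    have h' := congrArg (fun T : Finset ℕ => (T : Set ℕ)) (Subtype.ext_iff.1 h)
    simp only [Finset.coe_map, Finset.coe_univ, Set.image_univ, Function.Embedding.coeFn_mk] at h'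
    exact Subtype.ext ((StrictMono.range_inj hf hg).1 h')
  · rintro ⟨T, hT, hs⟩
    refine ⟨⟨T.orderEmbOfFin hT, (T.orderEmbOfFin hT).strictMono, ?_⟩, ?_⟩
    · refine Eq.trans ?_ hs
      conv_rhs => rw [← Finset.map_orderEmbOfFin_univ T hT, Finset.sum_map]
      rfl
    · exact Subtype.ext (Finset.map_orderEmbOfFin_univ T hT)

theorem exists_equiv_strictMono_monotone (k w : ℕ) :
    Nonempty ({f : Fin k → ℕ // StrictMono f ∧ ∑ i, f i = w + ∑ i ∈ Finset.range k, i} ≃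
      {f : Fin k → ℕ // Monotone f ∧ ∑ i, f i = w}) := by
  refine ⟨(Equiv.ofBijective (fun f => ⟨fun i => f.1 i + i,
    fun i j hij => add_lt_add_of_le_of_lt (f.2.1 hij.le) hij,
    by rw [Finset.sum_add_distrib, f.2.2, Fin.sum_univ_eq_sum_range (fun i => i)]⟩)
    ⟨?_, ?_⟩).symm⟩
  · rintro ⟨f, hf, _⟩ ⟨g, hg, _⟩ h
    refine Subtype.ext (funext fun i => ?_)
    have := congrFun (Subtype.ext_iff.1 h) i
    simpa using this
  · rintro ⟨f, hf, hs⟩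
    have hle : ∀ i : Fin k, (i : ℕ) ≤ f i := by
      intro i
      have h0 : 0 < k := i.pos
      have := strictMono_fin_add_le hf (i := ⟨0, h0⟩) (j := i) (Nat.zero_le _)
      simp only [add_zero] at this
      omega
    refine ⟨⟨fun i => f i - i, ?_, ?_⟩, ?_⟩
    · intro i j hij
      have := strictMono_fin_add_le hf hij
      have := hle i
      have := hle j
      simp only
      omega
    · have : ∑ i, (f i - (i : ℕ)) + ∑ i ∈ Finset.range k, i = w + ∑ i ∈ Finset.range k, i := by
        rw [← hs, ← Fin.sum_univ_eq_sum_range (fun i => i), ← Finset.sum_add_distrib]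
        exact Finset.sum_congr rfl fun i _ => Nat.sub_add_cancel (hle i)
      exact Nat.add_right_cancel this
    · exact Subtype.ext (funext fun i => Nat.sub_add_cancel (hle i))

theorem exists_equiv_monotone_partition {k w : ℕ} (hk : w ≤ k) :
    Nonempty ({f : Fin k → ℕ // Monotone f ∧ ∑ i, f i = w} ≃ Nat.Partition w) := by
  refine ⟨Equiv.ofBijective
    (fun f => Nat.Partition.ofSums w (Finset.univ.val.map f.1) f.2.2) ⟨?_, ?_⟩⟩
  · rintro ⟨f, hf, hfs⟩ ⟨g, hg, hgs⟩ h
    have h0 := congrArg Nat.Partition.parts h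
    simp only [Nat.Partition.ofSums_parts] at h0
    have h1 : Finset.univ.val.map f = Finset.univ.val.map g := by
      have key : ∀ s : Multiset ℕ, s = s.filter (· ≠ 0) +
          Multiset.replicate (s.card - (s.filter (· ≠ 0)).card) 0 := by
        intro s
        conv_lhs => rw [← Multiset.filter_add_not (· ≠ 0) s]
        congr 1
        rw [Multiset.eq_replicate]
        constructor
        · have := congrArg Multiset.card (Multiset.filter_add_not (· ≠ 0) s)
          rw [Multiset.card_add] at this
          omega
        · intro b hb
          simpa using (Multiset.mem_filter.1 hb).2
      rw [key (Finset.univ.val.map f), key (Finset.univ.val.map g), h0]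
      simp
    rw [Fin.univ_val_map, Fin.univ_val_map, Multiset.coe_eq_coe] at h1
    have h2 := List.Perm.eq_of_sortedLE (List.sortedLE_ofFn_iff.2 hf)
      (List.sortedLE_ofFn_iff.2 hg) h1
    exact Subtype.ext (List.ofFn_injective h2)
  · intro p
    have hc : p.parts.card ≤ w := by
      have := Multiset.card_nsmul_le_sum (s := p.parts) (a := 1) (fun x hx => p.parts_pos hx)
      rw [p.parts_sum] at this
      simpa using this
    obtain ⟨s, hs⟩ : ∃ s : Multiset ℕ, s = p.parts + Multiset.replicate (k - p.parts.card) 0 :=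
      ⟨_, rfl⟩
    have hlen : (s.sort (· ≤ ·)).length = k := by
      rw [Multiset.length_sort, hs, Multiset.card_add, Multiset.card_replicate]
      omega
    have hfs : Finset.univ.val.map (fun i : Fin k => (s.sort (· ≤ ·)).get (i.cast hlen.symm)) = s := by
      conv_rhs => rw [← Multiset.sort_eq s (· ≤ ·)]
      rw [Fin.univ_val_map, Multiset.coe_eq_coe]
      apply List.Perm.of_eq
      apply List.ext_get
      · simp [hlen]
      · intro i h1 h2
        simp
    refine ⟨⟨fun i => (s.sort (· ≤ ·)).get (i.cast hlen.symm), ?_, ?_⟩, ?_⟩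
    · intro i j hij
      exact List.sortedLE_iff_monotone_get.1 (Multiset.pairwise_sort s (· ≤ ·)).sortedLE hij
    · have := congrArg Multiset.sum hfs
      have hsum : s.sum = w := by
        rw [hs, Multiset.sum_add, p.parts_sum, Multiset.sum_replicate, smul_zero, add_zero]
      exact this.trans hsum
    · apply Nat.Partition.ext
      refine (congrArg (Multiset.filter (· ≠ 0)) hfs).trans ?_
      rw [hs, Multiset.filter_add, Multiset.filter_eq_self.2,
        Multiset.filter_eq_nil.2, add_zero]
      · intro a ha
        simp [Multiset.eq_of_mem_replicate ha]
      · intro a ha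
        exact (p.parts_pos ha).ne'

/-- A pair `(A, B)` of finite sets of natural numbers encodes the Maya diagram in which a position
`a ≥ 0` is occupied if and only if `a ∈ A`, and a position `-1 - b < 0` is vacant if and only if
`b ∈ B`.  Its energy is measured relative to the diagram whose occupied positions are the
negative ones. -/
def mayaEnergy (p : Finset ℕ × Finset ℕ) : ℕ := ∑ a ∈ p.1, a + ∑ b ∈ p.2, (b + 1)

/-- The charge of a Maya diagram. -/
def mayaCharge (p : Finset ℕ × Finset ℕ) : ℤ := (p.1.card : ℤ) - p.2.card

theorem sum_range_card_le (s : Finset ℕ) : ∑ i ∈ Finset.range s.card, i ≤ ∑ x ∈ s, x := by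
  conv_rhs => rw [← Finset.map_orderEmbOfFin_univ s rfl, Finset.sum_map]
  rw [← Fin.sum_univ_eq_sum_range (fun i => i)]
  refine Finset.sum_le_sum fun i _ => ?_
  have := strictMono_fin_add_le (s.orderEmbOfFin rfl).strictMono (i := ⟨0, i.pos⟩) (j := i)
    (Nat.zero_le _)
  simp only [add_zero] at this
  exact le_trans (Nat.le_add_left _ _) this

theorem two_mul_sum_range_int (k : ℕ) :
    2 * ((∑ i ∈ Finset.range k, i : ℕ) : ℤ) = (k : ℤ) * (k - 1) := by
  induction k with
  | zero => simp
  | succ k ih => rw [Finset.sum_range_succ]; push_cast at ih ⊢; linarith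

/-- The energy of a Maya diagram of charge `c` is at least the minimal energy `c (c - 1) / 2`, and
differs from it by an integer. -/
theorem exists_mayaEnergy_eq (p : Finset ℕ × Finset ℕ) :
    ∃ w : ℕ, 2 * (mayaEnergy p : ℤ) = mayaCharge p * (mayaCharge p - 1) + 2 * w := by
  obtain ⟨A, B⟩ := p
  have hA := two_mul_sum_range_int A.card
  have hB := two_mul_sum_range_int B.card
  have hA' : ((∑ i ∈ Finset.range A.card, i : ℕ) : ℤ) ≤ ((∑ a ∈ A, a : ℕ) : ℤ) := by
    exact_mod_cast sum_range_card_le A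
  have hB' : ((∑ i ∈ Finset.range B.card, i : ℕ) : ℤ) ≤ ((∑ a ∈ B, a : ℕ) : ℤ) := by
    exact_mod_cast sum_range_card_le B
  have hE : (mayaEnergy (A, B) : ℤ)
      = ((∑ a ∈ A, a : ℕ) : ℤ) + ((∑ a ∈ B, a : ℕ) : ℤ) + B.card := by
    simp [mayaEnergy, Finset.sum_add_distrib]
    ring
  obtain ⟨d, hd⟩ := Int.even_mul_pred_self (mayaCharge (A, B))
  have hle : mayaCharge (A, B) * (mayaCharge (A, B) - 1) ≤ 2 * (mayaEnergy (A, B) : ℤ) := by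
    have hab : (0 : ℤ) ≤ (A.card : ℤ) * B.card := by positivity
    have : mayaCharge (A, B) * (mayaCharge (A, B) - 1) = (A.card : ℤ) * (A.card - 1)
        + B.card * (B.card - 1) + 2 * B.card - 2 * (A.card * B.card) := by
      simp only [mayaCharge]
      ring
    rw [this, hE]
    linarith
  refine ⟨((mayaEnergy (A, B) : ℤ) - d).toNat, ?_⟩
  rw [hd] at hle ⊢
  rw [Int.toNat_of_nonneg (by linarith)]
  ring

/-- The Maya diagrams of charge `c` and excess energy `w` correspond to the finite sets of `k = L + c`
natural numbers with excess sum `w`: shift the occupied positions by a large number `L`, and forget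
the positions that remain negative. -/
theorem exists_equiv_maya_finset (c : ℤ) (w L k : ℕ)
    (hL : c * (c - 1) + 2 * w ≤ 2 * L) (hk : (k : ℤ) = L + c) :
    Nonempty ({p : Finset ℕ × Finset ℕ // mayaCharge p = c ∧
        2 * (mayaEnergy p : ℤ) = c * (c - 1) + 2 * w} ≃
      {T : Finset ℕ // T.card = k ∧ ∑ t ∈ T, t = w + ∑ i ∈ Finset.range k, i}) := by
  -- the finite set of occupied positions, and its inverse
  let F : Finset ℕ × Finset ℕ → Finset ℕ := fun p =>
    p.1.map (addRightEmbedding L) ∪ (Finset.range L).filter (fun x => L - 1 - x ∉ p.2)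
  let P : Finset ℕ → Finset ℕ × Finset ℕ := fun T =>
    ((T.filter (L ≤ ·)).image (· - L), (Finset.range L).filter (fun b => L - 1 - b ∉ T))
  have memF : ∀ p x, x ∈ F p ↔ (L ≤ x ∧ x - L ∈ p.1) ∨ (x < L ∧ L - 1 - x ∉ p.2) := by
    intro p x
    simp only [F, Finset.mem_union, Finset.mem_map, addRightEmbedding_apply, Finset.mem_filter,
      Finset.mem_range]
    constructor
    · rintro (⟨a, ha, rfl⟩ | h)
      · left; simpa using ha
      · right; exact h
    · rintro (⟨h1, h2⟩ | h)
      · left; exact ⟨x - L, h2, by omega⟩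
      · right; exact h
  have memP1 : ∀ T a, a ∈ (P T).1 ↔ a + L ∈ T := by
    intro T a
    simp only [P, Finset.mem_image, Finset.mem_filter]
    constructor
    · rintro ⟨x, ⟨h1, h2⟩, rfl⟩
      rwa [Nat.sub_add_cancel h2]
    · intro h
      exact ⟨a + L, ⟨h, by omega⟩, by omega⟩
  have memP2 : ∀ T b, b ∈ (P T).2 ↔ b < L ∧ L - 1 - b ∉ T := by
    intro T b
    simp [P]
  have PF : ∀ p, (∀ b ∈ p.2, b < L) → P (F p) = p := by
    intro p hp
    refine Prod.ext (Finset.ext fun a => ?_) (Finset.ext fun b => ?_)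
    · rw [memP1, memF]
      simp
    · rw [memP2, memF]
      constructor
      · rintro ⟨h1, h2⟩
        by_contra h3
        exact h2 (Or.inr ⟨by omega, by rwa [show L - 1 - (L - 1 - b) = b by omega]⟩)
      · intro h
        have := hp b h
        refine ⟨this, ?_⟩
        rintro (h2 | h2)
        · omega
        · exact h2.2 (by rwa [show L - 1 - (L - 1 - b) = b by omega])
  have FP : ∀ T, F (P T) = T := by
    intro T
    refine Finset.ext fun x => ?_
    rw [memF, memP1, memP2]
    by_cases hx : x < L
    · rw [show L - 1 - (L - 1 - x) = x by omega]
      have : L - 1 - x < L := by omega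
      have h3 : ¬ L ≤ x := by omega
      simp [hx, this, h3]
    · have h3 : L ≤ x := by omega
      rw [Nat.sub_add_cancel h3]
      simp [hx, h3]
  -- every occupied position moves up by `L`, so cardinality and sum change by known amounts
  have num : ∀ p, (∀ b ∈ p.2, b < L) → ((F p).card : ℤ) = L + mayaCharge p ∧
      2 * ((∑ t ∈ F p, t : ℕ) : ℤ)
        = 2 * mayaEnergy p + 2 * L * mayaCharge p + L * (L - 1) := by
    rintro ⟨A, B⟩ hB
    have hdisj : Disjoint (A.map (addRightEmbedding L))
        ((Finset.range L).filter (fun x => L - 1 - x ∉ B)) := by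
      rw [Finset.disjoint_left]
      intro x hx hx'
      simp only [Finset.mem_map, addRightEmbedding_apply, Finset.mem_filter,
        Finset.mem_range] at hx hx'
      obtain ⟨a, _, rfl⟩ := hx
      omega
    have hB' : (Finset.range L).filter (fun x => L - 1 - x ∈ B) = B.image (fun b => L - 1 - b) := by
      ext x
      simp only [Finset.mem_filter, Finset.mem_range, Finset.mem_image]
      constructor
      · rintro ⟨h1, h2⟩
        exact ⟨_, h2, by omega⟩
      · rintro ⟨b, hb, rfl⟩
        have := hB b hb
        exact ⟨by omega, by rwa [show L - 1 - (L - 1 - b) = b by omega]⟩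
    have hinj : Set.InjOn (fun b => L - 1 - b) (B : Set ℕ) := by
      intro x hx y hy hxy
      have := hB x hx
      have := hB y hy
      simp only at hxy
      omega
    constructor
    · have h1 := Finset.card_filter_add_card_filter_not (s := Finset.range L)
        (fun x => L - 1 - x ∈ B)
      rw [hB', Finset.card_image_of_injOn hinj, Finset.card_range] at h1
      simp only [F, mayaCharge]
      rw [Finset.card_union_of_disjoint hdisj, Finset.card_map]
      push_cast
      omega
    · have h1 := Finset.sum_filter_add_sum_filter_not (Finset.range L)
        (fun x => L - 1 - x ∈ B) (fun x => x)
      rw [hB', Finset.sum_image hinj] at h1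
      have h2 : ∑ b ∈ B, (L - 1 - b) + ∑ b ∈ B, (b + 1) = B.card * L := by
        rw [← Finset.sum_add_distrib, Finset.card_eq_sum_ones, Finset.sum_mul]
        refine Finset.sum_congr rfl fun b hb => ?_
        have := hB b hb
        omega
      have h3 := two_mul_sum_range_int L
      simp only [F, mayaCharge, mayaEnergy]
      rw [Finset.sum_union hdisj, Finset.sum_map]
      simp only [addRightEmbedding_apply, Finset.sum_add_distrib (f := fun x => x)
        (g := fun _ => L), Finset.sum_const, smul_eq_mul] at h1 h2 ⊢
      zify at h1 h2 h3 ⊢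
      linarith
  have hk' := two_mul_sum_range_int k
  -- a hole beyond `L` would alone exceed the energy
  have hlt : ∀ p, 2 * (mayaEnergy p : ℤ) = c * (c - 1) + 2 * w → ∀ b ∈ p.2, b < L := by
    intro p hp b hb
    have h1 : b + 1 ≤ ∑ b ∈ p.2, (b + 1) :=
      Finset.single_le_sum (f := fun b => b + 1) (fun _ _ => Nat.zero_le _) hb
    have h2 : b + 1 ≤ mayaEnergy p := h1.trans (Nat.le_add_left _ _)
    zify at h2 ⊢
    linarith
  refine ⟨⟨fun p => ⟨F p.1, ?_⟩, fun T => ⟨P T.1, ?_⟩, fun p => ?_, fun T => ?_⟩⟩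
  · obtain ⟨p, hc, hE⟩ := p
    obtain ⟨h1, h2⟩ := num p (hlt p hE)
    rw [hc] at h1 h2
    have h3 : ((F p).card : ℤ) = k := by rw [h1, hk]
    refine ⟨by exact_mod_cast h3, ?_⟩
    zify
    rw [hk] at hk'
    rw [Nat.cast_sum] at h2 hk'
    nlinarith
  · obtain ⟨T, hc, hE⟩ := T
    obtain ⟨h1, h2⟩ := num (P T) (fun b hb => ((memP2 T b).1 hb).1)
    rw [FP] at h1 h2
    have h3 : mayaCharge (P T) = c := by
      rw [hc] at h1
      linarith
    refine ⟨h3, ?_⟩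
    rw [h3] at h2
    rw [hk] at hk'
    zify at hE
    rw [Nat.cast_sum] at h2 hk'
    nlinarith
  · exact Subtype.ext (PF p.1 (hlt p.1 p.2.2))
  · exact Subtype.ext (FP T.1)

/-- Maya diagrams are classified by their charge and a partition, whose weight is the excess of the
energy over the minimal energy `c (c - 1) / 2` for the charge `c`. -/
theorem exists_maya_equiv : ∃ Φ : Finset ℕ × Finset ℕ ≃ ℤ × OrdPartition, ∀ p,
    (Φ p).1 = mayaCharge p ∧
    2 * (mayaEnergy p : ℤ) = mayaCharge p * (mayaCharge p - 1) + 2 * (Φ p).2.weight := by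
  choose w hw using exists_mayaEnergy_eq
  have hfib : ∀ y : ℤ × ℕ, Nonempty
      ({p : Finset ℕ × Finset ℕ // (mayaCharge p, w p) = y} ≃ Nat.Partition y.2) := by
    rintro ⟨c, v⟩
    let L : ℕ := (c * (c - 1)).natAbs + v + c.natAbs
    obtain ⟨k, hk⟩ : ∃ k : ℕ, (k : ℤ) = L + c := ⟨(L + c).toNat, by omega⟩
    obtain ⟨e1⟩ := exists_equiv_maya_finset c v L k (by
      simp only [L]
      push_cast
      linarith [le_abs_self (c * (c - 1)), abs_nonneg (c * (c - 1)), abs_nonneg c]) hk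
    obtain ⟨e2⟩ := exists_equiv_finset_strictMono k (v + ∑ i ∈ Finset.range k, i)
    obtain ⟨e3⟩ := exists_equiv_strictMono_monotone k v
    obtain ⟨e4⟩ := exists_equiv_monotone_partition (k := k) (w := v) (by omega)
    refine ⟨(Equiv.subtypeEquivRight fun p => ?_).trans (e1.trans (e2.trans (e3.trans e4)))⟩
    rw [Prod.mk.injEq]
    constructor
    · rintro ⟨rfl, rfl⟩
      exact ⟨rfl, hw p⟩
    · rintro ⟨rfl, h⟩
      have := hw p
      exact ⟨rfl, by omega⟩
  let e := fun y => (hfib y).some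
  refine ⟨(Equiv.sigmaFiberEquiv fun p => (mayaCharge p, w p)).symm.trans
    ((Equiv.sigmaCongrRight e).trans
      ⟨fun x => (x.1.1, ⟨x.1.2, x.2⟩), fun x => ⟨(x.1, x.2.1), x.2.2⟩, fun _ => rfl,
        fun _ => rfl⟩), fun p => ⟨rfl, hw p⟩⟩

/-! ### Coding coloured beads by two charges and three partitions -/

/-- The classification of Maya diagrams by charge and partition. -/
noncomputable def mayaEquiv : Finset ℕ × Finset ℕ ≃ ℤ × OrdPartition :=
  exists_maya_equiv.choose

theorem mayaEquiv_fst (p : Finset ℕ × Finset ℕ) : (mayaEquiv p).1 = mayaCharge p :=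
  (exists_maya_equiv.choose_spec p).1

theorem two_mul_mayaEnergy (p : Finset ℕ × Finset ℕ) : 2 * (mayaEnergy p : ℤ) =
    mayaCharge p * (mayaCharge p - 1) + 2 * (mayaEquiv p).2.weight :=
  (exists_maya_equiv.choose_spec p).2

theorem eq_range_card_of_pred_mem {s : Finset ℕ} (h : ∀ x, x + 1 ∈ s → x ∈ s) :
    s = Finset.range s.card := by
  have hdown : ∀ d x, x + d ∈ s → x ∈ s := by
    intro d
    induction d with
    | zero => exact fun x hx => hx
    | succ d ih => exact fun x hx => ih x (h _ hx)
  have hsub : ∀ x ∈ s, x < s.card := by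
    intro x hx
    have : Finset.range (x + 1) ⊆ s := by
      intro y hy
      have hy' : y ≤ x := Nat.lt_succ_iff.1 (Finset.mem_range.1 hy)
      exact hdown (x - y) y (by rwa [Nat.add_sub_cancel' hy'])
    simpa using Finset.card_le_card this
  exact Finset.eq_of_subset_of_card_le (fun x hx => Finset.mem_range.2 (hsub x hx)) (by simp)

/-- A Maya diagram in which no particle can move down has the empty partition. -/
theorem mayaEquiv_weight_eq_zero {p : Finset ℕ × Finset ℕ} (h1 : ∀ x, x + 1 ∈ p.1 → x ∈ p.1)
    (h2 : ∀ x, x + 1 ∈ p.2 → x ∈ p.2) (h0 : ¬ (0 ∈ p.1 ∧ 0 ∈ p.2)) :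
    (mayaEquiv p).2.weight = 0 := by
  obtain ⟨A, B⟩ := p
  have hA := eq_range_card_of_pred_mem h1
  have hB := eq_range_card_of_pred_mem h2
  have hE := two_mul_mayaEnergy (A, B)
  have hsA := two_mul_sum_range_int A.card
  have hsB := two_mul_sum_range_int B.card
  have hprod : (A.card : ℤ) * B.card = 0 := by
    by_contra hne
    apply h0
    simp only at hA hB ⊢
    rw [hA, hB, Finset.mem_range, Finset.mem_range]
    constructor <;> rw [Nat.pos_iff_ne_zero] <;> intro h <;> simp [h] at hne
  have hEn : (mayaEnergy (A, B) : ℤ) = ((∑ i ∈ Finset.range A.card, i : ℕ) : ℤ)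
      + ((∑ i ∈ Finset.range B.card, i : ℕ) : ℤ) + B.card := by
    simp only at hA hB
    rw [← hA, ← hB]
    simp [mayaEnergy, Finset.sum_add_distrib]
    ring
  rw [hEn] at hE
  simp only [mayaCharge] at hE
  have : (2 : ℤ) * ((mayaEquiv (A, B)).2.weight : ℤ) = 0 := by nlinarith
  omega

theorem ordPartition_ext {p p' : OrdPartition} (h : p.2.parts = p'.2.parts) : p = p' := by
  obtain ⟨a, p⟩ := p
  obtain ⟨b, p'⟩ := p'
  have hab : a = b := by rw [← p.parts_sum, ← p'.parts_sum]; exact congrArg _ h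
  subst hab
  exact congrArg _ (Nat.Partition.ext h)

theorem ordPartition_eq_of_weight_eq_zero {p p' : OrdPartition} (h : p.weight = 0)
    (h' : p'.weight = 0) : p = p' := by
  obtain ⟨a, p⟩ := p
  obtain ⟨b, p'⟩ := p'
  obtain rfl : a = 0 := h
  obtain rfl : b = 0 := h'
  exact ordPartition_ext (by simp)

/-- The partition with `r k` parts equal to `k + 1`. -/
noncomputable def multiplicityEquiv : (ℕ →₀ ℕ) ≃ OrdPartition where
  toFun r := ⟨_, ⟨(Finsupp.toMultiset r).map (· + 1), by
    intro i hi
    obtain ⟨k, _, rfl⟩ := Multiset.mem_map.1 hi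
    omega, rfl⟩⟩
  invFun p := Multiset.toFinsupp (p.2.parts.map (· - 1))
  left_inv r := by
    simp [Multiset.map_map]
  right_inv p := by
    apply ordPartition_ext
    simp only [Multiset.toFinsupp_toMultiset, Multiset.map_map]
    conv_rhs => rw [← Multiset.map_id p.2.parts]
    refine Multiset.map_congr rfl fun x hx => ?_
    exact Nat.sub_add_cancel (p.2.parts_pos hx)

theorem multiplicityEquiv_weight (r : ℕ →₀ ℕ) :
    (multiplicityEquiv r).weight = r.sum fun k a => a * (k + 1) := by
  change ((Finsupp.toMultiset r).map (· + 1)).sum = _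
  induction r using Finsupp.induction_linear with
  | zero => simp
  | add f g hf hg =>
    rw [Finsupp.sum_add_index' (by simp) (by intros; ring), ← hf, ← hg]
    simp
  | single a b => simp [Finsupp.sum_single_index, Multiset.sum_nsmul, mul_add]

/-- The halves of the even, respectively odd, members of a set. -/
def evenHalf (S : Finset ℕ) : Finset ℕ := (S.filter (fun x => x % 2 = 0)).image (· / 2)

/-- See `evenHalf`. -/
def oddHalf (S : Finset ℕ) : Finset ℕ := (S.filter (fun x => x % 2 = 1)).image (· / 2)

/-- The set with given halves. -/
def interleave (X Y : Finset ℕ) : Finset ℕ :=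
  X.image (fun a => 2 * a) ∪ Y.image (fun a => 2 * a + 1)

theorem mem_evenHalf {S : Finset ℕ} {a : ℕ} : a ∈ evenHalf S ↔ 2 * a ∈ S := by
  simp only [evenHalf, Finset.mem_image, Finset.mem_filter]
  constructor
  · rintro ⟨x, ⟨h1, h2⟩, rfl⟩
    rwa [show 2 * (x / 2) = x by omega]
  · intro h
    exact ⟨2 * a, ⟨h, by omega⟩, by omega⟩

theorem mem_oddHalf {S : Finset ℕ} {a : ℕ} : a ∈ oddHalf S ↔ 2 * a + 1 ∈ S := by
  simp only [oddHalf, Finset.mem_image, Finset.mem_filter]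
  constructor
  · rintro ⟨x, ⟨h1, h2⟩, rfl⟩
    rwa [show 2 * (x / 2) + 1 = x by omega]
  · intro h
    exact ⟨2 * a + 1, ⟨h, by omega⟩, by omega⟩

theorem even_mem_interleave {X Y : Finset ℕ} {a : ℕ} : 2 * a ∈ interleave X Y ↔ a ∈ X := by
  simp only [interleave, Finset.mem_union, Finset.mem_image]
  constructor
  · rintro (⟨x, h1, h2⟩ | ⟨x, h1, h2⟩)
    · rwa [show a = x by omega]
    · omega
  · exact fun h => Or.inl ⟨a, h, rfl⟩

theorem odd_mem_interleave {X Y : Finset ℕ} {a : ℕ} : 2 * a + 1 ∈ interleave X Y ↔ a ∈ Y := by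
  simp only [interleave, Finset.mem_union, Finset.mem_image]
  constructor
  · rintro (⟨x, h1, h2⟩ | ⟨x, h1, h2⟩)
    · omega
    · rwa [show a = x by omega]
  · exact fun h => Or.inr ⟨a, h, rfl⟩

theorem evenHalf_interleave (X Y : Finset ℕ) : evenHalf (interleave X Y) = X := by
  ext a; rw [mem_evenHalf, even_mem_interleave]

theorem oddHalf_interleave (X Y : Finset ℕ) : oddHalf (interleave X Y) = Y := by
  ext a; rw [mem_oddHalf, odd_mem_interleave]

theorem interleave_halves (S : Finset ℕ) : interleave (evenHalf S) (oddHalf S) = S := by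
  ext a
  obtain ⟨b, rfl | rfl⟩ : ∃ b, a = 2 * b ∨ a = 2 * b + 1 := ⟨a / 2, by omega⟩
  · rw [even_mem_interleave, mem_evenHalf]
  · rw [odd_mem_interleave, mem_oddHalf]

theorem card_interleave (X Y : Finset ℕ) : (interleave X Y).card = X.card + Y.card := by
  rw [interleave, Finset.card_union_of_disjoint, Finset.card_image_of_injective,
    Finset.card_image_of_injective]
  · intro a b h; simp only at h; omega
  · intro a b h; simp only at h; omega
  · rw [Finset.disjoint_left]
    simp only [Finset.mem_image]
    rintro x ⟨a, _, rfl⟩ ⟨b, _, h⟩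
    omega

/-- Shift a set up by one, and adjoin `0` if and only if `b` holds. -/
def shiftInsert (b : Prop) [Decidable b] (X : Finset ℕ) : Finset ℕ :=
  if b then insert 0 (X.image (· + 1)) else X.image (· + 1)

/-- Shift a set down by one, discarding `0`. -/
def unshift (X : Finset ℕ) : Finset ℕ := (X.filter (· ≠ 0)).image (· - 1)

theorem zero_mem_shiftInsert {b : Prop} [Decidable b] {X : Finset ℕ} :
    0 ∈ shiftInsert b X ↔ b := by
  unfold shiftInsert
  split_ifs with h <;> simp [h]

theorem succ_mem_shiftInsert {b : Prop} [Decidable b] {X : Finset ℕ} {a : ℕ} :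
    a + 1 ∈ shiftInsert b X ↔ a ∈ X := by
  unfold shiftInsert
  split_ifs with h <;> simp

theorem mem_unshift {X : Finset ℕ} {a : ℕ} : a ∈ unshift X ↔ a + 1 ∈ X := by
  simp only [unshift, Finset.mem_image, Finset.mem_filter]
  constructor
  · rintro ⟨x, ⟨h1, h2⟩, rfl⟩
    rwa [Nat.sub_add_cancel (Nat.pos_of_ne_zero h2)]
  · intro h
    exact ⟨a + 1, ⟨h, by omega⟩, by omega⟩

theorem unshift_shiftInsert (b : Prop) [Decidable b] (X : Finset ℕ) :
    unshift (shiftInsert b X) = X := by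
  ext a; rw [mem_unshift, succ_mem_shiftInsert]

theorem shiftInsert_unshift {b : Prop} [Decidable b] {X : Finset ℕ} (h : b ↔ 0 ∈ X) :
    shiftInsert b (unshift X) = X := by
  ext a
  cases a with
  | zero => rw [zero_mem_shiftInsert, h]
  | succ a => rw [succ_mem_shiftInsert, mem_unshift]

theorem card_shiftInsert (b : Prop) [Decidable b] (X : Finset ℕ) :
    (shiftInsert b X).card = X.card + if b then 1 else 0 := by
  have hc : (X.image (· + 1)).card = X.card :=
    Finset.card_image_of_injective _ (add_left_injective 1)
  unfold shiftInsert
  split_ifs with h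
  · rw [Finset.card_insert_of_notMem (by simp), hc]
  · rw [hc, add_zero]

/-- A pair of finite sets of positive integers (each shifted down by one) splits into two Maya
diagrams.  The even members give the first one, in which the position `0` is occupied if and only
if the total number of members is odd; the odd members give the second one.  The resulting
constraint is that the sum of the charges is even. -/
noncomputable def parityEquiv : Finset ℕ × Finset ℕ ≃
    {P : (Finset ℕ × Finset ℕ) × (Finset ℕ × Finset ℕ) //
      Even (mayaCharge P.1 + mayaCharge P.2)} where
  toFun p := ⟨((shiftInsert (Odd (p.1.card + p.2.card)) (oddHalf p.1), oddHalf p.2),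
      (evenHalf p.1, evenHalf p.2)), by
    have h1 : p.1.card = (evenHalf p.1).card + (oddHalf p.1).card := by
      rw [← card_interleave, interleave_halves]
    have h2 : p.2.card = (evenHalf p.2).card + (oddHalf p.2).card := by
      rw [← card_interleave, interleave_halves]
    simp only [mayaCharge, card_shiftInsert]
    split_ifs with h
    · rw [Nat.odd_iff] at h
      rw [Int.even_iff]
      push_cast
      omega
    · rw [Nat.odd_iff] at h
      rw [Int.even_iff]
      push_cast
      omega⟩
  invFun P := (interleave P.1.2.1 (unshift P.1.1.1), interleave P.1.2.2 P.1.1.2)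
  left_inv p := by
    simp only [unshift_shiftInsert, interleave_halves]
  right_inv P := by
    obtain ⟨⟨⟨X, Y⟩, Z, W⟩, h⟩ := P
    have hX : X.card = (unshift X).card + if 0 ∈ X then 1 else 0 := by
      conv_lhs => rw [← shiftInsert_unshift (b := 0 ∈ X) (X := X) Iff.rfl]
      exact card_shiftInsert _ _
    have hb : Odd ((interleave Z (unshift X)).card + (interleave W Y).card) ↔ 0 ∈ X := by
      rw [card_interleave, card_interleave]
      simp only [mayaCharge] at h
      rw [Nat.odd_iff]
      rw [Int.even_iff] at h
      split_ifs at hX with h0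
      · simp only [h0, iff_true]
        omega
      · simp only [h0, iff_false]
        omega
    simp only [oddHalf_interleave, evenHalf_interleave, shiftInsert_unshift hb]

/-- An integer `x` at each place is encoded by `x < 0` together with the parity of `x` and the
number of pairs in `|x|`: a nonnegative `2 r + u` by `(u, 0, r)`, and a negative `-(2 r + u + 1)` by
`(u, 1, r)`. -/
noncomputable def pairsEquiv : (ℕ →₀ ℤ) ≃ (Finset ℕ × Finset ℕ) × (ℕ →₀ ℕ) where
  toFun s := ((s.support.filter fun k => (s k % 2 = 1 ↔ 0 ≤ s k), s.support.filter fun k => s k < 0),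
    Finsupp.onFinset s.support (fun k => (if s k < 0 then (-s k - 1) / 2 else s k / 2).toNat) (by
      intro k hk
      rw [Finsupp.mem_support_iff]
      intro h
      simp [h] at hk))
  invFun y := Finsupp.onFinset (y.1.1 ∪ y.1.2 ∪ y.2.support) (fun k =>
    if k ∈ y.1.2 then -(2 * (y.2 k : ℤ) + 1 + if k ∈ y.1.1 then 1 else 0)
    else 2 * (y.2 k : ℤ) + if k ∈ y.1.1 then 1 else 0) (by
      intro k hk
      by_contra h
      simp only [Finset.mem_union, not_or, Finsupp.mem_support_iff, not_not] at h
      simp [h] at hk)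
  left_inv s := by
    ext k
    by_cases hk : s k = 0
    · simp [hk]
    · simp only [Finsupp.onFinset_apply, Finset.mem_filter, Finsupp.mem_support_iff, ne_eq, hk,
        not_false_eq_true, true_and]
      split_ifs <;> omega
  right_inv y := by
    obtain ⟨⟨U, V⟩, r⟩ := y
    refine Prod.ext (Prod.ext (Finset.ext fun k => ?_) (Finset.ext fun k => ?_))
      (Finsupp.ext fun k => ?_)
    · simp only [Finset.mem_filter, Finsupp.mem_support_iff, Finsupp.onFinset_apply]
      split_ifs with h1 h2 <;> simp_all <;> omega
    · simp only [Finset.mem_filter, Finsupp.mem_support_iff, Finsupp.onFinset_apply]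
      split_ifs with h1 h2 <;> simp_all <;> omega
    · simp only [Finsupp.onFinset_apply]
      split_ifs <;> omega

/-- The contribution of a signed multiplicity to the charges: its sign if it is odd. -/
def oddSign (x : ℤ) : ℤ := if x % 2 = 0 then 0 else if 0 < x then 1 else -1

theorem card_filter_sub_card_filter {s : ℕ →₀ ℤ} {K : ℕ} {ι : ℕ → ℕ}
    (hK : ∀ a, s (ι a) ≠ 0 → a < K) {X Y : Finset ℕ}
    (hX : ∀ a, a ∈ X ↔ ι a ∈ (pairsEquiv s).1.1) (hY : ∀ a, a ∈ Y ↔ ι a ∈ (pairsEquiv s).1.2) :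
    (X.card : ℤ) - Y.card = ∑ a ∈ Finset.range K, oddSign (s (ι a)) := by
  have hU : ∀ k, k ∈ (pairsEquiv s).1.1 ↔ s k ≠ 0 ∧ (s k % 2 = 1 ↔ 0 ≤ s k) := by
    intro k; simp [pairsEquiv]
  have hV : ∀ k, k ∈ (pairsEquiv s).1.2 ↔ s k < 0 := by
    intro k; simp [pairsEquiv]; omega
  have hX' : X = (Finset.range K).filter (· ∈ X) := by
    ext a
    simp only [Finset.mem_filter, Finset.mem_range, iff_and_self]
    intro ha
    exact hK a ((hU _).1 ((hX a).1 ha)).1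
  have hY' : Y = (Finset.range K).filter (· ∈ Y) := by
    ext a
    simp only [Finset.mem_filter, Finset.mem_range, iff_and_self]
    intro ha
    exact hK a ((hV _).1 ((hY a).1 ha)).ne
  rw [hX', hY', Finset.card_filter, Finset.card_filter]
  push_cast
  rw [← Finset.sum_sub_distrib]
  refine Finset.sum_congr rfl fun a _ => ?_
  have h1 := (hX a).trans (hU _)
  have h2 := (hY a).trans (hV _)
  simp only [h1, h2, oddSign]
  split_ifs <;> omega

theorem pairsEquiv_abs (s : ℕ →₀ ℤ) (k : ℕ) : (s k).natAbs =
    (if k ∈ (pairsEquiv s).1.1 then 1 else 0) + (if k ∈ (pairsEquiv s).1.2 then 1 else 0)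
      + 2 * (pairsEquiv s).2 k := by
  simp only [pairsEquiv, Equiv.coe_fn_mk, Finset.mem_filter, Finsupp.mem_support_iff,
    Finsupp.onFinset_apply]
  split_ifs <;> omega

/-- The total multiplicity beyond the place `k`. -/
def tailSum (g : ℕ →₀ ℤ) (k : ℕ) : ℕ := ∑ j ∈ g.support.filter (k < ·), (g j).natAbs

theorem tailSum_succ (g : ℕ →₀ ℤ) (k : ℕ) : tailSum g k = (g (k + 1)).natAbs + tailSum g (k + 1) := by
  unfold tailSum
  by_cases h : g (k + 1) = 0
  · rw [h, Int.natAbs_zero, zero_add]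
    refine Finset.sum_congr (Finset.filter_congr fun j hj => ?_) fun _ _ => rfl
    rw [Finsupp.mem_support_iff] at hj
    have : j ≠ k + 1 := by rintro rfl; exact hj h
    omega
  · have : g.support.filter (k < ·) = insert (k + 1) (g.support.filter (k + 1 < ·)) := by
      ext j
      simp only [Finset.mem_filter, Finset.mem_insert, Finsupp.mem_support_iff]
      constructor
      · rintro ⟨h1, h2⟩
        by_cases hj : j = k + 1
        · exact Or.inl hj
        · exact Or.inr ⟨h1, by omega⟩
      · rintro (rfl | ⟨h1, h2⟩)
        · exact ⟨h, by omega⟩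
        · exact ⟨h1, by omega⟩
    rw [this, Finset.sum_insert (by simp)]

/-- Change the sign at each place, and once more for each unit of multiplicity beyond it.  The signs
so obtained are the ones that a move on the abacus respects. -/
noncomputable def twist (g : ℕ →₀ ℤ) : ℕ →₀ ℤ :=
  Finsupp.onFinset g.support (fun k => -g k * (-1) ^ tailSum g k) (by
    intro k hk
    rw [Finsupp.mem_support_iff]
    intro h
    simp [h] at hk)

theorem twist_apply (g : ℕ →₀ ℤ) (k : ℕ) : twist g k = -g k * (-1) ^ tailSum g k := rfl

theorem natAbs_twist (g : ℕ →₀ ℤ) (k : ℕ) : (twist g k).natAbs = (g k).natAbs := by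
  rw [twist_apply, Int.natAbs_mul, Int.natAbs_neg, Int.natAbs_pow]
  simp

theorem support_twist (g : ℕ →₀ ℤ) : (twist g).support = g.support := by
  ext k
  rw [Finsupp.mem_support_iff, Finsupp.mem_support_iff, ← Int.natAbs_ne_zero, natAbs_twist,
    Int.natAbs_ne_zero]

theorem tailSum_twist (g : ℕ →₀ ℤ) (k : ℕ) : tailSum (twist g) k = tailSum g k := by
  unfold tailSum
  rw [support_twist]
  exact Finset.sum_congr rfl fun j _ => natAbs_twist g j

theorem twist_twist (g : ℕ →₀ ℤ) : twist (twist g) = g := by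
  ext k
  rw [twist_apply, tailSum_twist, twist_apply]
  rcases neg_one_pow_eq_or ℤ (tailSum g k) with h | h <;> rw [h] <;> ring

/-- `twist` as a permutation. -/
noncomputable def twistEquiv : (ℕ →₀ ℤ) ≃ (ℕ →₀ ℤ) := ⟨twist, twist, twist_twist, twist_twist⟩

/-- Two integers with an even sum, in the coordinates in which the energy becomes
`2 z² + z + 2 z'² + z'`. -/
def evenSumEquiv (P : Type) : {y : (ℤ × P) × (ℤ × P) // Even (y.1.1 + y.2.1)} ≃
    (ℤ × ℤ) × (P × P) where
  toFun y := ((-((y.1.1.1 + y.1.2.1) / 2), -((y.1.1.1 - y.1.2.1) / 2)), (y.1.1.2, y.1.2.2))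
  invFun x := ⟨((-(x.1.1 + x.1.2), x.2.1), (x.1.2 - x.1.1, x.2.2)), by
    rw [Int.even_iff]; simp only; omega⟩
  left_inv y := by
    obtain ⟨⟨⟨a, p⟩, b, p'⟩, h⟩ := y
    rw [Int.even_iff] at h
    simp only at h
    refine Subtype.ext (Prod.ext (Prod.ext ?_ rfl) (Prod.ext ?_ rfl)) <;> simp only <;> omega
  right_inv x := by
    obtain ⟨⟨a, b⟩, p, p'⟩ := x
    refine Prod.ext (Prod.ext ?_ ?_) rfl <;> simp only <;> omega

/-- The classification of coloured configurations by two integers and three partitions.  The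
multiplicity of the beads at the `k`-th coloured position is `|g (k - 1)|`, and their colour is the
sign. -/
noncomputable def colouredEquiv : (ℕ →₀ ℤ) ≃ (ℤ × ℤ) × (OrdPartition × OrdPartition) × OrdPartition :=
  (twistEquiv.trans pairsEquiv).trans
    (((((parityEquiv.trans
      ((Equiv.prodCongr mayaEquiv mayaEquiv).subtypeEquiv (fun P => by
        change _ ↔ Even ((mayaEquiv P.1).1 + (mayaEquiv P.2).1)
        rw [mayaEquiv_fst, mayaEquiv_fst]))).trans (evenSumEquiv OrdPartition)).prodCongr
          multiplicityEquiv)).trans (Equiv.prodAssoc _ _ _))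

theorem colouredEquiv_spec (g : ℕ →₀ ℤ) :
    let p := (pairsEquiv (twist g)).1
    let P := (parityEquiv p).1
    (colouredEquiv g).1 = (-((mayaCharge P.1 + mayaCharge P.2) / 2),
      -((mayaCharge P.1 - mayaCharge P.2) / 2)) ∧
    (colouredEquiv g).2 = (((mayaEquiv P.1).2, (mayaEquiv P.2).2),
      multiplicityEquiv (pairsEquiv (twist g)).2) := by
  refine ⟨?_, rfl⟩
  rw [← mayaEquiv_fst, ← mayaEquiv_fst]
  rfl

theorem sum_range_two_mul {M : Type*} [AddCommMonoid M] (f : ℕ → M) (K : ℕ) :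
    ∑ k ∈ Finset.range (2 * K), f k
      = ∑ a ∈ Finset.range K, f (2 * a) + ∑ a ∈ Finset.range K, f (2 * a + 1) := by
  induction K with
  | zero => simp
  | succ K ih =>
    rw [show 2 * (K + 1) = 2 * K + 1 + 1 by ring, Finset.sum_range_succ, Finset.sum_range_succ, ih,
      Finset.sum_range_succ, Finset.sum_range_succ]
    abel

theorem sum_mem_eq_sum_ite {U : Finset ℕ} {B : ℕ} (h : ∀ k ∈ U, k < B) (f : ℕ → ℕ) :
    ∑ k ∈ U, f k = ∑ k ∈ Finset.range B, if k ∈ U then f k else 0 := by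
  rw [← Finset.sum_filter]
  refine Finset.sum_congr ?_ fun _ _ => rfl
  ext k
  simp only [Finset.mem_filter, Finset.mem_range, iff_and_self]
  exact h k

theorem pairsEquiv_lt {s : ℕ →₀ ℤ} {B : ℕ} (hB : ∀ k, s k ≠ 0 → k < B) :
    (∀ k ∈ (pairsEquiv s).1.1, k < B) ∧ (∀ k ∈ (pairsEquiv s).1.2, k < B) ∧
      (∀ k, (pairsEquiv s).2 k ≠ 0 → k < B) := by
  refine ⟨fun k hk => hB k ?_, fun k hk => hB k ?_, fun k hk => hB k ?_⟩ <;> intro h0 <;>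
    have h := pairsEquiv_abs s k <;> rw [h0, Int.natAbs_zero] at h
  · rw [if_pos hk] at h; omega
  · rw [if_pos hk] at h; omega
  · omega

theorem parityEquiv_apply (p : Finset ℕ × Finset ℕ) : (parityEquiv p).1 =
    ((shiftInsert (Odd (p.1.card + p.2.card)) (oddHalf p.1), oddHalf p.2),
      (evenHalf p.1, evenHalf p.2)) := rfl

/-- The parity of the total multiplicity is that of the number of members of the two sets. -/
theorem sum_natAbs_mod_two {s : ℕ →₀ ℤ} {B : ℕ} (hB : ∀ k, s k ≠ 0 → k < B) :
    (∑ k ∈ Finset.range B, (s k).natAbs) % 2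
      = ((pairsEquiv s).1.1.card + (pairsEquiv s).1.2.card) % 2 := by
  obtain ⟨h1, h2, -⟩ := pairsEquiv_lt hB
  rw [Finset.card_eq_sum_ones, Finset.card_eq_sum_ones, sum_mem_eq_sum_ite h1,
    sum_mem_eq_sum_ite h2, ← Finset.sum_add_distrib]
  simp only [pairsEquiv_abs, Finset.sum_add_distrib (f := fun k =>
    (if k ∈ (pairsEquiv s).1.1 then 1 else 0) + (if k ∈ (pairsEquiv s).1.2 then 1 else 0)),
    ← Finset.mul_sum]
  omega

/-- The two integers of a coloured configuration in terms of the signs that `twist` produces. -/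
theorem colouredEquiv_charges {g : ℕ →₀ ℤ} {K : ℕ} (hK : ∀ k, g k ≠ 0 → k < 2 * K) :
    -((colouredEquiv g).1.1 + (colouredEquiv g).1.2)
      = ((∑ k ∈ Finset.range (2 * K), (g k).natAbs) % 2 : ℕ)
        + ∑ a ∈ Finset.range K, oddSign (twist g (2 * a + 1)) ∧
    (colouredEquiv g).1.2 - (colouredEquiv g).1.1
      = ∑ a ∈ Finset.range K, oddSign (twist g (2 * a)) := by
  have hK' : ∀ k, twist g k ≠ 0 → k < 2 * K := fun k hk => hK k (by
    rwa [← Finsupp.mem_support_iff, ← support_twist, Finsupp.mem_support_iff])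
  have hz := (colouredEquiv_spec g).1
  have hev := (parityEquiv (pairsEquiv (twist g)).1).2
  rw [Int.even_iff] at hev
  have h0 := card_filter_sub_card_filter (s := twist g) (K := K) (ι := fun a => 2 * a)
    (fun a ha => by have := hK' _ ha; omega)
    (X := evenHalf (pairsEquiv (twist g)).1.1) (Y := evenHalf (pairsEquiv (twist g)).1.2)
    (fun a => mem_evenHalf) (fun a => mem_evenHalf)
  have h1 := card_filter_sub_card_filter (s := twist g) (K := K) (ι := fun a => 2 * a + 1)
    (fun a ha => by have := hK' _ ha; omega)
    (X := oddHalf (pairsEquiv (twist g)).1.1) (Y := oddHalf (pairsEquiv (twist g)).1.2)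
    (fun a => mem_oddHalf) (fun a => mem_oddHalf)
  have hpar := sum_natAbs_mod_two hK'
  simp only [natAbs_twist] at hpar
  rw [parityEquiv_apply] at hev
  rw [hz, parityEquiv_apply]
  simp only [mayaCharge, card_shiftInsert, Nat.odd_iff] at hev ⊢
  rw [hpar]
  push_cast at hev h0 h1 ⊢
  split_ifs at hev ⊢ with h
  · constructor <;> omega
  · constructor <;> omega

/-- The energy of a coloured configuration. -/
theorem colouredEquiv_energy {g : ℕ →₀ ℤ} {K : ℕ} (hK : ∀ k, g k ≠ 0 → k < 2 * K) :
    ((∑ k ∈ Finset.range (2 * K), (k + 1) * (g k).natAbs : ℕ) : ℤ)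
      = (2 * (colouredEquiv g).1.1 ^ 2 + (colouredEquiv g).1.1)
        + (2 * (colouredEquiv g).1.2 ^ 2 + (colouredEquiv g).1.2)
        + 2 * ((colouredEquiv g).2.1.1.weight + (colouredEquiv g).2.1.2.weight
          + (colouredEquiv g).2.2.weight) := by
  have hK' : ∀ k, twist g k ≠ 0 → k < 2 * K := fun k hk => hK k (by
    rwa [← Finsupp.mem_support_iff, ← support_twist, Finsupp.mem_support_iff])
  obtain ⟨hz, hw⟩ := colouredEquiv_spec g
  rw [hz, hw]
  have hev := (parityEquiv (pairsEquiv (twist g)).1).2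
  have hE0 := two_mul_mayaEnergy (parityEquiv (pairsEquiv (twist g)).1).1.1
  have hE1 := two_mul_mayaEnergy (parityEquiv (pairsEquiv (twist g)).1).1.2
  have hr := multiplicityEquiv_weight (pairsEquiv (twist g)).2
  obtain ⟨h1, h2, h3⟩ := pairsEquiv_lt hK'
  have hsum : ∑ k ∈ Finset.range (2 * K), (k + 1) * (g k).natAbs
      = ∑ k ∈ (pairsEquiv (twist g)).1.1, (k + 1) + ∑ k ∈ (pairsEquiv (twist g)).1.2, (k + 1)
        + 2 * ((pairsEquiv (twist g)).2.sum fun k a => a * (k + 1)) := by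
    rw [sum_mem_eq_sum_ite h1, sum_mem_eq_sum_ite h2, Finsupp.sum_of_support_subset (s :=
      Finset.range (2 * K)) _ (fun k hk => Finset.mem_range.2 (h3 k (Finsupp.mem_support_iff.1 hk)))
      _ (by simp), Finset.mul_sum, ← Finset.sum_add_distrib, ← Finset.sum_add_distrib]
    refine Finset.sum_congr rfl fun k _ => ?_
    rw [← natAbs_twist, pairsEquiv_abs]
    split_ifs <;> ring
  have hsplit : ∀ U : Finset ℕ, ∑ k ∈ U, (k + 1)
      = (2 * ∑ a ∈ evenHalf U, a + (evenHalf U).card) + 2 * ∑ a ∈ oddHalf U, (a + 1) := by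
    intro U
    conv_lhs => rw [← interleave_halves U]
    rw [interleave, Finset.sum_union, Finset.sum_image, Finset.sum_image, Finset.card_eq_sum_ones,
      Finset.mul_sum, Finset.mul_sum, ← Finset.sum_add_distrib]
    · congr 1
    · intro a _ b _ h; simp only at h; omega
    · intro a _ b _ h; simp only at h; omega
    · rw [Finset.disjoint_left]
      simp only [Finset.mem_image]
      rintro x ⟨a, _, rfl⟩ ⟨b, _, h⟩
      omega
  have hshift : ∀ (b : Prop) [Decidable b] (X : Finset ℕ),
      ∑ a ∈ shiftInsert b X, a = ∑ a ∈ X, (a + 1) := by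
    intro b _ X
    have : ∑ a ∈ X.image (· + 1), a = ∑ a ∈ X, (a + 1) :=
      Finset.sum_image (fun a _ b _ h => by simpa using h)
    unfold shiftInsert
    split_ifs
    · rw [Finset.sum_insert (by simp), this, zero_add]
    · exact this
  rw [hsum, hsplit (pairsEquiv (twist g)).1.1, hsplit (pairsEquiv (twist g)).1.2, hr.symm]
  obtain ⟨d, hd⟩ := hev
  have hE0' : mayaEnergy (parityEquiv (pairsEquiv (twist g)).1).1.1
      = ∑ a ∈ oddHalf (pairsEquiv (twist g)).1.1, (a + 1)
        + ∑ a ∈ oddHalf (pairsEquiv (twist g)).1.2, (a + 1) := by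
    rw [parityEquiv_apply, mayaEnergy, hshift]
  have hE1' : mayaEnergy (parityEquiv (pairsEquiv (twist g)).1).1.2
      = ∑ a ∈ evenHalf (pairsEquiv (twist g)).1.1, a
        + ∑ a ∈ evenHalf (pairsEquiv (twist g)).1.2, (a + 1) := by
    rw [parityEquiv_apply, mayaEnergy]
  have hc1 : mayaCharge (parityEquiv (pairsEquiv (twist g)).1).1.2
      = (evenHalf (pairsEquiv (twist g)).1.1).card - (evenHalf (pairsEquiv (twist g)).1.2).card := by
    rw [parityEquiv_apply, mayaCharge]
  rw [Finset.sum_add_distrib (s := evenHalf _), ← Finset.card_eq_sum_ones] at hE1'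
  generalize mayaCharge (parityEquiv (pairsEquiv (twist g)).1).1.1 = d0 at *
  generalize mayaCharge (parityEquiv (pairsEquiv (twist g)).1).1.2 = d1 at *
  have e0 : (d0 + d1) / 2 = d := by omega
  have e1 : (d0 - d1) / 2 = d - d1 := by omega
  simp only [e0, e1]
  obtain rfl : d0 = 2 * d - d1 := by linarith
  zify at hE0' hE1'
  push_cast
  nlinarith

/-- The configurations in which no coloured bead can move have empty partitions: the conditions say
that the signs produced by `twist` are constant along the even and along the odd places, and agree
with the invisible bead at position `0`. -/
theorem colouredEquiv_weights_eq_zero {g : ℕ →₀ ℤ} (h1 : ∀ k, (g k).natAbs ≤ 1)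
    (hjump : ∀ k, g (k + 2) ≠ 0 → g (k + 1) = 0 → g k = -g (k + 2))
    (hswap : ∀ k, g (k + 2) ≠ 0 → g (k + 1) ≠ 0 → g k = g (k + 2))
    (hjump0 : g 1 ≠ 0 → g 0 = 0 → g 1 = -1) (hswap0 : g 1 ≠ 0 → g 0 ≠ 0 → g 1 = 1) :
    (colouredEquiv g).2.1.1.weight = 0 ∧ (colouredEquiv g).2.1.2.weight = 0 ∧
      (colouredEquiv g).2.2.weight = 0 := by
  have key : ∀ k, twist g (k + 2) ≠ 0 → twist g k = twist g (k + 2) := by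
    intro k hk
    have hk' : g (k + 2) ≠ 0 := by
      rwa [← Finsupp.mem_support_iff, ← support_twist, Finsupp.mem_support_iff]
    have ha : (g (k + 2)).natAbs = 1 := by have := h1 (k + 2); omega
    rw [twist_apply, twist_apply, tailSum_succ g k, tailSum_succ g (k + 1), ha]
    by_cases h0 : g (k + 1) = 0
    · rw [h0, hjump k hk' h0, Int.natAbs_zero, pow_add, pow_add]
      ring
    · have hb : (g (k + 1)).natAbs = 1 := by have := h1 (k + 1); omega
      rw [hb, hswap k hk' h0, pow_add, pow_add]
      ring
  have key0 : twist g 1 ≠ 0 →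
      twist g 1 = -(-1) ^ (tailSum g 0 + (g 0).natAbs) := by
    intro hk
    have hk' : g 1 ≠ 0 := by
      rwa [← Finsupp.mem_support_iff, ← support_twist, Finsupp.mem_support_iff]
    have ha : (g 1).natAbs = 1 := by have := h1 1; omega
    rw [twist_apply, tailSum_succ g 0, zero_add, ha]
    by_cases h0 : g 0 = 0
    · rw [h0, hjump0 hk' h0, Int.natAbs_zero, pow_add, pow_add]
      ring
    · have hb : (g 0).natAbs = 1 := by have := h1 0; omega
      rw [hb, hswap0 hk' h0, pow_add, pow_add]
      ring
  have h1' : ∀ k, (twist g k).natAbs ≤ 1 := fun k => by rw [natAbs_twist]; exact h1 k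
  have hU : ∀ k, k ∈ (pairsEquiv (twist g)).1.1 ↔ twist g k = 1 := by
    intro k
    have := h1' k
    simp [pairsEquiv]
    omega
  have hV : ∀ k, k ∈ (pairsEquiv (twist g)).1.2 ↔ twist g k = -1 := by
    intro k
    have := h1' k
    simp [pairsEquiv]
    omega
  have hpar : Odd ((pairsEquiv (twist g)).1.1.card + (pairsEquiv (twist g)).1.2.card) ↔
      Odd (tailSum g 0 + (g 0).natAbs) := by
    obtain ⟨B, hB⟩ : ∃ B, ∀ k, twist g k ≠ 0 → k < B :=
      ⟨(twist g).support.sup id + 1, fun k hk => Nat.lt_succ_of_le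
        (Finset.le_sup (f := id) (Finsupp.mem_support_iff.2 hk))⟩
    have h := sum_natAbs_mod_two (B := B + 1) (fun k hk => (hB k hk).trans (Nat.lt_succ_self _))
    rw [Nat.odd_iff, ← h, ← Nat.odd_iff, Finset.sum_range_succ', natAbs_twist]
    have : ∑ k ∈ Finset.range B, (twist g (k + 1)).natAbs = tailSum g 0 := by
      have haux : ∀ B, ∑ k ∈ Finset.range B, (g (k + 1)).natAbs + tailSum g B = tailSum g 0 := by
        intro B
        induction B with
        | zero => simp
        | succ B ih => rw [Finset.sum_range_succ, ← ih, tailSum_succ g B]; ring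
      simp only [natAbs_twist]
      rw [← haux B, left_eq_add]
      refine Finset.sum_eq_zero fun j hj => ?_
      rw [Finset.mem_filter, ← support_twist, Finsupp.mem_support_iff] at hj
      have := hB j hj.1
      omega
    rw [this]
  rw [(colouredEquiv_spec g).2, parityEquiv_apply]
  refine ⟨mayaEquiv_weight_eq_zero ?_ ?_ ?_, mayaEquiv_weight_eq_zero ?_ ?_ ?_, ?_⟩
  · intro x
    cases x with
    | zero =>
      simp only [succ_mem_shiftInsert, zero_mem_shiftInsert, mem_oddHalf, hU, hpar]
      intro h
      rw [mul_zero, zero_add] at h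
      have := key0 (by rw [h]; decide)
      rw [h] at this
      by_contra h'
      rw [Nat.not_odd_iff_even] at h'
      rw [h'.neg_one_pow] at this
      omega
    | succ x =>
      simp only [succ_mem_shiftInsert, mem_oddHalf, hU]
      intro h
      rw [show 2 * (x + 1) + 1 = 2 * x + 1 + 2 by ring] at h
      rw [key _ (by rw [h]; decide), h]
  · intro x
    simp only [mem_oddHalf, hV]
    intro h
    rw [show 2 * (x + 1) + 1 = 2 * x + 1 + 2 by ring] at h
    rw [key _ (by rw [h]; decide), h]
  · simp only [zero_mem_shiftInsert, mem_oddHalf, hV, hpar]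
    rintro ⟨ho, h⟩
    rw [mul_zero, zero_add] at h
    have := key0 (by rw [h]; decide)
    rw [h, ho.neg_one_pow] at this
    omega
  · intro x
    simp only [mem_evenHalf, hU]
    intro h
    rw [show 2 * (x + 1) = 2 * x + 2 by ring] at h
    rw [key _ (by rw [h]; decide), h]
  · intro x
    simp only [mem_evenHalf, hV]
    intro h
    rw [show 2 * (x + 1) = 2 * x + 2 by ring] at h
    rw [key _ (by rw [h]; decide), h]
  · simp only [mem_evenHalf, hU, hV]
    rintro ⟨h, h'⟩
    omega
  · rw [multiplicityEquiv_weight]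
    refine Finset.sum_eq_zero fun k _ => ?_
    have h2 := pairsEquiv_abs (twist g) k
    have h3 := h1' k
    have : (pairsEquiv (twist g)).2 k = 0 := by omega
    simp [this]

/-! ### Levels of a column and walls with a given profile -/

/-- The shape of a half-block: upper-left for `true`, lower-right for `false`. -/
def half : Bool → Piece
  | true => Piece.upper
  | false => Piece.lower

theorem half_ne_full (b : Bool) : half b ≠ Piece.full := by cases b <;> simp [half]

theorem half_injective : Function.Injective half := by
  intro a b; cases a <;> cases b <;> simp [half]

theorem eq_half_of_ne_full {p : Piece} (h : p ≠ Piece.full) (b : Bool) :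
    p = half b ∨ p = half (!b) := by
  cases p <;> cases b <;> simp_all [half]

/-- The row of the block at level `v` of a column; here `n = q + 2`. -/
def rowOf (q v : ℕ) : ℕ := q * (v / (q + 1)) + (v % (q + 1) - 1)

/-- The block at level `v` of the column `x`.  The blocks of a column are stacked in the order of
their rows, where of the two half-blocks in row `q k` the one with the shape `half (τ k)` comes
first; here `n = q + 2`. -/
def blockAt (q : ℕ) (τ : ℕ → Bool) (x v : ℕ) : Block :=
  ⟨x, rowOf q v, if v % (q + 1) = 0 then half (τ (v / (q + 1)))
    else if v % (q + 1) = 1 then half (!τ (v / (q + 1))) else Piece.full⟩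

/-- The level of a block in its column; inverse to `blockAt`. -/
def level (q : ℕ) (τ : ℕ → Bool) (b : Block) : ℕ :=
  if b.piece = Piece.full then (q + 1) * (b.row / q) + b.row % q + 1
  else if b.piece = half (τ (b.row / q)) then (q + 1) * (b.row / q)
  else (q + 1) * (b.row / q) + 1

theorem inPattern_iff {q : ℕ} {b : Block} :
    b.InPattern (q + 2) ↔ (b.piece = Piece.full ↔ ¬ q ∣ b.row) := Iff.rfl

/-- Every level is `(q + 1) k + j` with `j ≤ q`. -/
theorem exists_level_eq (q v : ℕ) : ∃ k j, j < q + 1 ∧ v = (q + 1) * k + j :=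
  ⟨v / (q + 1), v % (q + 1), Nat.mod_lt _ (Nat.succ_pos _), (Nat.div_add_mod v (q + 1)).symm⟩

theorem level_div {q k j : ℕ} (h : j < q + 1) : ((q + 1) * k + j) / (q + 1) = k := by
  rw [Nat.mul_add_div (Nat.succ_pos q), Nat.div_eq_of_lt h, add_zero]

theorem level_mod {q k j : ℕ} (h : j < q + 1) : ((q + 1) * k + j) % (q + 1) = j := by
  rw [Nat.mul_add_mod, Nat.mod_eq_of_lt h]

theorem rowOf_eq {q k j : ℕ} (h : j < q + 1) : rowOf q ((q + 1) * k + j) = q * k + (j - 1) := by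
  rw [rowOf, level_div h, level_mod h]

theorem blockAt_eq {q k j : ℕ} (τ : ℕ → Bool) (x : ℕ) (h : j < q + 1) :
    blockAt q τ x ((q + 1) * k + j) = ⟨x, q * k + (j - 1), if j = 0 then half (τ k)
      else if j = 1 then half (!τ k) else Piece.full⟩ := by
  rw [blockAt, rowOf_eq h, level_div h, level_mod h]

theorem rowOf_succ {q : ℕ} (hq : 0 < q) (v : ℕ) :
    rowOf q (v + 1) = rowOf q v + if (q + 1) ∣ v then 0 else 1 := by
  obtain ⟨k, j, hj, rfl⟩ := exists_level_eq q v
  have hdvd : (q + 1) ∣ (q + 1) * k + j ↔ j = 0 := by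
    rw [Nat.dvd_iff_mod_eq_zero, level_mod hj]
  simp only [hdvd, rowOf_eq hj]
  by_cases h : j + 1 < q + 1
  · rw [add_assoc, rowOf_eq h]
    split_ifs <;> omega
  · have : (q + 1) * k + j + 1 = (q + 1) * (k + 1) + 0 := by
      rw [mul_add]; omega
    rw [this, rowOf_eq (by omega), mul_add]
    split_ifs <;> omega

theorem rowOf_mono {q : ℕ} (hq : 0 < q) : Monotone (rowOf q) :=
  monotone_nat_of_le_succ fun v => by rw [rowOf_succ hq]; exact Nat.le_add_right _ _

/-- Two levels lie in the same row only if they are the two half-blocks of a cell. -/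
theorem rowOf_lt {q : ℕ} (hq : 0 < q) {v w : ℕ} (h : v < w) (hv : ¬ (q + 1) ∣ v) :
    rowOf q v < rowOf q w := by
  have h1 := rowOf_succ hq v
  rw [if_neg hv] at h1
  have h2 := rowOf_mono hq (show v + 1 ≤ w from h)
  omega

theorem blockAt_inPattern {q : ℕ} (τ : ℕ → Bool) (x v : ℕ) :
    (blockAt q τ x v).InPattern (q + 2) := by
  obtain ⟨k, j, hj, rfl⟩ := exists_level_eq q v
  rw [blockAt_eq τ x hj, inPattern_iff]
  simp only
  rw [Nat.dvd_add_right (Nat.dvd_mul_right q k)]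
  by_cases h0 : j = 0
  · simp [h0, half_ne_full]
  · by_cases h1 : j = 1
    · simp [h1, half_ne_full]
    · simp only [h0, h1, if_false, true_iff]
      intro h
      have := Nat.le_of_dvd (by omega) h
      omega

theorem level_blockAt {q : ℕ} (hq : 0 < q) (τ : ℕ → Bool) (x v : ℕ) : level q τ (blockAt q τ x v) = v := by
  obtain ⟨k, j, hj, rfl⟩ := exists_level_eq q v
  rw [blockAt_eq τ x hj, level]
  have hdiv : (q * k + (j - 1)) / q = k := by
    rw [Nat.mul_add_div hq, Nat.div_eq_of_lt (by omega), add_zero]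
  have hmod : (q * k + (j - 1)) % q = j - 1 := by
    rw [Nat.mul_add_mod, Nat.mod_eq_of_lt (by omega)]
  simp only [hdiv, hmod]
  by_cases h0 : j = 0
  · simp [h0, half_ne_full]
  · by_cases h1 : j = 1
    · simp [h1, half_ne_full, half_injective.eq_iff]
    · simp only [h0, h1, if_false, if_true]
      omega

theorem blockAt_level {q : ℕ} (hq : 0 < q) (τ : ℕ → Bool) {b : Block}
    (hb : b.InPattern (q + 2)) : blockAt q τ b.col (level q τ b) = b := by
  obtain ⟨x, r, p⟩ := b
  rw [inPattern_iff] at hb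
  simp only at hb
  have hr := Nat.div_add_mod r q
  have hlt := Nat.mod_lt r hq
  unfold level
  simp only
  split_ifs with h1 h2
  · have hne : r % q ≠ 0 := fun h => (hb.1 h1) (Nat.dvd_of_mod_eq_zero h)
    rw [add_assoc, blockAt_eq τ x (by omega), if_neg (by omega), if_neg (by omega), h1]
    congr 1
  · have h0 : r % q = 0 := Nat.mod_eq_zero_of_dvd (by_contra fun h => h1 (hb.2 h))
    have := blockAt_eq (k := r / q) (j := 0) τ x (Nat.succ_pos q)
    rw [add_zero] at this
    rw [this, if_pos rfl, ← h2]
    congr 1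
    omega
  · have h0 : r % q = 0 := Nat.mod_eq_zero_of_dvd (by_contra fun h => h1 (hb.2 h))
    rw [blockAt_eq τ x (by omega), if_neg (by omega), if_pos rfl,
      ← (eq_half_of_ne_full h1 (τ (r / q))).resolve_left h2]
    congr 1
    omega

theorem rowOf_level {q : ℕ} (hq : 0 < q) (τ : ℕ → Bool) {b : Block}
    (hb : b.InPattern (q + 2)) : rowOf q (level q τ b) = b.row :=
  congrArg Block.row (blockAt_level hq τ hb)

theorem blockAt_injective2 {q : ℕ} (hq : 0 < q) {τ : ℕ → Bool} {x y v w : ℕ}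
    (h : blockAt q τ x v = blockAt q τ y w) : x = y ∧ v = w := by
  refine ⟨congrArg Block.col h, ?_⟩
  rw [← level_blockAt hq τ x v, h, level_blockAt hq]

/-- A profile of a wall: `G v` is the number of columns of height at least `v` (for `v ≥ 1`), and
`half (τ k)` is the half-block that comes first in row `q k`; here `n = q + 2`. -/
structure IsProfile (q : ℕ) (G : ℕ → ℕ) (τ : ℕ → Bool) : Prop where
  antitone : Antitone G
  eventually_zero : ∃ B, ∀ v, B ≤ v → G v = 0
  grey_first : τ 0 = false

/-- The full columns have distinct heights. -/
def IsProper (q : ℕ) (G : ℕ → ℕ) : Prop := ∀ v, ¬ (q + 1) ∣ v → G v ≤ G (v + 1) + 1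

/-- The wall with a given profile. -/
def profileWall (q : ℕ) (G : ℕ → ℕ) (τ : ℕ → Bool) : Set Block :=
  {b | b.InPattern (q + 2) ∧ (level q τ b = 0 ∨ b.col < G (level q τ b))}

theorem blockAt_mem_profileWall {q : ℕ} (hq : 0 < q) {G : ℕ → ℕ} {τ : ℕ → Bool} {x v : ℕ} :
    blockAt q τ x v ∈ profileWall q G τ ↔ v = 0 ∨ x < G v := by
  change _ ∧ (level q τ _ = 0 ∨ x < G (level q τ _)) ↔ _
  rw [level_blockAt hq]
  exact and_iff_right (blockAt_inPattern τ x v)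

/-- The grey half-block is at level `0`, so that the height of a column is the level of its
top block. -/
theorem level_eq_zero_iff_isGrey {q : ℕ} (hq : 0 < q) {τ : ℕ → Bool} (h0 : τ 0 = false) {b : Block}
    (hb : b.InPattern (q + 2)) : level q τ b = 0 ↔ b.IsGrey := by
  constructor
  · intro h
    rw [← blockAt_level hq τ hb, h]
    have := blockAt_eq (q := q) (k := 0) (j := 0) τ b.col (Nat.succ_pos q)
    rw [mul_zero, add_zero] at this
    rw [this]
    simp [Block.IsGrey, h0, half]
  · rintro ⟨h1, h2⟩
    simp [level, h1, h2, h0, half]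

theorem IsProfile.grey_mem {q : ℕ} (hq : 0 < q) {G : ℕ → ℕ} {τ : ℕ → Bool} (hP : IsProfile q G τ)
    {b : Block} (hb : b.InPattern (q + 2)) (h : b.IsGrey) : b ∈ profileWall q G τ :=
  ⟨hb, Or.inl ((level_eq_zero_iff_isGrey hq hP.grey_first hb).2 h)⟩

theorem mem_profileWall_white {q : ℕ} (hq : 0 < q) {G : ℕ → ℕ} {τ : ℕ → Bool}
    (hP : IsProfile q G τ) {b : Block} : b ∈ profileWall q G τ ∧ ¬ b.IsGrey ↔
      ∃ v x, 1 ≤ v ∧ x < G v ∧ blockAt q τ x v = b := by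
  constructor
  · rintro ⟨⟨h1, h2⟩, h3⟩
    have h0 := mt (level_eq_zero_iff_isGrey hq hP.grey_first h1).1 h3
    exact ⟨level q τ b, b.col, Nat.pos_of_ne_zero h0, h2.resolve_left h0, blockAt_level hq τ h1⟩
  · rintro ⟨v, x, hv, hx, rfl⟩
    refine ⟨(blockAt_mem_profileWall hq).2 (Or.inr hx), ?_⟩
    rw [← level_eq_zero_iff_isGrey hq hP.grey_first (blockAt_inPattern τ x v), level_blockAt hq]
    omega

/-- Counting white blocks level by level. -/
theorem ncard_white_blocks {q : ℕ} (hq : 0 < q) {G : ℕ → ℕ} {τ : ℕ → Bool}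
    (hP : IsProfile q G τ) {B : ℕ} (hB : ∀ v, B ≤ v → G v = 0) (p : Block → Prop)
    [DecidablePred p] :
    {b ∈ profileWall q G τ | ¬ b.IsGrey ∧ p b}.ncard
      = ∑ v ∈ Finset.Ico 1 B, ((Finset.range (G v)).filter fun x => p (blockAt q τ x v)).card := by
  have hset : {b ∈ profileWall q G τ | ¬ b.IsGrey ∧ p b}
      = ((((Finset.Ico 1 B).sigma fun v =>
          (Finset.range (G v)).filter fun x => p (blockAt q τ x v)).map
        ⟨fun s => blockAt q τ s.2 s.1, fun s t h => by
          obtain ⟨v, x⟩ := s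
          obtain ⟨w, y⟩ := t
          obtain ⟨rfl, rfl⟩ := blockAt_injective2 hq h
          rfl⟩ : Finset Block) : Set Block) := by
    ext b
    simp only [Set.mem_ofPred_eq, Finset.coe_map, Set.mem_image,
      Finset.mem_coe, Finset.mem_sigma, Finset.mem_Ico, Finset.mem_filter, Finset.mem_range]
    rw [← and_assoc, mem_profileWall_white hq hP]
    constructor
    · rintro ⟨⟨v, x, hv, hx, rfl⟩, hp⟩
      refine ⟨⟨v, x⟩, ⟨⟨hv, ?_⟩, hx, hp⟩, rfl⟩
      by_contra h
      rw [hB v (by simpa using h)] at hx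
      omega
    · rintro ⟨⟨v, x⟩, ⟨⟨h1, _⟩, h3, h4⟩, rfl⟩
      exact ⟨⟨v, x, h1, h3, rfl⟩, h4⟩
  rw [hset, Set.ncard_coe_finset, Finset.card_map, Finset.card_sigma]

theorem IsProfile.finite_white {q : ℕ} (hq : 0 < q) {G : ℕ → ℕ} {τ : ℕ → Bool}
    (hP : IsProfile q G τ) : {b ∈ profileWall q G τ | ¬ b.IsGrey}.Finite := by
  obtain ⟨B, hB⟩ := hP.eventually_zero
  refine ((Finset.range B ×ˢ Finset.range (G 0)).finite_toSet.image
    fun s : ℕ × ℕ => blockAt q τ s.2 s.1).subset fun b hb => ?_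
  obtain ⟨v, x, hv, hx, rfl⟩ := (mem_profileWall_white hq hP).1 hb
  simp only [Set.mem_image, Finset.mem_coe, Finset.mem_product, Finset.mem_range]
  refine ⟨(v, x), ⟨?_, hx.trans_le (hP.antitone (Nat.zero_le v))⟩, rfl⟩
  by_contra h
  rw [hB v (by simpa using h)] at hx
  omega

theorem IsProfile.le_columnHeight_iff {q : ℕ} (hq : 0 < q) {G : ℕ → ℕ} {τ : ℕ → Bool}
    (hP : IsProfile q G τ) {x v : ℕ} (hv : 1 ≤ v) :
    v ≤ columnHeight (profileWall q G τ) x ↔ x < G v := by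
  obtain ⟨B, hB⟩ := hP.eventually_zero
  let S : Finset ℕ := (Finset.range B).filter fun u => x < G (u + 1)
  have hS : S = Finset.range S.card := eq_range_card_of_pred_mem fun u hu => by
    simp only [S, Finset.mem_filter, Finset.mem_range] at hu ⊢
    exact ⟨by omega, hu.2.trans_le (hP.antitone (Nat.le_succ _))⟩
  have hc : columnHeight (profileWall q G τ) x = S.card := by
    have h := ncard_white_blocks hq hP (B := B + 1) (fun v hv => hB v (by omega)) (fun b => b.col = x)
    unfold columnHeight
    rw [show {b ∈ profileWall q G τ | b.col = x ∧ ¬ b.IsGrey}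
      = {b ∈ profileWall q G τ | ¬ b.IsGrey ∧ b.col = x} by ext b; simp only [Set.mem_ofPred_eq]; tauto,
      h, Finset.sum_Ico_eq_sum_range, Finset.card_filter, Nat.add_sub_cancel]
    refine Finset.sum_congr rfl fun u _ => ?_
    have : (Finset.range (G (1 + u))).filter (fun y => (blockAt q τ y (1 + u)).col = x)
        = if x < G (u + 1) then {x} else ∅ := by
      ext y
      simp only [Finset.mem_filter, Finset.mem_range, blockAt, add_comm 1 u]
      split_ifs with h
      · rw [Finset.mem_singleton]
        constructor
        · exact fun h => h.2
        · rintro rfl; exact ⟨h, rfl⟩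
      · simp only [Finset.notMem_empty, iff_false, not_and]
        rintro h1 rfl
        exact h h1
    rw [this]
    split_ifs <;> rfl
  have hm : v ≤ S.card ↔ v - 1 ∈ S := by
    rw [hS, Finset.mem_range, Finset.card_range]
    omega
  rw [hc, hm, Finset.mem_filter, Finset.mem_range, Nat.sub_add_cancel hv, and_iff_right_iff_imp]
  intro h
  by_contra h'
  rw [hB v (by omega)] at h
  omega

theorem IsProfile.blockAt_mem_iff {q : ℕ} (hq : 0 < q) {G : ℕ → ℕ} {τ : ℕ → Bool}
    (hP : IsProfile q G τ) {x v : ℕ} : blockAt q τ x v ∈ profileWall q G τ ↔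
      v ≤ columnHeight (profileWall q G τ) x := by
  rw [blockAt_mem_profileWall hq]
  by_cases hv : v = 0
  · simp [hv]
  · rw [hP.le_columnHeight_iff hq (Nat.pos_of_ne_zero hv)]
    simp [hv]

theorem IsProfile.level_le {q : ℕ} (hq : 0 < q) {G : ℕ → ℕ} {τ : ℕ → Bool}
    (hP : IsProfile q G τ) {b : Block} (hb : b ∈ profileWall q G τ) :
    level q τ b ≤ columnHeight (profileWall q G τ) b.col := by
  rw [← hP.blockAt_mem_iff hq, blockAt_level hq τ hb.1]
  exact hb

/-- A column ends in a single half-block if and only if its height is divisible by `n - 1`. -/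
theorem IsProfile.isFullColumn_iff {q : ℕ} (hq : 0 < q) {G : ℕ → ℕ} {τ : ℕ → Bool}
    (hP : IsProfile q G τ) {x : ℕ} : IsFullColumn (q + 2) (profileWall q G τ) x ↔
      ¬ (q + 1) ∣ columnHeight (profileWall q G τ) x := by
  set h := columnHeight (profileWall q G τ) x with hh
  constructor
  · rintro ⟨r, h1, h2⟩ hd
    have hrow : rowOf q (h + 1) = rowOf q h := by rw [rowOf_succ hq, if_pos hd, add_zero]
    have h3 : rowOf q h ≤ r := by
      have := h2 (blockAt q τ x h) ((hP.blockAt_mem_iff hq).2 le_rfl) rfl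
      exact this
    obtain ⟨c, hc1, hc2, hc3⟩ : ∃ c : Block, c.InPattern (q + 2) ∧ c.col = x ∧ c.row = r := by
      by_cases hqr : q ∣ r
      · exact ⟨⟨x, r, Piece.lower⟩, by rw [inPattern_iff]; simp [hqr], rfl, rfl⟩
      · exact ⟨⟨x, r, Piece.full⟩, by rw [inPattern_iff]; simp [hqr], rfl, rfl⟩
    have h4 : level q τ c ≤ h := by
      have := hP.level_le hq (h1 c hc1 hc2 hc3)
      rwa [hc2] at this
    have h5 : r ≤ rowOf q h := by
      rw [← hc3, ← rowOf_level hq τ hc1]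
      exact rowOf_mono hq h4
    have h6 := h1 (blockAt q τ x (h + 1)) (blockAt_inPattern τ x _) rfl
      (hrow.trans (le_antisymm h3 h5))
    rw [hP.blockAt_mem_iff hq] at h6
    omega
  · intro hd
    refine ⟨rowOf q h, fun b hb hx hr => ?_, fun b hb hx => ?_⟩
    · have h1 : level q τ b ≤ h := by
        by_contra h2
        have := rowOf_lt hq (not_le.1 h2) hd
        rw [rowOf_level hq τ hb] at this
        omega
      rw [← blockAt_level hq τ hb, hP.blockAt_mem_iff hq, hx]
      exact h1
    · rw [← rowOf_level hq τ hb.1]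
      have := hP.level_le hq hb
      rw [hx] at this
      exact rowOf_mono hq this

theorem IsProfile.isYoungWall {q : ℕ} (hq : 0 < q) {G : ℕ → ℕ} {τ : ℕ → Bool}
    (hP : IsProfile q G τ) (hp : IsProper q G) : IsYoungWall (q + 2) (profileWall q G τ) where
  subset_pattern b hb := hb.1
  grey_mem b hb h := hP.grey_mem hq hb h
  finite_white := hP.finite_white hq
  supported := by
    intro b hb c hc hcol hrow
    rw [← blockAt_level hq τ hc, hP.blockAt_mem_iff hq, hcol]
    refine le_trans (le_of_not_gt fun h => ?_) (hP.level_le hq hb)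
    have := rowOf_mono hq h.le
    rw [rowOf_level hq τ hb.1, rowOf_level hq τ hc] at this
    omega
  left_closed := by
    rintro x r p ⟨h1, h2⟩
    refine ⟨h1, h2.imp id fun h => ?_⟩
    exact lt_trans (Nat.lt_succ_self x) h
  proper := by
    intro x y hx hy hxy
    rw [hP.isFullColumn_iff hq] at hx hy
    set h := columnHeight (profileWall q G τ) x with hh
    have h1 : 1 ≤ h := Nat.pos_of_ne_zero fun h0 => hx (by rw [h0]; exact dvd_zero _)
    have hx1 := (hP.le_columnHeight_iff hq (x := x) h1).1 le_rfl
    have hy1 := (hP.le_columnHeight_iff hq (x := y) h1).1 hxy.le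
    have hx2 := mt (hP.le_columnHeight_iff hq (x := x) (v := h + 1) (by omega)).2 (by omega)
    have hy2 := mt (hP.le_columnHeight_iff hq (x := y) (v := h + 1) (by omega)).2 (by omega)
    have := hp h hx
    omega

/-! ### Every Young wall has a profile -/

theorem mem_iff_lt_ncard {X : Set ℕ} (hfin : X.Finite) (h : ∀ x, x + 1 ∈ X → x ∈ X) (x : ℕ) :
    x ∈ X ↔ x < X.ncard := by
  have := eq_range_card_of_pred_mem (s := hfin.toFinset) (by simpa using h)
  rw [← hfin.mem_toFinset, Set.ncard_eq_toFinset_card X hfin]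
  conv_lhs => rw [this]
  exact Finset.mem_range

/-- Every Young wall has a profile.  In each row of half-blocks the columns containing one of the two
shapes are among those containing the other, since both sets of columns are initial segments. -/
theorem IsYoungWall.exists_profile {q : ℕ} (hq : 0 < q) {Y : Set Block}
    (hY : IsYoungWall (q + 2) Y) :
    ∃ G τ, IsProfile q G τ ∧ IsProper q G ∧ Y = profileWall q G τ := by
  classical
  -- the lower-right shape comes first whenever that is possible
  let τ : ℕ → Bool := fun k => ! decide (∀ x, (⟨x, q * k, Piece.upper⟩ : Block) ∈ Y →
    (⟨x, q * k, Piece.lower⟩ : Block) ∈ Y)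
  have hleft : ∀ d x r p, (⟨x + d, r, p⟩ : Block) ∈ Y → (⟨x, r, p⟩ : Block) ∈ Y := by
    intro d
    induction d with
    | zero => exact fun _ _ _ h => h
    | succ d ih => exact fun x r p h => ih x r p (hY.left_closed _ r p h)
  have hτ : ∀ k x, (⟨x, q * k, half (!τ k)⟩ : Block) ∈ Y → (⟨x, q * k, half (τ k)⟩ : Block) ∈ Y := by
    intro k x
    by_cases h : ∀ x, (⟨x, q * k, Piece.upper⟩ : Block) ∈ Y →
      (⟨x, q * k, Piece.lower⟩ : Block) ∈ Y
    · have : τ k = false := by simp only [τ, decide_eq_true h]; rfl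
      rw [this]
      exact h x
    · have : τ k = true := by simp only [τ, decide_eq_false h]; rfl
      rw [this]
      push Not at h
      obtain ⟨x₀, h1, h2⟩ := h
      intro hx
      have hlt : x < x₀ := by
        by_contra hge
        obtain ⟨d, rfl⟩ := Nat.exists_eq_add_of_le (not_lt.1 hge)
        exact h2 (hleft d x₀ _ _ hx)
      obtain ⟨d, rfl⟩ := Nat.exists_eq_add_of_lt hlt
      exact hleft (d + 1) x _ _ h1
  have hτ0 : τ 0 = false := by
    have h : ∀ x, (⟨x, q * 0, Piece.upper⟩ : Block) ∈ Y → (⟨x, q * 0, Piece.lower⟩ : Block) ∈ Y :=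
      fun x _ => hY.grey_mem _ (by rw [inPattern_iff]; simp) ⟨by simp, rfl⟩
    simp only [τ, decide_eq_true h]
    rfl
  have hwhite : ∀ x v, 1 ≤ v → ¬ (blockAt q τ x v).IsGrey := by
    intro x v hv h
    rw [← level_eq_zero_iff_isGrey hq hτ0 (blockAt_inPattern τ x v), level_blockAt hq] at h
    omega
  have hdown : ∀ x v, blockAt q τ x (v + 1) ∈ Y → blockAt q τ x v ∈ Y := by
    intro x v h
    by_cases hv : (q + 1) ∣ v
    · obtain ⟨k, rfl⟩ := hv
      have h1 := blockAt_eq (q := q) (k := k) (j := 1) τ x (by omega)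
      have h0 := blockAt_eq (q := q) (k := k) (j := 0) τ x (by omega)
      rw [add_zero] at h0
      rw [h1] at h
      rw [h0]
      exact hτ k x h
    · exact hY.supported _ h _ (blockAt_inPattern τ x v) rfl (rowOf_lt hq (Nat.lt_succ_self v) hv)
  -- the level `0` contains all grey blocks; there `G` repeats the value at level `1`
  let X : ℕ → Set ℕ := fun v => {x | blockAt q τ x (max v 1) ∈ Y}
  have hXfin : ∀ v, (X v).Finite := by
    intro v
    refine Set.Finite.of_finite_image (f := fun x => blockAt q τ x (max v 1))
      (hY.finite_white.subset ?_) (fun x _ y _ h => (blockAt_injective2 hq h).1)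
    rintro b ⟨x, hx, rfl⟩
    exact ⟨hx, hwhite x _ (le_max_right v 1)⟩
  have hX : ∀ v x, x ∈ X v ↔ x < (X v).ncard := fun v x =>
    mem_iff_lt_ncard (hXfin v) (fun x hx => hY.left_closed _ _ _ hx) x
  let G : ℕ → ℕ := fun v => (X v).ncard
  have hanti : Antitone G := by
    refine antitone_nat_of_succ_le fun v => Set.ncard_le_ncard ?_ (hXfin v)
    intro x hx
    cases v with
    | zero => exact hx
    | succ v =>
      change blockAt q τ x (max (v + 1 + 1) 1) ∈ Y at hx
      change blockAt q τ x (max (v + 1) 1) ∈ Y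
      rw [max_eq_left (by omega)] at hx ⊢
      exact hdown x _ hx
  have hmem : ∀ v x, 1 ≤ v → (blockAt q τ x v ∈ Y ↔ x < G v) := by
    intro v x hv
    rw [← hX]
    change _ ↔ blockAt q τ x (max v 1) ∈ Y
    rw [max_eq_left hv]
  have hev : ∃ B, ∀ v, B ≤ v → G v = 0 := by
    obtain ⟨B, hB⟩ := (hY.finite_white.image (level q τ)).bddAbove
    refine ⟨B + 1, fun v hv => ?_⟩
    by_contra h0
    have h1 := (hmem v 0 (by omega)).2 (Nat.pos_of_ne_zero h0)
    have := hB ⟨_, ⟨h1, hwhite 0 v (by omega)⟩, level_blockAt hq τ 0 v⟩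
    omega
  have hP : IsProfile q G τ := ⟨hanti, hev, hτ0⟩
  have hYeq : Y = profileWall q G τ := by
    ext b
    constructor
    · intro hb
      have hbp := hY.subset_pattern b hb
      refine ⟨hbp, ?_⟩
      by_cases h0 : level q τ b = 0
      · exact Or.inl h0
      · right
        rw [← hmem _ _ (Nat.pos_of_ne_zero h0), blockAt_level hq τ hbp]
        exact hb
    · rintro ⟨hbp, h0 | h0⟩
      · exact hY.grey_mem b hbp ((level_eq_zero_iff_isGrey hq hτ0 hbp).1 h0)
      · by_cases h1 : level q τ b = 0
        · exact hY.grey_mem b hbp ((level_eq_zero_iff_isGrey hq hτ0 hbp).1 h1)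
        · rw [← hmem _ _ (Nat.pos_of_ne_zero h1), blockAt_level hq τ hbp] at h0
          exact h0
  refine ⟨G, τ, hP, fun v hv => ?_, hYeq⟩
  by_contra hlt
  have hv1 : 1 ≤ v := Nat.pos_of_ne_zero fun h0 => hv (by rw [h0]; exact dvd_zero _)
  -- otherwise two full columns have the height `v`
  have hheight : ∀ x, G (v + 1) ≤ x → x < G v → columnHeight Y x = v := by
    intro x h1 h2
    rw [hYeq]
    have h3 := (hP.le_columnHeight_iff hq hv1).2 h2
    have h4 := mt (hP.le_columnHeight_iff hq (v := v + 1) (by omega)).1 (not_lt.2 h1)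
    omega
  have h1 := hheight (G (v + 1)) le_rfl (by omega)
  have h2 := hheight (G (v + 1) + 1) (by omega) (by omega)
  have hfull : ∀ x, columnHeight Y x = v → IsFullColumn (q + 2) Y x := by
    intro x hx
    rw [hYeq] at hx ⊢
    rw [hP.isFullColumn_iff hq, hx]
    exact hv
  have := hY.proper _ _ (hfull _ h1) (hfull _ h2) (h1.trans h2.symm)
  omega

/-! ### The abacus of a wall with a given profile -/

theorem IsProfile.columnHeight_eq_iff {q : ℕ} (hq : 0 < q) {G : ℕ → ℕ} {τ : ℕ → Bool}
    (hP : IsProfile q G τ) {x v : ℕ} (hv : 1 ≤ v) :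
    columnHeight (profileWall q G τ) x = v ↔ G (v + 1) ≤ x ∧ x < G v := by
  rw [← hP.le_columnHeight_iff hq hv, ← not_lt, ← hP.le_columnHeight_iff hq (by omega)]
  omega

theorem IsProfile.topIsLower_iff {q : ℕ} (hq : 0 < q) {G : ℕ → ℕ} {τ : ℕ → Bool}
    (hP : IsProfile q G τ) {x k : ℕ} (hk : columnHeight (profileWall q G τ) x = (q + 1) * k) :
    TopIsLower (profileWall q G τ) x ↔ τ k = false := by
  have hb : ∀ k j, j < 2 → blockAt q τ x ((q + 1) * k + j)
      = ⟨x, q * k, if j = 0 then half (τ k) else half (!τ k)⟩ := by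
    intro k j hj
    rw [blockAt_eq τ x (by omega), show j - 1 = 0 by omega, add_zero]
    congr 1
    split_ifs <;> first | rfl | omega
  constructor
  · rintro ⟨r, h1, h2⟩
    have hr : q ∣ r := by
      have := h1.1
      rw [inPattern_iff] at this
      by_contra h
      exact absurd (this.2 h) (by simp)
    obtain ⟨k', rfl⟩ := hr
    have h0 := hb k' 0 (by omega)
    have h1' := hb k' 1 (by omega)
    rw [if_pos rfl, add_zero] at h0
    rw [if_neg one_ne_zero] at h1'
    have m0 := hP.blockAt_mem_iff hq (x := x) (v := (q + 1) * k')
    have m1 := hP.blockAt_mem_iff hq (x := x) (v := (q + 1) * k' + 1)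
    rw [h0, hk] at m0
    rw [h1', hk] at m1
    cases hτ : τ k' with
    | true =>
      rw [hτ] at m0 m1
      have := m1.1 h1
      exact absurd (m0.2 (by omega)) h2
    | false =>
      rw [hτ] at m0 m1
      have ha := m0.1 h1
      have hb := mt m1.2 h2
      have : k' = k := by
        apply le_antisymm
        · exact Nat.le_of_mul_le_mul_left ha (Nat.succ_pos q)
        · by_contra hlt
          have := Nat.mul_le_mul_left (q + 1) (show k' + 1 ≤ k by omega)
          rw [mul_add] at this
          omega
      rw [← this, hτ]
  · intro hτ
    have h0 := hb k 0 (by omega)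
    have h1' := hb k 1 (by omega)
    rw [if_pos rfl, add_zero] at h0
    rw [if_neg one_ne_zero] at h1'
    refine ⟨q * k, ?_, ?_⟩
    · have m0 := hP.blockAt_mem_iff hq (x := x) (v := (q + 1) * k)
      rw [h0, hk, hτ] at m0
      exact m0.2 le_rfl
    · have m1 := hP.blockAt_mem_iff hq (x := x) (v := (q + 1) * k + 1)
      rw [h1', hk, hτ] at m1
      intro h
      have := m1.1 h
      omega

open Classical in
/-- The colour of the beads at the position `v`: `τ` gives the shape at the top of the columns of
height `v`, and the set counts the full columns shorter than `v`. -/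
noncomputable def profileColour (q : ℕ) (G : ℕ → ℕ) (τ : ℕ → Bool) (v : ℕ) : Colour :=
  if τ (v / (q + 1)) = false ↔ Even {w | (¬ (q + 1) ∣ w ∧ G w ≠ G (w + 1)) ∧ w < v}.ncard
  then Colour.white else Colour.black

/-- The configuration of a wall with a given profile: the number of beads at `v` is
`G v - G (v + 1)`. -/
noncomputable def profileBeads (q : ℕ) (G : ℕ → ℕ) (τ : ℕ → Bool) : Beads where
  plain := {v | ¬ (q + 1) ∣ v ∧ G v ≠ G (v + 1)}
  coloured := fun c v =>
    if 0 < v ∧ (q + 1) ∣ v ∧ c = profileColour q G τ v then G v - G (v + 1) else 0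

theorem IsProfile.ncard_shorter {q : ℕ} (hq : 0 < q) {G : ℕ → ℕ} {τ : ℕ → Bool}
    (hP : IsProfile q G τ) (hp : IsProper q G) (v : ℕ) :
    {y | IsFullColumn (q + 2) (profileWall q G τ) y ∧
      columnHeight (profileWall q G τ) y < v}.ncard
      = {w | (¬ (q + 1) ∣ w ∧ G w ≠ G (w + 1)) ∧ w < v}.ncard := by
  have hinj : Set.InjOn (columnHeight (profileWall q G τ))
      {y | IsFullColumn (q + 2) (profileWall q G τ) y ∧
        columnHeight (profileWall q G τ) y < v} := by
    rintro x ⟨hx, -⟩ y ⟨hy, -⟩ hxy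
    exact (hP.isYoungWall hq hp).proper x y hx hy hxy
  rw [← hinj.ncard_image]
  · congr 1
    ext w
    simp only [Set.mem_image, Set.mem_ofPred_eq, hP.isFullColumn_iff hq]
    constructor
    · rintro ⟨y, ⟨h1, h2⟩, rfl⟩
      refine ⟨⟨h1, ?_⟩, h2⟩
      have h3 := (hP.columnHeight_eq_iff hq (Nat.pos_of_ne_zero fun h0 => h1 (by
        rw [h0]; exact dvd_zero _))).1 (rfl : columnHeight (profileWall q G τ) y = _)
      omega
    · rintro ⟨⟨h1, h2⟩, h3⟩
      have h4 := hP.antitone (Nat.le_succ w)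
      have h5 := (hP.columnHeight_eq_iff hq (x := G (w + 1)) (v := w) (Nat.pos_of_ne_zero fun h0 =>
        h1 (by rw [h0]; exact dvd_zero _))).2 ⟨le_rfl, lt_of_le_of_ne h4 (Ne.symm h2)⟩
      exact ⟨_, by rw [h5]; exact ⟨h1, h3⟩, h5⟩

theorem IsProfile.columnColour_eq {q : ℕ} (hq : 0 < q) {G : ℕ → ℕ} {τ : ℕ → Bool}
    (hP : IsProfile q G τ) (hp : IsProper q G) {x v : ℕ} (hv : (q + 1) ∣ v)
    (hx : columnHeight (profileWall q G τ) x = v) :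
    columnColour (q + 2) (profileWall q G τ) x = profileColour q G τ v := by
  obtain ⟨k, rfl⟩ := hv
  unfold columnColour profileColour
  rw [hx, hP.topIsLower_iff hq hx, hP.ncard_shorter hq hp,
    Nat.mul_div_cancel_left _ (Nat.succ_pos q)]
  split_ifs <;> rfl

/-- The abacus of a wall with a given profile. -/
theorem IsProfile.abacus_eq {q : ℕ} (hq : 0 < q) {G : ℕ → ℕ} {τ : ℕ → Bool}
    (hP : IsProfile q G τ) (hp : IsProper q G) :
    YoungWall.abacus (n := q + 2) ⟨profileWall q G τ, hP.isYoungWall hq hp⟩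
      = profileBeads q G τ := by
  have hpos : ∀ w, ¬ (q + 1) ∣ w → 1 ≤ w := fun w h =>
    Nat.pos_of_ne_zero fun h0 => h (by rw [h0]; exact dvd_zero _)
  apply Beads.ext
  · ext w
    change (∃ x, IsFullColumn (q + 2) (profileWall q G τ) x ∧
      columnHeight (profileWall q G τ) x = w) ↔ ¬ (q + 1) ∣ w ∧ G w ≠ G (w + 1)
    simp only [hP.isFullColumn_iff hq]
    constructor
    · rintro ⟨x, h1, rfl⟩
      have := (hP.columnHeight_eq_iff hq (hpos _ h1)).1 rfl
      exact ⟨h1, by omega⟩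
    · rintro ⟨h1, h2⟩
      have h4 := hP.antitone (Nat.le_succ w)
      have h5 := (hP.columnHeight_eq_iff hq (x := G (w + 1)) (hpos w h1)).2
        ⟨le_rfl, lt_of_le_of_ne h4 (Ne.symm h2)⟩
      exact ⟨_, by rwa [h5], h5⟩
  · funext c v
    change {x | ¬ IsFullColumn (q + 2) (profileWall q G τ) x ∧
      0 < columnHeight (profileWall q G τ) x ∧ columnHeight (profileWall q G τ) x = v ∧
      columnColour (q + 2) (profileWall q G τ) x = c}.ncard =
      if 0 < v ∧ (q + 1) ∣ v ∧ c = profileColour q G τ v then G v - G (v + 1) else 0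
    split_ifs with h
    · obtain ⟨h1, h2, h3⟩ := h
      rw [← Nat.card_Ico, ← Set.ncard_coe_finset]
      congr 1
      ext x
      simp only [Set.mem_ofPred_eq, Finset.coe_Ico, Set.mem_Ico, hP.isFullColumn_iff hq, not_not]
      rw [← hP.columnHeight_eq_iff hq h1]
      constructor
      · exact fun h => h.2.2.1
      · intro hx
        exact ⟨by rwa [hx], by rwa [hx], hx, (hP.columnColour_eq hq hp h2 hx).trans h3.symm⟩
    · have : {x | ¬ IsFullColumn (q + 2) (profileWall q G τ) x ∧
          0 < columnHeight (profileWall q G τ) x ∧ columnHeight (profileWall q G τ) x = v ∧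
          columnColour (q + 2) (profileWall q G τ) x = c} = ∅ := by
        ext x
        simp only [Set.mem_ofPred_eq, Set.mem_empty_iff_false, iff_false, hP.isFullColumn_iff hq,
          not_not]
        rintro ⟨h1, h2, rfl, h4⟩
        exact h ⟨h2, h1, h4.symm.trans (hP.columnColour_eq hq hp h1 rfl)⟩
      rw [this, Set.ncard_empty]

theorem IsProfile.isConfig {q : ℕ} {G : ℕ → ℕ} {τ : ℕ → Bool}
    (hP : IsProfile q G τ) : (profileBeads q G τ).IsConfig (q + 2) := by
  obtain ⟨B, hB⟩ := hP.eventually_zero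
  have htot : ∀ v, (profileBeads q G τ).total v ≠ 0 →
      (0 < v ∧ (q + 1) ∣ v) ∧ G v ≠ G (v + 1) := by
    intro v hv
    by_contra h
    apply hv
    simp only [Beads.total, profileBeads]
    by_cases h1 : 0 < v ∧ (q + 1) ∣ v
    · have h2 : G v = G (v + 1) := by
        by_contra h2
        exact h ⟨h1, h2⟩
      simp [h2]
    · rw [if_neg (fun h => h1 ⟨h.1, h.2.1⟩), if_neg (fun h => h1 ⟨h.1, h.2.1⟩)]
  have hfin : ∀ S : Set ℕ, (∀ v ∈ S, G v ≠ G (v + 1)) → S.Finite := by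
    intro S hS
    refine (Set.finite_Iio B).subset fun v hv => ?_
    by_contra h
    rw [Set.mem_Iio, not_lt] at h
    exact hS v hv (by rw [hB v h, hB (v + 1) (by omega)])
  refine ⟨hfin _ fun v hv => hv.2, fun v hv => ⟨?_, hv.1⟩, hfin _ fun v hv => (htot v hv).2,
    fun v hv => (htot v hv).1, fun v => ?_⟩
  · exact Nat.pos_of_ne_zero fun h0 => hv.1 (by rw [h0]; exact dvd_zero _)
  · simp only [profileBeads]
    cases profileColour q G τ v <;> simp

/-- Containment of walls in terms of profiles. -/
theorem profileWall_subset {q : ℕ} (hq : 0 < q) {G G' : ℕ → ℕ} {τ τ' : ℕ → Bool}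
    (hP : IsProfile q G τ) (hP' : IsProfile q G' τ') (hle : ∀ v, 1 ≤ v → G' v ≤ G v)
    (hτ : ∀ k, 1 ≤ k → τ k = τ' k ∨ G' ((q + 1) * k) ≤ G ((q + 1) * k + 1)) :
    profileWall q G' τ' ⊆ profileWall q G τ := by
  rintro b ⟨hb, h0⟩
  by_cases h1 : level q τ' b = 0
  · exact hP.grey_mem hq hb ((level_eq_zero_iff_isGrey hq hP'.grey_first hb).1 h1)
  have h2 := h0.resolve_left h1
  refine ⟨hb, Or.inr ?_⟩
  by_cases hf : b.piece = Piece.full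
  · have : level q τ b = level q τ' b := by simp [level, hf]
    rw [this]
    exact h2.trans_le (hle _ (Nat.pos_of_ne_zero h1))
  · by_cases hτk : τ (b.row / q) = τ' (b.row / q)
    · have : level q τ b = level q τ' b := by simp only [level, hτk]
      rw [this]
      exact h2.trans_le (hle _ (Nat.pos_of_ne_zero h1))
    · have hk : 1 ≤ b.row / q := by
        refine Nat.pos_of_ne_zero fun h => hτk ?_
        rw [h, hP.grey_first, hP'.grey_first]
      have h3 := (hτ _ hk).resolve_left hτk
      have h4 : level q τ b ≤ (q + 1) * (b.row / q) + 1 := by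
        unfold level; rw [if_neg hf]; split_ifs <;> omega
      have h5 : (q + 1) * (b.row / q) ≤ level q τ' b := by
        unfold level; rw [if_neg hf]; split_ifs <;> omega
      have h6 := hP.antitone h4
      have h7 := hP'.antitone h5
      omega

theorem profileWall_congr {q : ℕ} (hq : 0 < q) {G G' : ℕ → ℕ} {τ τ' : ℕ → Bool}
    (hP : IsProfile q G τ) (hP' : IsProfile q G' τ') (hG : ∀ v, 1 ≤ v → G' v = G v)
    (hτ : ∀ k, 1 ≤ k → τ k = τ' k ∨ G ((q + 1) * k) = G ((q + 1) * k + 1)) :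
    profileWall q G τ = profileWall q G' τ' := by
  have hpos : ∀ k, 1 ≤ k → 1 ≤ (q + 1) * k := fun k hk => Nat.mul_pos (Nat.succ_pos q) hk
  refine Set.Subset.antisymm
    (profileWall_subset hq hP' hP (fun v hv => (hG v hv).ge) fun k hk => ?_)
    (profileWall_subset hq hP hP' (fun v hv => (hG v hv).le) fun k hk => ?_)
  · refine (hτ k hk).imp Eq.symm fun h => ?_
    rw [hG _ (by omega), h]
  · refine (hτ k hk).imp id fun h => ?_
    rw [hG _ (hpos k hk), h]

theorem eq_of_sub_succ_eq {G G' : ℕ → ℕ} {B : ℕ} (hB : G B = G' B)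
    {a : ℕ} (h : ∀ v, a ≤ v → v < B → G v + G' (v + 1) = G' v + G (v + 1)) :
    ∀ v, a ≤ v → v ≤ B → G v = G' v := by
  intro v hv hvB
  induction hvB using Nat.decreasingInduction with
  | self => exact hB
  | of_succ v hlt ih =>
    have h1 := h v hv hlt
    have h2 := ih (by omega)
    omega

theorem profileBeads_total {q : ℕ} (G : ℕ → ℕ) (τ : ℕ → Bool) {v : ℕ}
    (hv : 0 < v) (hd : (q + 1) ∣ v) : (profileBeads q G τ).total v = G v - G (v + 1) := by
  simp only [Beads.total, profileBeads, hv, hd, true_and]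
  cases profileColour q G τ v <;> simp

/-- The wall is determined by its abacus. -/
theorem profileWall_eq_of_profileBeads_eq {q : ℕ} (hq : 0 < q) {G G' : ℕ → ℕ} {τ τ' : ℕ → Bool}
    (hP : IsProfile q G τ) (hP' : IsProfile q G' τ') (hp : IsProper q G) (hp' : IsProper q G')
    (h : profileBeads q G τ = profileBeads q G' τ') :
    profileWall q G τ = profileWall q G' τ' := by
  have hplain : ∀ v, (¬ (q + 1) ∣ v ∧ G v ≠ G (v + 1)) ↔ (¬ (q + 1) ∣ v ∧ G' v ≠ G' (v + 1)) :=
    fun v => Set.ext_iff.1 (congrArg Beads.plain h) v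
  obtain ⟨B, hB⟩ := hP.eventually_zero
  obtain ⟨B', hB'⟩ := hP'.eventually_zero
  have hG : ∀ v, 1 ≤ v → G' v = G v := by
    intro v hv
    refine eq_of_sub_succ_eq (B := max v (max B B')) (a := 1) ?_ (fun w hw _ => ?_) v hv
      (le_max_left _ _)
    · rw [hB _ (by omega), hB' _ (by omega)]
    · have h1 := hP.antitone (Nat.le_succ w)
      have h2 := hP'.antitone (Nat.le_succ w)
      simp only [Nat.succ_eq_add_one] at h1 h2
      by_cases hd : (q + 1) ∣ w
      · have h3 := congrArg (fun A : Beads => A.total w) h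
        simp only [profileBeads_total _ _ hw hd] at h3
        omega
      · have h3 := hplain w
        simp only [hd, not_false_eq_true, true_and] at h3
        have h4 := hp w hd
        have h5 := hp' w hd
        omega
  refine profileWall_congr hq hP hP' hG fun k hk => ?_
  have hk' : 0 < (q + 1) * k := Nat.mul_pos (Nat.succ_pos q) hk
  by_cases hne : G ((q + 1) * k) = G ((q + 1) * k + 1)
  · exact Or.inr hne
  left
  have h1 := hP.antitone (Nat.le_succ ((q + 1) * k))
  have h2 := congrFun (congrFun (congrArg Beads.coloured h) (profileColour q G τ ((q + 1) * k)))
    ((q + 1) * k)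
  simp only [profileBeads, hk', dvd_mul_right, true_and, if_true, Nat.succ_eq_add_one] at h1 h2
  have h3 : profileColour q G τ ((q + 1) * k) = profileColour q G' τ' ((q + 1) * k) := by
    by_contra h4
    rw [if_neg h4] at h2
    omega
  simp only [profileColour, Nat.mul_div_cancel_left _ (Nat.succ_pos q), hplain] at h3
  generalize {w | (¬ (q + 1) ∣ w ∧ G' w ≠ G' (w + 1)) ∧ w < (q + 1) * k}.ncard = N at h3
  by_cases hE : Even N <;> cases h5 : τ k <;> cases h6 : τ' k <;> simp [h5, h6, hE] at h3 ⊢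

/-! ### The Young wall with a given abacus -/

open Classical in
/-- The number of beads at the position `v`. -/
noncomputable def Beads.count (A : Beads) (v : ℕ) : ℕ := (if v ∈ A.plain then 1 else 0) + A.total v

/-- The number of beads at positions at least `v`. -/
noncomputable def Beads.above (A : Beads) (v : ℕ) : ℕ := ∑ᶠ s ∈ Set.Ici v, A.count s

/-- The number of uncoloured beads at positions less than `v`. -/
noncomputable def Beads.shorter (A : Beads) (v : ℕ) : ℕ := {w ∈ A.plain | w < v}.ncard

open Classical in
/-- Which half-block comes first in row `q k` of the wall with a given abacus: the upper-left one if
and only if either the beads at position `(q + 1) k` are black or the number of uncoloured beads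
at smaller positions is odd, but not both.  For `k = 0` this is the grey half-block. -/
noncomputable def Beads.upperFirst (q : ℕ) (A : Beads) (k : ℕ) : Bool :=
  decide (Odd ((if A.coloured Colour.black ((q + 1) * k) = 0 then 0 else 1)
    + A.shorter ((q + 1) * k)))

theorem Beads.IsConfig.exists_bound {n : ℕ} {A : Beads} (hA : A.IsConfig n) :
    ∃ B, ∀ v, B ≤ v → A.count v = 0 := by
  obtain ⟨B, hB⟩ := (hA.plain_finite.union hA.coloured_finite).bddAbove
  refine ⟨B + 1, fun v hv => ?_⟩
  have h : v ∉ A.plain ∪ {s | A.total s ≠ 0} := fun h => by have := hB h; omega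
  simp only [Set.mem_union, Set.mem_ofPred_eq, not_or, not_not] at h
  rw [Beads.count, if_neg h.1, h.2]

theorem Beads.count_eq_zero {A : Beads} {v : ℕ} (h : A.count v = 0) :
    v ∉ A.plain ∧ ∀ c, A.coloured c v = 0 := by
  rw [Beads.count, Beads.total] at h
  split_ifs at h with h1
  · omega
  · refine ⟨h1, fun c => ?_⟩
    cases c <;> omega

theorem Beads.above_eq_sum {A : Beads} {B : ℕ} (hB : ∀ v, B ≤ v → A.count v = 0) (v : ℕ) :
    A.above v = ∑ s ∈ Finset.Ico v B, A.count s := by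
  unfold Beads.above
  apply finsum_mem_eq_sum_of_inter_support_eq
  ext s
  simp only [Set.mem_inter_iff, Set.mem_Ici, Function.mem_support, Finset.coe_Ico, Set.mem_Ico]
  constructor
  · rintro ⟨h1, h2⟩
    exact ⟨⟨h1, lt_of_not_ge fun h => h2 (hB s h)⟩, h2⟩
  · rintro ⟨⟨h1, -⟩, h2⟩
    exact ⟨h1, h2⟩

theorem Beads.above_eq_zero {A : Beads} {B : ℕ} (hB : ∀ v, B ≤ v → A.count v = 0) {v : ℕ}
    (hv : B ≤ v) : A.above v = 0 := by
  rw [Beads.above_eq_sum hB, Finset.Ico_eq_empty_of_le hv, Finset.sum_empty]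

theorem Beads.IsConfig.above_succ {n : ℕ} {A : Beads} (hA : A.IsConfig n) (v : ℕ) :
    A.above v = A.count v + A.above (v + 1) := by
  obtain ⟨B, hB⟩ := hA.exists_bound
  by_cases h : v < B
  · rw [Beads.above_eq_sum hB, Beads.above_eq_sum hB, Finset.sum_eq_sum_Ico_succ_bot h]
  · rw [Beads.above_eq_zero hB (by omega), Beads.above_eq_zero hB (by omega), hB v (by omega)]

theorem Beads.IsConfig.count_of_not_dvd {q : ℕ} {A : Beads} (hA : A.IsConfig (q + 2)) {v : ℕ}
    (hv : ¬ (q + 1) ∣ v) : A.total v = 0 := by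
  by_contra h
  exact hv (hA.coloured_pos v h).2

theorem Beads.IsConfig.not_mem_plain {q : ℕ} {A : Beads} (hA : A.IsConfig (q + 2)) {v : ℕ}
    (hv : (q + 1) ∣ v) : v ∉ A.plain := fun h => (hA.plain_pos v h).2 hv

theorem Beads.IsConfig.count_of_dvd {q : ℕ} {A : Beads} (hA : A.IsConfig (q + 2)) {v : ℕ}
    (hv : (q + 1) ∣ v) : A.count v = A.total v := by
  rw [Beads.count, if_neg (hA.not_mem_plain hv), zero_add]

theorem Beads.IsConfig.coloured_zero {q : ℕ} {A : Beads} (hA : A.IsConfig (q + 2)) (c : Colour) :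
    A.coloured c 0 = 0 := by
  have h : A.total 0 = 0 := by
    by_contra h
    exact absurd (hA.coloured_pos 0 h).1 (lt_irrefl 0)
  rw [Beads.total] at h
  cases c <;> omega

theorem Beads.IsConfig.count_zero {q : ℕ} {A : Beads} (hA : A.IsConfig (q + 2)) :
    A.count 0 = 0 := by
  rw [hA.count_of_dvd (dvd_zero _), Beads.total, hA.coloured_zero, hA.coloured_zero]

theorem Beads.IsConfig.isProfile {q : ℕ} {A : Beads} (hA : A.IsConfig (q + 2)) :
    IsProfile q A.above (A.upperFirst q) where
  antitone := antitone_nat_of_succ_le fun v => by rw [hA.above_succ v]; exact Nat.le_add_left _ _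
  eventually_zero := by
    obtain ⟨B, hB⟩ := hA.exists_bound
    exact ⟨B, fun v hv => Beads.above_eq_zero hB hv⟩
  grey_first := by
    simp [Beads.upperFirst, hA.coloured_zero, Beads.shorter]

theorem Beads.IsConfig.isProper {q : ℕ} {A : Beads} (hA : A.IsConfig (q + 2)) :
    IsProper q A.above := by
  intro v hv
  rw [hA.above_succ v, Beads.count, hA.count_of_not_dvd hv]
  split_ifs <;> omega

theorem Beads.IsConfig.profileBeads_eq {q : ℕ} {A : Beads} (hA : A.IsConfig (q + 2)) :
    profileBeads q A.above (A.upperFirst q) = A := by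
  have hplain : ∀ v, (¬ (q + 1) ∣ v ∧ A.above v ≠ A.above (v + 1)) ↔ v ∈ A.plain := by
    intro v
    rw [hA.above_succ v, Beads.count]
    constructor
    · rintro ⟨h1, h2⟩
      by_contra h3
      rw [if_neg h3, hA.count_of_not_dvd h1] at h2
      omega
    · intro h
      have h1 := (hA.plain_pos v h).2
      refine ⟨h1, ?_⟩
      rw [if_pos h, hA.count_of_not_dvd h1]
      omega
  apply Beads.ext
  · exact Set.ext hplain
  · funext c v
    simp only [profileBeads]
    by_cases hv : 0 < v ∧ (q + 1) ∣ v
    · obtain ⟨h0, k, rfl⟩ := hv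
      have hcol : profileColour q A.above (A.upperFirst q) ((q + 1) * k)
          = if A.coloured Colour.black ((q + 1) * k) = 0 then Colour.white else Colour.black := by
        unfold profileColour
        simp only [hplain]
        rw [Nat.mul_div_cancel_left _ (Nat.succ_pos q)]
        change (if _ ↔ Even (A.shorter ((q + 1) * k)) then _ else _) = _
        unfold Beads.upperFirst
        by_cases hb : A.coloured Colour.black ((q + 1) * k) = 0
        · simp [hb]
        · have : Even (1 + A.shorter ((q + 1) * k)) ↔ ¬ Even (A.shorter ((q + 1) * k)) := by
            rw [add_comm, Nat.even_add_one]
          by_cases hN : Even (A.shorter ((q + 1) * k)) <;> simp [hb, this, hN]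
      rw [hcol, hA.above_succ ((q + 1) * k), hA.count_of_dvd (dvd_mul_right _ _), Beads.total,
        Nat.add_sub_cancel]
      have hone := hA.one_colour ((q + 1) * k)
      simp only [h0, dvd_mul_right, true_and]
      by_cases hb : A.coloured Colour.black ((q + 1) * k) = 0
      · cases c <;> simp [hb]
      · have hw := hone.resolve_right hb
        cases c <;> simp [hb, hw]
    · rw [if_neg fun h => hv ⟨h.1, h.2.1⟩]
      have h : A.total v = 0 := by
        by_contra h
        exact hv (hA.coloured_pos v h)
      rw [Beads.total] at h
      cases c <;> omega

/-- The Young wall with a given abacus. -/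
noncomputable def wallOf {q : ℕ} (hq : 0 < q) {A : Beads} (hA : A.IsConfig (q + 2)) :
    YoungWall (q + 2) :=
  ⟨profileWall q A.above (A.upperFirst q), hA.isProfile.isYoungWall hq hA.isProper⟩

theorem abacus_wallOf {q : ℕ} (hq : 0 < q) {A : Beads} (hA : A.IsConfig (q + 2)) :
    (wallOf hq hA).abacus = A :=
  (hA.isProfile.abacus_eq hq hA.isProper).trans hA.profileBeads_eq

theorem abacus_isConfig {q : ℕ} (hq : 0 < q) (Y : YoungWall (q + 2)) :
    Y.abacus.IsConfig (q + 2) := by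
  obtain ⟨Y, hY⟩ := Y
  obtain ⟨G, τ, hP, hp, rfl⟩ := hY.exists_profile hq
  rw [hP.abacus_eq hq hp]
  exact hP.isConfig

theorem abacus_injective {q : ℕ} (hq : 0 < q) :
    Function.Injective (fun Y : YoungWall (q + 2) => Y.abacus) := by
  rintro ⟨Y, hY⟩ ⟨Y', hY'⟩ h
  obtain ⟨G, τ, hP, hp, rfl⟩ := hY.exists_profile hq
  obtain ⟨G', τ', hP', hp', rfl⟩ := hY'.exists_profile hq
  simp only [hP.abacus_eq hq hp, hP'.abacus_eq hq hp'] at h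
  exact Subtype.ext (profileWall_eq_of_profileBeads_eq hq hP hP' hp hp' h)

theorem wallOf_abacus {q : ℕ} (hq : 0 < q) (Y : YoungWall (q + 2)) :
    wallOf hq (abacus_isConfig hq Y) = Y :=
  abacus_injective hq (abacus_wallOf hq _)

theorem abacus_bijOn {q : ℕ} (hq : 0 < q) : Set.BijOn (fun Y : YoungWall (q + 2) => Y.abacus)
    Set.univ {A | A.IsConfig (q + 2)} :=
  ⟨fun Y _ => abacus_isConfig hq Y, (abacus_injective hq).injOn,
    fun _ hA => ⟨wallOf hq hA, trivial, abacus_wallOf hq hA⟩⟩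

/-! ### Label counts of walls -/

/-- The class of a level, in terms of labels: `1` for the labels `0, 1`, `n - 1` for the labels
`n - 1, n`, and otherwise the label itself; here `n = q + 2`. -/
def levelClass (q v : ℕ) : ℕ :=
  if v / (q + 1) % 2 = 0 then (if v % (q + 1) = 0 then 1 else v % (q + 1))
  else (if v % (q + 1) = 0 then q + 1 else q + 2 - v % (q + 1))

/-- Whether the half-block at a level is the upper-left one. -/
def upperAt (q : ℕ) (τ : ℕ → Bool) (v : ℕ) : Bool :=
  if v % (q + 1) = 0 then τ (v / (q + 1)) else !τ (v / (q + 1))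

theorem levelClass_eq {q k j : ℕ} (hj : j < q + 1) : levelClass q ((q + 1) * k + j) =
    if k % 2 = 0 then (if j = 0 then 1 else j) else (if j = 0 then q + 1 else q + 2 - j) := by
  rw [levelClass, level_div hj, level_mod hj]

theorem levelClass_bounds {q : ℕ} (v : ℕ) : 1 ≤ levelClass q v ∧ levelClass q v ≤ q + 1 := by
  obtain ⟨k, j, hj, rfl⟩ := exists_level_eq q v
  rw [levelClass_eq hj]
  split_ifs <;> omega

theorem half_eq_upper_iff (b : Bool) : half b = Piece.upper ↔ b = true := by
  cases b <;> simp [half]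

/-- The labels of the pattern in terms of levels. -/
theorem label_blockAt {q : ℕ} (hq : 2 ≤ q) (τ : ℕ → Bool) (x v : ℕ) :
    (blockAt q τ x v).label (q + 2) =
      if levelClass q v = 1 then (if upperAt q τ v = true ↔ Even x then 0 else 1)
      else if levelClass q v = q + 1 then (if upperAt q τ v = true ↔ Even x then q + 1 else q + 2)
      else levelClass q v := by
  obtain ⟨k, j, hj, rfl⟩ := exists_level_eq q v
  rw [blockAt_eq τ x hj, levelClass_eq hj, upperAt, level_div hj, level_mod hj]
  have hpiece : ∀ j, j ≤ 1 → (if j = 0 then half (τ k) else if j = 1 then half (!τ k)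
      else Piece.full) = half (if j = 0 then τ k else !τ k) := by
    intro j hj
    split_ifs <;> first | rfl | omega
  obtain ⟨a, rfl | rfl⟩ : ∃ a, k = 2 * a ∨ k = 2 * a + 1 := ⟨k / 2, by omega⟩
  · have hr : (q * (2 * a) + (j - 1)) % (2 * q) = j - 1 := by
      rw [show q * (2 * a) = 2 * q * a by ring, Nat.mul_add_mod, Nat.mod_eq_of_lt (by omega)]
    unfold Block.label
    simp only [show q + 2 - 2 = q from rfl, hr, show 2 * a % 2 = 0 by omega, if_true]
    by_cases hj1 : j ≤ 1
    · simp only [hpiece j hj1, half_eq_upper_iff]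
      have hc : (if j = 0 then 1 else j) = 1 := by split_ifs <;> omega
      simp only [hc, show j - 1 = 0 by omega, if_true]
    · rw [if_neg (by omega), if_neg (by omega), if_pos (by omega), if_neg (by split_ifs <;> omega),
        if_neg (by split_ifs <;> omega), if_neg (by omega)]
      omega
  · have hr : (q * (2 * a + 1) + (j - 1)) % (2 * q) = q + (j - 1) := by
      rw [show q * (2 * a + 1) + (j - 1) = 2 * q * a + (q + (j - 1)) by ring, Nat.mul_add_mod,
        Nat.mod_eq_of_lt (by omega)]
    unfold Block.label
    simp only [show q + 2 - 2 = q from rfl, hr, show (2 * a + 1) % 2 = 1 by omega, one_ne_zero,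
      if_false]
    by_cases hj1 : j ≤ 1
    · simp only [hpiece j hj1, half_eq_upper_iff]
      have hc : (if j = 0 then q + 1 else q + 2 - j) = q + 1 := by split_ifs <;> omega
      simp only [hc, show j - 1 = 0 by omega, add_zero, show ¬ q = 0 by omega,
        show ¬ q + 1 = 1 by omega, if_true, if_false]
      rfl
    · rw [if_neg (by omega), if_neg (by omega), if_neg (by omega), if_neg (by split_ifs <;> omega),
        if_neg (by split_ifs <;> omega), if_neg (by omega)]
      omega

/-- The number of white blocks with label `j`. -/
noncomputable def labelCount (n : ℕ) (Y : Set Block) (j : ℕ) : ℕ :=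
  {b ∈ Y | ¬ b.IsGrey ∧ b.label n = j}.ncard

/-- The number of white blocks in the levels of class `i`. -/
noncomputable def classCount (q : ℕ) (G : ℕ → ℕ) (B i : ℕ) : ℕ :=
  ∑ v ∈ Finset.Ico 1 B, if levelClass q v = i then G v else 0

/-- The difference between the numbers of blocks with the two labels of the half-blocks of class
`i`: along a level the two labels alternate. -/
noncomputable def classDiff (q : ℕ) (G : ℕ → ℕ) (τ : ℕ → Bool) (B i : ℕ) : ℤ :=
  ∑ v ∈ Finset.Ico 1 B, if levelClass q v = i
    then (if upperAt q τ v = true then 1 else -1) * ((G v % 2 : ℕ) : ℤ) else 0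

theorem card_filter_even_range (g : ℕ) :
    ((Finset.range g).filter fun x => Even x).card = (g + 1) / 2 := by
  induction g with
  | zero => rfl
  | succ g ih =>
    rw [Finset.range_add_one, Finset.filter_insert]
    split_ifs with h
    · rw [Finset.card_insert_of_notMem (by simp), ih]
      rw [Nat.even_iff] at h
      omega
    · rw [ih]
      rw [Nat.even_iff] at h
      omega

theorem card_filter_iff_even_range (u : Bool) (g : ℕ) :
    ((Finset.range g).filter fun x => (u = true ↔ Even x)).card
      = if u = true then (g + 1) / 2 else g / 2 := by
  have h1 := card_filter_even_range g
  cases u with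
  | true => simpa using h1
  | false =>
    have h2 := Finset.card_filter_add_card_filter_not (s := Finset.range g) (fun x => Even x)
    rw [h1, Finset.card_range] at h2
    simp only [Bool.false_eq_true, false_iff, if_false]
    omega

theorem card_filter_not_iff_even_range (u : Bool) (g : ℕ) :
    ((Finset.range g).filter fun x => ¬ (u = true ↔ Even x)).card
      = if u = true then g / 2 else (g + 1) / 2 := by
  have h1 := card_filter_iff_even_range u g
  have h2 := Finset.card_filter_add_card_filter_not (s := Finset.range g)
    (fun x => (u = true ↔ Even x))
  rw [h1, Finset.card_range] at h2
  split_ifs at h2 ⊢ <;> omega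

section

variable {q : ℕ} {G : ℕ → ℕ} {τ : ℕ → Bool} {B : ℕ}

theorem IsProfile.labelCount_eq_classCount (hq : 2 ≤ q) (hP : IsProfile q G τ)
    (hB : ∀ v, B ≤ v → G v = 0) {j : ℕ} (h2 : 2 ≤ j) (hj : j ≤ q) :
    labelCount (q + 2) (profileWall q G τ) j = classCount q G B j := by
  rw [labelCount, ncard_white_blocks (by omega) hP hB, classCount]
  refine Finset.sum_congr rfl fun v _ => ?_
  have hl : ∀ x, (blockAt q τ x v).label (q + 2) = j ↔ levelClass q v = j := by
    intro x
    rw [label_blockAt hq]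
    split_ifs <;> omega
  simp only [hl]
  split_ifs with h <;> simp [h]

/-- Along a level of half-blocks two labels alternate, so that a level with `G v` blocks contributes
to their difference only if `G v` is odd. -/
theorem IsProfile.labelCount_half (hq : 2 ≤ q) (hP : IsProfile q G τ)
    (hB : ∀ v, B ≤ v → G v = 0) {i j : ℕ} (hij : (i = 1 ∧ j = 0) ∨ (i = q + 1 ∧ j = q + 1)) :
    labelCount (q + 2) (profileWall q G τ) j + labelCount (q + 2) (profileWall q G τ) (j + 1)
        = classCount q G B i ∧
    (labelCount (q + 2) (profileWall q G τ) j : ℤ)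
      - labelCount (q + 2) (profileWall q G τ) (j + 1) = classDiff q G τ B i := by
  have hl1 : ∀ x v, (blockAt q τ x v).label (q + 2) = j ↔
      levelClass q v = i ∧ (upperAt q τ v = true ↔ Even x) := by
    intro x v
    rw [label_blockAt hq]
    have := levelClass_bounds (q := q) v
    by_cases hu : upperAt q τ v = true ↔ Even x
    · simp only [eq_true hu, if_true, and_true]
      split_ifs <;> omega
    · simp only [eq_false hu, if_false, and_false, iff_false]
      split_ifs <;> omega
  have hl2 : ∀ x v, (blockAt q τ x v).label (q + 2) = j + 1 ↔
      levelClass q v = i ∧ ¬ (upperAt q τ v = true ↔ Even x) := by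
    intro x v
    rw [label_blockAt hq]
    have := levelClass_bounds (q := q) v
    by_cases hu : upperAt q τ v = true ↔ Even x
    · simp only [eq_true hu, if_true, not_true, and_false, iff_false]
      split_ifs <;> first | omega | exact not_false
    · simp only [eq_false hu, if_false, not_false_eq_true, and_true]
      split_ifs <;> omega
  have h1 : ∀ v, ((Finset.range (G v)).filter fun x => (blockAt q τ x v).label (q + 2) = j).card
      = if levelClass q v = i then (if upperAt q τ v = true then (G v + 1) / 2 else G v / 2)
        else 0 := by
    intro v
    simp only [hl1]
    rw [← card_filter_iff_even_range]
    split_ifs with h <;> simp [h]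
  have h2 : ∀ v, ((Finset.range (G v)).filter
      fun x => (blockAt q τ x v).label (q + 2) = j + 1).card
      = if levelClass q v = i then (if upperAt q τ v = true then G v / 2 else (G v + 1) / 2)
        else 0 := by
    intro v
    simp only [hl2]
    rw [← card_filter_not_iff_even_range]
    split_ifs with h <;> simp [h]
  simp only [labelCount, ncard_white_blocks (show 0 < q by omega) hP hB, h1, h2, classCount,
    classDiff]
  constructor
  · rw [← Finset.sum_add_distrib]
    refine Finset.sum_congr rfl fun v _ => ?_
    split_ifs <;> omega
  · push_cast
    rw [← Finset.sum_sub_distrib]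
    refine Finset.sum_congr rfl fun v _ => ?_
    split_ifs <;> omega

theorem IsProfile.size_eq (hq : 2 ≤ q) (hP : IsProfile q G τ) (hp : IsProper q G)
    (hB : ∀ v, B ≤ v → G v = 0) :
    YoungWall.size (n := q + 2) ⟨profileWall q G τ, hP.isYoungWall (by omega) hp⟩
      = ∑ v ∈ Finset.Ico 1 B, G v := by
  have h := ncard_white_blocks (q := q) (by omega) hP hB (fun _ => True)
  simp only [and_true, Finset.filter_true, Finset.card_range] at h
  exact h

end

/-- Passing to a smaller wall, the label counts drop by those of the difference. -/
theorem labelCount_sdiff {n : ℕ} {Y Y' : Set Block} (hY : IsYoungWall n Y)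
    (hY' : IsYoungWall n Y') (h : Y' ⊆ Y) (j : ℕ) :
    labelCount n Y j = labelCount n Y' j + {b ∈ Y \ Y' | b.label n = j}.ncard := by
  have hfin : {b ∈ Y | ¬ b.IsGrey ∧ b.label n = j}.Finite :=
    hY.finite_white.subset fun b hb => ⟨hb.1, hb.2.1⟩
  have hfin1 : {b ∈ Y' | ¬ b.IsGrey ∧ b.label n = j}.Finite :=
    hfin.subset fun b hb => ⟨h hb.1, hb.2⟩
  have hfin2 : {b ∈ Y \ Y' | b.label n = j}.Finite :=
    hfin.subset fun b hb => ⟨hb.1.1, fun hg => hb.1.2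
      (hY'.grey_mem b (hY.subset_pattern b hb.1.1) hg), hb.2⟩
  unfold labelCount
  rw [← Set.ncard_union_eq (hs := hfin1) (ht := hfin2)]
  · congr 1
    ext b
    simp only [Set.mem_union, Set.mem_ofPred_eq, Set.mem_sdiff]
    constructor
    · rintro ⟨h1, h2, h3⟩
      by_cases hb : b ∈ Y'
      · exact Or.inl ⟨hb, h2, h3⟩
      · exact Or.inr ⟨⟨h1, hb⟩, h3⟩
    · rintro (⟨h1, h2, h3⟩ | ⟨⟨h1, h2⟩, h3⟩)
      · exact ⟨h h1, h2, h3⟩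
      · exact ⟨h1, fun hg => h2 (hY'.grey_mem b (hY.subset_pattern b h1) hg), h3⟩
  · rw [Set.disjoint_left]
    rintro b ⟨h1, -⟩ ⟨⟨-, h2⟩, -⟩
    exact h2 h1

/-- The bar condition in terms of the label counts of the two walls. -/
theorem isBar_sdiff_iff {n : ℕ} {Y Y' : Set Block} (hY : IsYoungWall n Y)
    (hY' : IsYoungWall n Y') (h : Y' ⊆ Y) : IsBar n (Y \ Y') ↔ BlocksConnected (Y \ Y') ∧
      ∀ j ≤ n, labelCount n Y j = labelCount n Y' j + if 2 ≤ j ∧ j ≤ n - 2 then 2 else 1 := by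
  unfold IsBar
  simp only [labelCount_sdiff hY hY' h, Nat.add_left_cancel_iff]

/-- The label counts of a wall and a smaller wall differ by those of a bar if and only if the class
counts differ by `2` and the label differences agree. -/
theorem labelCount_eq_add_iff {q : ℕ} {G G' : ℕ → ℕ} {τ τ' : ℕ → Bool} {B : ℕ} (hq : 2 ≤ q)
    (hP : IsProfile q G τ) (hP' : IsProfile q G' τ') (hB : ∀ v, B ≤ v → G v = 0)
    (hB' : ∀ v, B ≤ v → G' v = 0) :
    (∀ j ≤ q + 2, labelCount (q + 2) (profileWall q G τ) j
      = labelCount (q + 2) (profileWall q G' τ') j + if 2 ≤ j ∧ j ≤ q + 2 - 2 then 2 else 1) ↔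
    (∀ i, 1 ≤ i → i ≤ q + 1 → classCount q G B i = classCount q G' B i + 2) ∧
      classDiff q G τ B 1 = classDiff q G' τ' B 1 ∧
      classDiff q G τ B (q + 1) = classDiff q G' τ' B (q + 1) := by
  obtain ⟨a1, a2⟩ := hP.labelCount_half hq hB (i := 1) (j := 0) (Or.inl ⟨rfl, rfl⟩)
  obtain ⟨b1, b2⟩ := hP.labelCount_half hq hB (i := q + 1) (j := q + 1) (Or.inr ⟨rfl, rfl⟩)
  obtain ⟨a1', a2'⟩ := hP'.labelCount_half hq hB' (i := 1) (j := 0) (Or.inl ⟨rfl, rfl⟩)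
  obtain ⟨b1', b2'⟩ := hP'.labelCount_half hq hB' (i := q + 1) (j := q + 1) (Or.inr ⟨rfl, rfl⟩)
  rw [zero_add] at a1 a2 a1' a2'
  rw [show q + 1 + 1 = q + 2 from rfl] at b1 b2 b1' b2'
  constructor
  · intro h
    have h0 := h 0 (by omega)
    have h1 := h 1 (by omega)
    have h2 := h (q + 1) (by omega)
    have h3 := h (q + 2) (by omega)
    rw [if_neg (by omega)] at h0 h1 h2 h3
    refine ⟨fun i hi1 hi2 => ?_, by omega, by omega⟩
    by_cases e1 : i = 1
    · subst e1; omega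
    · by_cases e2 : i = q + 1
      · subst e2; omega
      · have h4 := h i (by omega)
        rw [if_pos (by omega), hP.labelCount_eq_classCount hq hB (by omega) (by omega),
          hP'.labelCount_eq_classCount hq hB' (by omega) (by omega)] at h4
        exact h4
  · rintro ⟨h1, h2, h3⟩ j hj
    have c1 := h1 1 le_rfl (by omega)
    have c2 := h1 (q + 1) (by omega) le_rfl
    by_cases e : 2 ≤ j ∧ j ≤ q
    · rw [if_pos (by omega), hP.labelCount_eq_classCount hq hB e.1 e.2,
        hP'.labelCount_eq_classCount hq hB' e.1 e.2]
      exact h1 j (by omega) (by omega)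
    · rw [if_neg (by omega)]
      obtain rfl | rfl | rfl | rfl : j = 0 ∨ j = 1 ∨ j = q + 1 ∨ j = q + 2 := by omega
      all_goals omega

/-! ### Summation by parts -/

/-- Abel summation. -/
theorem sum_mul_eq_sum_sub_mul {f F G c : ℕ → ℕ} {B : ℕ} (h0 : F 0 = 0)
    (hF : ∀ v, F (v + 1) = F v + f (v + 1)) (hG : ∀ v, G v = c v + G (v + 1)) (hB : 1 ≤ B)
    (hGB : G B = 0) : ∑ v ∈ Finset.Ico 1 B, f v * G v = ∑ v ∈ Finset.Ico 1 B, c v * F v := by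
  have key : ∀ b, 1 ≤ b → ∑ v ∈ Finset.Ico 1 b, f v * G v
      = ∑ v ∈ Finset.Ico 1 b, c v * F v + F (b - 1) * G b := by
    intro b hb
    induction b, hb using Nat.le_induction with
    | base => simp [h0]
    | succ b hb ih =>
      rw [Finset.sum_Ico_succ_top hb, Finset.sum_Ico_succ_top hb, ih, hG b, Nat.add_sub_cancel]
      have := hF (b - 1)
      rw [Nat.sub_add_cancel hb] at this
      rw [this]
      ring
  rw [key B hB, hGB, mul_zero, add_zero]

/-- The number of levels from `1` to `s` of class `i`. -/
def classLevels (q i s : ℕ) : ℕ :=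
  2 * (s / (2 * q + 2)) + (if i ≤ s % (2 * q + 2) then 1 else 0)
    + (if 2 * q + 3 - i ≤ s % (2 * q + 2) then 1 else 0)

theorem classLevels_succ {q i : ℕ} (hi : 1 ≤ i) (hi' : i ≤ q + 1) (v : ℕ) :
    classLevels q i (v + 1) = classLevels q i v + if levelClass q (v + 1) = i then 1 else 0 := by
  obtain ⟨k, j, hj, hv⟩ := exists_level_eq q (v + 1)
  rw [hv, levelClass_eq hj, ← hv]
  have hN := Nat.div_add_mod v (2 * q + 2)
  have hlt := Nat.mod_lt v (show 0 < 2 * q + 2 by omega)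
  obtain ⟨a, ha⟩ : ∃ a, a = v / (2 * q + 2) := ⟨_, rfl⟩
  obtain ⟨r, hr⟩ : ∃ r, r = v % (2 * q + 2) := ⟨_, rfl⟩
  rw [← ha, ← hr] at hN
  rw [← hr] at hlt
  -- the quotient and the remainder of `v + 1`
  have hk : (r + 1 < 2 * q + 2 ∧ (v + 1) / (2 * q + 2) = a ∧ (v + 1) % (2 * q + 2) = r + 1 ∧
      k % 2 = (r + 1) / (q + 1) ∧ j = (r + 1) % (q + 1)) ∨
      (r + 1 = 2 * q + 2 ∧ (v + 1) / (2 * q + 2) = a + 1 ∧ (v + 1) % (2 * q + 2) = 0 ∧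
      k % 2 = 0 ∧ j = 0) := by
    have e1 : k = (v + 1) / (q + 1) := by rw [hv, level_div hj]
    have e2 : j = (v + 1) % (q + 1) := by rw [hv, level_mod hj]
    by_cases h : r + 1 < 2 * q + 2
    · left
      have e3 : v + 1 = (2 * q + 2) * a + (r + 1) := by omega
      refine ⟨h, ?_, ?_, ?_, ?_⟩
      · rw [e3, Nat.mul_add_div (by omega), Nat.div_eq_of_lt h, add_zero]
      · rw [e3, Nat.mul_add_mod, Nat.mod_eq_of_lt h]
      · rw [e1, e3, show (2 * q + 2) * a = (q + 1) * (2 * a) by ring, Nat.mul_add_div (by omega)]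
        have : (r + 1) / (q + 1) < 2 := Nat.div_lt_of_lt_mul (by omega)
        generalize (r + 1) / (q + 1) = y at this
        omega
      · rw [e2, e3, show (2 * q + 2) * a = (q + 1) * (2 * a) by ring, Nat.mul_add_mod]
    · right
      have e3 : v + 1 = (2 * q + 2) * (a + 1) := by rw [mul_add]; omega
      refine ⟨by omega, ?_, ?_, ?_, ?_⟩
      · rw [e3, Nat.mul_div_cancel_left _ (by omega)]
      · rw [e3, Nat.mul_mod_right]
      · rw [e1, e3, show (2 * q + 2) * (a + 1) = (q + 1) * (2 * (a + 1)) by ring,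
          Nat.mul_div_cancel_left _ (by omega)]
        omega
      · rw [e2, e3, show (2 * q + 2) * (a + 1) = (q + 1) * (2 * (a + 1)) by ring,
          Nat.mul_mod_right]
  unfold classLevels
  rw [← ha, ← hr]
  rcases hk with ⟨h1, h2, h3, h4, h5⟩ | ⟨h1, h2, h3, h4, h5⟩
  · rw [h2, h3, h4, h5]
    clear h2 h3 h4 h5 hv ha hr hN
    by_cases h6 : r + 1 < q + 1
    · rw [Nat.div_eq_of_lt h6, Nat.mod_eq_of_lt h6, if_pos rfl, if_neg (Nat.succ_ne_zero r)]
      split_ifs <;> omega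
    · have e : r + 1 = (q + 1) * 1 + (r - q) := by omega
      have e1 : (r + 1) / (q + 1) = 1 := by rw [e, level_div (by omega)]
      have e2 : (r + 1) % (q + 1) = r - q := by rw [e, level_mod (by omega)]
      rw [e1, e2, if_neg (by omega : ¬ 1 % 2 = 0)]
      clear e e1 e2
      split_ifs <;> omega
  · rw [h2, h3, h4, h5, if_pos rfl, if_pos rfl]
    clear h2 h3 h4 h5 hv ha hr hN
    split_ifs <;> omega

/-- A class count is a sum over the beads, each counting the levels of the class up to its position. -/
theorem classCount_eq {q i : ℕ} (hi : 1 ≤ i) (hi' : i ≤ q + 1) {G c : ℕ → ℕ} {B : ℕ}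
    (hG : ∀ v, G v = c v + G (v + 1)) (hB : 1 ≤ B) (hGB : G B = 0) :
    classCount q G B i = ∑ s ∈ Finset.Ico 1 B, c s * classLevels q i s := by
  rw [← sum_mul_eq_sum_sub_mul (f := fun v => if levelClass q v = i then 1 else 0)
    (F := classLevels q i) ?_ (classLevels_succ hi hi') hG hB hGB, classCount]
  · refine Finset.sum_congr rfl fun v _ => ?_
    split_ifs <;> simp
  · unfold classLevels
    rw [Nat.zero_div, Nat.zero_mod]
    split_ifs <;> omega

/-! ### Label differences in terms of coloured beads -/

/-- The coloured beads of a configuration: the multiplicity at position `(q + 1) (k + 1)`, with a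
positive sign for white and a negative sign for black beads. -/
noncomputable def signedMult {q : ℕ} {A : Beads} (hA : A.IsConfig (q + 2)) : ℕ →₀ ℤ :=
  Finsupp.ofSupportFinite (fun k => (A.coloured Colour.white ((q + 1) * (k + 1)) : ℤ)
    - A.coloured Colour.black ((q + 1) * (k + 1))) (by
      refine Set.Finite.of_finite_image (f := fun k => (q + 1) * (k + 1))
        (hA.coloured_finite.subset ?_)
        (fun x _ y _ h => Nat.succ_injective (Nat.eq_of_mul_eq_mul_left (Nat.succ_pos q) h))
      rintro _ ⟨k, hk, rfl⟩
      simp only [Function.mem_support] at hk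
      simp only [Set.mem_ofPred_eq, Beads.total]
      omega)

theorem signedMult_apply {q : ℕ} {A : Beads} (hA : A.IsConfig (q + 2)) (k : ℕ) :
    signedMult hA k = (A.coloured Colour.white ((q + 1) * (k + 1)) : ℤ)
      - A.coloured Colour.black ((q + 1) * (k + 1)) := rfl

theorem natAbs_signedMult {q : ℕ} {A : Beads} (hA : A.IsConfig (q + 2)) (k : ℕ) :
    (signedMult hA k).natAbs = A.total ((q + 1) * (k + 1)) := by
  rw [signedMult_apply, Beads.total]
  have := hA.one_colour ((q + 1) * (k + 1))
  omega

/-- There is a bound of the form that the block sums below require. -/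
theorem Beads.IsConfig.exists_bound_mul {q : ℕ} {A : Beads} (hA : A.IsConfig (q + 2)) :
    ∃ K, 1 ≤ K ∧ ∀ v, (q + 1) * (2 * K) ≤ v → A.count v = 0 := by
  obtain ⟨B, hB⟩ := hA.exists_bound
  refine ⟨B + 1, by omega, fun v hv => hB v ?_⟩
  nlinarith

theorem signedMult_lt {q : ℕ} {A : Beads} (hA : A.IsConfig (q + 2)) {K : ℕ}
    (hK : ∀ v, (q + 1) * (2 * K) ≤ v → A.count v = 0) {k : ℕ} (hk : signedMult hA k ≠ 0) :
    k + 1 < 2 * K := by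
  by_contra h
  have h1 := hK ((q + 1) * (k + 1)) (Nat.mul_le_mul_left _ (by omega))
  rw [hA.count_of_dvd (dvd_mul_right _ _), ← natAbs_signedMult hA] at h1
  omega

open Classical in
theorem Beads.shorter_eq_sum {A : Beads} (v : ℕ) :
    A.shorter v = ∑ s ∈ Finset.range v, if s ∈ A.plain then 1 else 0 := by
  rw [← Finset.card_filter, Beads.shorter, ← Set.ncard_coe_finset]
  congr 1
  ext s
  simp only [Set.mem_ofPred_eq, Finset.coe_filter, Finset.mem_range]
  tauto

theorem Beads.shorter_eq_ncard {A : Beads} {B : ℕ} (hB : ∀ v, B ≤ v → A.count v = 0) :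
    A.shorter B = A.plain.ncard := by
  unfold Beads.shorter
  congr 1
  ext s
  simp only [Set.mem_ofPred_eq, and_iff_left_iff_imp]
  intro hs
  by_contra h
  exact (Beads.count_eq_zero (hB s (not_lt.1 h))).1 hs

theorem Beads.above_add_sum {A : Beads} {B : ℕ} (hB : ∀ v, B ≤ v → A.count v = 0) {v : ℕ}
    (hv : v ≤ B) : A.above v + ∑ s ∈ Finset.range v, A.count s = ∑ s ∈ Finset.range B, A.count s := by
  rw [Beads.above_eq_sum hB, add_comm, Finset.sum_range_add_sum_Ico _ hv]

theorem sum_range_mul {M : Type*} [AddCommMonoid M] (f : ℕ → M) (m L : ℕ) :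
    ∑ v ∈ Finset.range (m * L), f v
      = ∑ k ∈ Finset.range L, ∑ j ∈ Finset.range m, f (m * k + j) := by
  induction L with
  | zero => simp
  | succ L ih => rw [mul_add, mul_one, Finset.sum_range_add, ih, Finset.sum_range_succ]

theorem sum_total_range {q : ℕ} {A : Beads} (hA : A.IsConfig (q + 2)) (k : ℕ) :
    ∑ s ∈ Finset.range ((q + 1) * (k + 1)), A.total s
      = ∑ j ∈ Finset.range k, (signedMult hA j).natAbs := by
  have h : ∀ k, ∑ j ∈ Finset.range (q + 1), A.total ((q + 1) * k + j) = A.total ((q + 1) * k) := by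
    intro k
    rw [Finset.sum_range_succ', add_zero, Nat.add_eq_right]
    refine Finset.sum_eq_zero fun j hj => hA.count_of_not_dvd ?_
    rw [Finset.mem_range] at hj
    rw [Nat.dvd_iff_mod_eq_zero, level_mod (by omega)]
    omega
  rw [sum_range_mul]
  simp only [h]
  rw [Finset.sum_range_succ']
  simp only [natAbs_signedMult]
  simp [Beads.total, hA.coloured_zero]

theorem sum_count_eq {A : Beads} (v : ℕ) :
    ∑ s ∈ Finset.range v, A.count s = A.shorter v + ∑ s ∈ Finset.range v, A.total s := by
  classical
  rw [Beads.shorter_eq_sum, ← Finset.sum_add_distrib]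
  refine Finset.sum_congr rfl fun s _ => ?_
  unfold Beads.count
  congr

theorem tailSum_add_sum (g : ℕ →₀ ℤ) {B : ℕ} (hB : ∀ k, g k ≠ 0 → k < B) (k : ℕ) :
    tailSum g k + (g k).natAbs + ∑ j ∈ Finset.range k, (g j).natAbs
      = ∑ j ∈ Finset.range B, (g j).natAbs := by
  have h : ∀ k, tailSum g 0 + (g 0).natAbs
      = tailSum g k + (g k).natAbs + ∑ j ∈ Finset.range k, (g j).natAbs := by
    intro k
    induction k with
    | zero => simp
    | succ k ih => rw [ih, Finset.sum_range_succ, tailSum_succ g k]; ring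
  rw [← h k, h B]
  have h1 : g B = 0 := by
    by_contra h
    exact absurd (hB B h) (lt_irrefl _)
  have h2 : tailSum g B = 0 := by
    refine Finset.sum_eq_zero fun j hj => ?_
    rw [Finset.mem_filter, Finsupp.mem_support_iff] at hj
    have := hB j hj.1
    omega
  rw [h1, h2]
  simp

/-- The number of columns beyond a coloured position, in terms of uncoloured and coloured beads. -/
theorem above_add_shorter {q : ℕ} {A : Beads} (hA : A.IsConfig (q + 2)) (k : ℕ) :
    A.above ((q + 1) * (k + 1) + 1) + A.shorter ((q + 1) * (k + 1))
      = A.plain.ncard + tailSum (signedMult hA) k := by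
  obtain ⟨K₀, hK₀, hB₀⟩ := hA.exists_bound_mul
  obtain ⟨K, hK⟩ : ∃ K, K = K₀ + k + 1 := ⟨_, rfl⟩
  have hB : ∀ v, (q + 1) * (2 * K) ≤ v → A.count v = 0 := fun v hv =>
    hB₀ v (le_trans (Nat.mul_le_mul_left _ (by omega)) hv)
  have h1 := Beads.above_add_sum hB (v := (q + 1) * (k + 1)) (Nat.mul_le_mul_left _ (by omega))
  rw [sum_count_eq, sum_count_eq, Beads.shorter_eq_ncard hB,
    sum_total_range hA, show 2 * K = (2 * K - 1) + 1 by omega, sum_total_range hA,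
    hA.above_succ, hA.count_of_dvd (dvd_mul_right _ _), ← natAbs_signedMult hA] at h1
  have h2 := tailSum_add_sum (signedMult hA) (B := 2 * K - 1)
    (fun j hj => by have := signedMult_lt hA hB hj; omega) k
  omega

/-- The contribution of the row `q k` to the label differences. -/
noncomputable def rowDiff (q : ℕ) (G : ℕ → ℕ) (τ : ℕ → Bool) (k : ℕ) : ℤ :=
  (if τ k = true then 1 else -1)
    * ((G ((q + 1) * k) % 2 : ℕ) - (G ((q + 1) * k + 1) % 2 : ℕ))

/-- Up to a common sign that depends on the number of uncoloured beads only, the contribution of a row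
is the sign that `twist` produces. -/
theorem rowDiff_succ {q : ℕ} {A : Beads} (hA : A.IsConfig (q + 2)) (k : ℕ) :
    rowDiff q A.above (A.upperFirst q) (k + 1)
      = (-1) ^ A.plain.ncard * oddSign (twist (signedMult hA) k) := by
  have h1 := above_add_shorter hA k
  have h2 := hA.above_succ ((q + 1) * (k + 1))
  rw [hA.count_of_dvd (dvd_mul_right _ _)] at h2
  have h3 := hA.one_colour ((q + 1) * (k + 1))
  unfold rowDiff Beads.upperFirst oddSign
  rw [twist_apply, signedMult_apply, h2]
  simp only [decide_eq_true_eq, Nat.odd_iff]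
  rw [Beads.total]
  clear h2
  generalize A.coloured Colour.white ((q + 1) * (k + 1)) = w at *
  generalize A.coloured Colour.black ((q + 1) * (k + 1)) = b at *
  generalize A.above ((q + 1) * (k + 1) + 1) = y at *
  generalize A.shorter ((q + 1) * (k + 1)) = x at *
  generalize tailSum (signedMult hA) k = t at *
  generalize A.plain.ncard = f at *
  simp only [neg_one_pow_eq_ite, Nat.even_iff]
  rcases h3 with rfl | rfl
  · by_cases e1 : b = 0 <;> by_cases e2 : t % 2 = 0 <;> by_cases e3 : f % 2 = 0 <;>
      simp only [e1, e2, e3, if_true, if_false, Nat.cast_zero, zero_sub, neg_neg, mul_one,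
        mul_neg, sub_zero, neg_zero] <;> split_ifs <;> omega
  · by_cases e2 : t % 2 = 0 <;> by_cases e3 : f % 2 = 0 <;>
      simp only [e2, e3, if_true, if_false, Nat.cast_zero, neg_neg, mul_one, mul_neg, sub_zero] <;> split_ifs <;> omega

/-! ### Class counts, label differences and size in terms of beads -/

section

variable {q : ℕ} {G : ℕ → ℕ} {τ : ℕ → Bool}

/-- The full blocks do not contribute to a label difference, and the two half-blocks of a row enter
with opposite signs. -/
theorem sum_row_eq (hq : 2 ≤ q) {i e : ℕ} (hi : (i = 1 ∧ e = 0) ∨ (i = q + 1 ∧ e = 1)) (k : ℕ) :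
    (∑ j ∈ Finset.range (q + 1), if levelClass q ((q + 1) * k + j) = i
      then (if upperAt q τ ((q + 1) * k + j) = true then (1 : ℤ) else -1)
        * ((G ((q + 1) * k + j) % 2 : ℕ) : ℤ) else 0)
      = if k % 2 = e then rowDiff q G τ k else 0 := by
  obtain ⟨p, rfl⟩ : ∃ p, q = p + 1 := ⟨q - 1, by omega⟩
  rw [Finset.sum_range_succ', Finset.sum_range_succ', Finset.sum_eq_zero, zero_add]
  · have h0 : levelClass (p + 1) ((p + 1 + 1) * k) = i ↔ k % 2 = e := by
      rw [← add_zero ((p + 1 + 1) * k), levelClass_eq (by omega)]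
      split_ifs <;> omega
    have h1 : levelClass (p + 1) ((p + 1 + 1) * k + (0 + 1)) = i ↔ k % 2 = e := by
      rw [levelClass_eq (by omega)]
      split_ifs <;> omega
    have e0 : upperAt (p + 1) τ ((p + 1 + 1) * k) = τ k := by
      rw [← add_zero ((p + 1 + 1) * k), upperAt, level_mod (by omega), level_div (by omega), if_pos rfl]
    have e1 : upperAt (p + 1) τ ((p + 1 + 1) * k + (0 + 1)) = !τ k := by
      rw [upperAt, level_mod (by omega), level_div (by omega), if_neg (by omega)]
    simp only [add_zero, h0, h1, e0, e1]
    rw [zero_add, rowDiff]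
    by_cases h : k % 2 = e
    · rw [if_pos h, if_pos h, if_pos h]
      cases τ k <;> simp <;> ring
    · rw [if_neg h, if_neg h, if_neg h, add_zero]
  · intro j hj
    rw [Finset.mem_range] at hj
    refine if_neg ?_
    rw [levelClass_eq (by omega)]
    simp only [Nat.succ_ne_zero, if_false]
    rcases hi with ⟨rfl, rfl⟩ | ⟨rfl, rfl⟩ <;> split_ifs <;> omega

theorem classDiff_one_eq (hq : 2 ≤ q) (hτ : τ 0 = false) (K : ℕ) (hK : 1 ≤ K) :
    classDiff q G τ ((q + 1) * (2 * K)) 1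
      = (G 0 % 2 : ℕ) + ∑ a ∈ Finset.range K, rowDiff q G τ (2 * a) := by
  have h := sum_range_mul (fun v => if levelClass q v = 1
      then (if upperAt q τ v = true then (1 : ℤ) else -1) * ((G v % 2 : ℕ) : ℤ) else 0)
      (q + 1) (2 * K)
  rw [Finset.sum_congr rfl fun k _ => sum_row_eq (G := G) (τ := τ) hq (Or.inl ⟨rfl, rfl⟩) k,
    sum_range_two_mul, Finset.sum_range_eq_add_Ico _ (by positivity)] at h
  have h0 : levelClass q 0 = 1 := by simp [levelClass]
  have h1 : upperAt q τ 0 = false := by simp [upperAt, hτ]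
  rw [h0, if_pos rfl, h1] at h
  simp only [Bool.false_eq_true, if_false, show ∀ a, (2 * a) % 2 = 0 by omega, if_true,
    show ∀ a, ¬ (2 * a + 1) % 2 = 0 by omega, add_zero, neg_mul, one_mul,
    Finset.sum_const_zero] at h
  rw [classDiff, ← h]
  ring

theorem classDiff_last_eq (hq : 2 ≤ q) (K : ℕ) (hK : 1 ≤ K) :
    classDiff q G τ ((q + 1) * (2 * K)) (q + 1)
      = ∑ a ∈ Finset.range K, rowDiff q G τ (2 * a + 1) := by
  have h := sum_range_mul (fun v => if levelClass q v = q + 1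
      then (if upperAt q τ v = true then (1 : ℤ) else -1) * ((G v % 2 : ℕ) : ℤ) else 0)
      (q + 1) (2 * K)
  rw [Finset.sum_congr rfl fun k _ => sum_row_eq (G := G) (τ := τ) hq (Or.inr ⟨rfl, rfl⟩) k,
    sum_range_two_mul, Finset.sum_range_eq_add_Ico _ (by positivity)] at h
  have h0 : ¬ levelClass q 0 = q + 1 := by simp [levelClass]; omega
  rw [if_neg h0] at h
  simp only [show ∀ a, ¬ (2 * a) % 2 = 1 by omega, if_false,
    show ∀ a, (2 * a + 1) % 2 = 1 by omega, if_true, zero_add, Finset.sum_const_zero] at h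
  rw [classDiff, ← h]

end

section

variable {q : ℕ} {A : Beads}

/-- The difference for the labels `n - 1`, `n` is, up to sign, the charge of the
Maya diagram of the odd places: the difference of the two integers of the coloured beads. -/
theorem classDiff_last (hq : 2 ≤ q) (hA : A.IsConfig (q + 2)) {K : ℕ} (hK1 : 1 ≤ K)
    (hK : ∀ v, (q + 1) * (2 * K) ≤ v → A.count v = 0) :
    classDiff q A.above (A.upperFirst q) ((q + 1) * (2 * K)) (q + 1)
      = (-1) ^ A.plain.ncard * ((colouredEquiv (signedMult hA)).1.2
        - (colouredEquiv (signedMult hA)).1.1) := by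
  rw [classDiff_last_eq hq K hK1, (colouredEquiv_charges (g := signedMult hA) (K := K)
    (fun k hk => by have := signedMult_lt hA hK hk; omega)).2, Finset.mul_sum]
  exact Finset.sum_congr rfl fun a _ => rowDiff_succ hA (2 * a)

/-- The difference for the labels `0`, `1` comes from the Maya diagram of the even places and gives
the sum of the two integers of the coloured beads; the grey half-blocks cause the shift by `1`. -/
theorem classDiff_one (hq : 2 ≤ q) (hA : A.IsConfig (q + 2)) {K : ℕ} (hK1 : 1 ≤ K)
    (hK : ∀ v, (q + 1) * (2 * K) ≤ v → A.count v = 0) :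
    classDiff q A.above (A.upperFirst q) ((q + 1) * (2 * K)) 1
      = if A.plain.ncard % 2 = 0
        then -((colouredEquiv (signedMult hA)).1.1 + (colouredEquiv (signedMult hA)).1.2)
        else 1 + ((colouredEquiv (signedMult hA)).1.1 + (colouredEquiv (signedMult hA)).1.2) := by
  obtain ⟨L, rfl⟩ : ∃ L, K = L + 1 := ⟨K - 1, by omega⟩
  have hlast : signedMult hA (2 * L + 1) = 0 := by
    by_contra h
    have := signedMult_lt hA hK h
    omega
  rw [classDiff_one_eq hq hA.isProfile.grey_first _ hK1]
  have hc := (colouredEquiv_charges (g := signedMult hA) (K := L + 1)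
    (fun k hk => by have := signedMult_lt hA hK hk; omega)).1
  have h0 := Beads.above_add_sum hK (v := 0) (Nat.zero_le _)
  rw [Finset.range_zero, Finset.sum_empty, add_zero, sum_count_eq, Beads.shorter_eq_ncard hK,
    show 2 * (L + 1) = 2 * L + 1 + 1 by ring, sum_total_range hA] at h0
  rw [show 2 * (L + 1) = 2 * L + 1 + 1 by ring, Finset.sum_range_succ, hlast,
    Finset.sum_range_succ _ L, twist_apply, hlast] at hc
  rw [Finset.sum_range_succ', Finset.sum_congr rfl fun a _ => show
    rowDiff q A.above (A.upperFirst q) (2 * (a + 1)) = _ from rowDiff_succ hA (2 * a + 1),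
    ← Finset.mul_sum]
  have hr0 : rowDiff q A.above (A.upperFirst q) (2 * 0) = 0 := by
    rw [rowDiff, mul_zero, mul_zero, hA.above_succ 0, hA.count_zero, zero_add]
    ring
  rw [hr0, h0]
  have hs0 : oddSign (-0 * (-1) ^ tailSum (signedMult hA) (2 * L + 1)) = 0 := by simp [oddSign]
  rw [hs0, Int.natAbs_zero] at hc
  simp only [neg_one_pow_eq_ite, Nat.even_iff]
  generalize ∑ x ∈ Finset.range (2 * L + 1), (signedMult hA x).natAbs = P at *
  split_ifs with hf <;> omega

theorem Beads.onRuler_eq_sum (hA : A.IsConfig (q + 2)) {B : ℕ}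
    (hB : ∀ v, B ≤ v → A.count v = 0) {r : ℕ} (hr0 : 0 < r) (hr : r < 2 * q + 2)
    (hr' : r ≠ q + 1) : A.onRuler (q + 2) r
      = ∑ s ∈ Finset.Ico 1 B, A.count s * if s % (2 * q + 2) = r then 1 else 0 := by
  classical
  have h : {s ∈ A.plain | s ≡ r [MOD 2 * (q + 2) - 2]}
      = ↑((Finset.Ico 1 B).filter fun s => s ∈ A.plain ∧ s % (2 * q + 2) = r) := by
    ext s
    rw [show 2 * (q + 2) - 2 = 2 * q + 2 by omega]
    simp only [Set.mem_ofPred_eq, Nat.ModEq, Nat.mod_eq_of_lt hr, Finset.coe_filter,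
      Finset.mem_Ico]
    constructor
    · rintro ⟨h1, h2⟩
      refine ⟨⟨(hA.plain_pos s h1).1, ?_⟩, h1, h2⟩
      by_contra h
      exact (Beads.count_eq_zero (hB s (not_lt.1 h))).1 h1
    · exact fun h => h.2
  rw [Beads.onRuler, h, Set.ncard_coe_finset, Finset.card_filter]
  refine Finset.sum_congr rfl fun s _ => ?_
  by_cases hs : s % (2 * q + 2) = r
  · have : ¬ (q + 1) ∣ s := by
      rintro ⟨k, rfl⟩
      obtain ⟨a, rfl | rfl⟩ : ∃ a, k = 2 * a ∨ k = 2 * a + 1 := ⟨k / 2, by omega⟩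
      · rw [show (q + 1) * (2 * a) = (2 * q + 2) * a by ring, Nat.mul_mod_right] at hs
        omega
      · rw [show (q + 1) * (2 * a + 1) = (2 * q + 2) * a + (q + 1) by ring, Nat.mul_add_mod,
          Nat.mod_eq_of_lt (by omega)] at hs
        omega
    rw [Beads.count, hA.count_of_not_dvd this]
    simp [hs]
  · simp [hs]

/-- The difference of two successive class counts is the difference of the numbers of beads on two
opposite rulers. -/
theorem classCount_sub_classCount (hA : A.IsConfig (q + 2)) {B : ℕ} (hB1 : 1 ≤ B)
    (hB : ∀ v, B ≤ v → A.count v = 0) {i : ℕ} (hi : 1 ≤ i) (hi' : i ≤ q) :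
    classCount q A.above B i + A.onRuler (q + 2) (2 * q + 2 - i)
      = classCount q A.above B (i + 1) + A.onRuler (q + 2) i := by
  have hG : ∀ v, A.above v = A.count v + A.above (v + 1) := hA.above_succ
  have hGB : A.above B = 0 := Beads.above_eq_zero hB le_rfl
  rw [classCount_eq hi (by omega) hG hB1 hGB, classCount_eq (by omega) (by omega) hG hB1 hGB,
    Beads.onRuler_eq_sum hA hB (by omega) (by omega) (by omega),
    Beads.onRuler_eq_sum hA hB (by omega) (by omega) (by omega),
    ← Finset.sum_add_distrib, ← Finset.sum_add_distrib]
  refine Finset.sum_congr rfl fun s _ => ?_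
  rw [← mul_add, ← mul_add, classLevels, classLevels]
  congr 1
  generalize 2 * (s / (2 * q + 2)) = y
  generalize s % (2 * q + 2) = r
  split_ifs <;> omega

/-- The size of a Young wall is the sum of the positions of its beads. -/
theorem size_wallOf (hq : 2 ≤ q) (hA : A.IsConfig (q + 2)) {B : ℕ} (hB1 : 1 ≤ B)
    (hB : ∀ v, B ≤ v → A.count v = 0) :
    (wallOf (by omega) hA).size = ∑ s ∈ Finset.Ico 1 B, A.count s * s := by
  rw [wallOf, hA.isProfile.size_eq hq hA.isProper fun v hv => Beads.above_eq_zero hB hv,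
    ← sum_mul_eq_sum_sub_mul (f := fun _ => 1) (F := fun v => v) rfl (fun _ => rfl)
      hA.above_succ hB1 (Beads.above_eq_zero hB le_rfl)]
  simp

end

/-! ### Coding configurations -/

section

variable {q : ℕ}

/-- The positions of the uncoloured beads, given for each pair of opposite rulers `R_{i+1}`,
`R_{2n-3-i}` by the places of the beads on these rulers. -/
def plainFinset (p : Fin q → Finset ℕ × Finset ℕ) : Finset ℕ :=
  Finset.univ.biUnion fun i : Fin q => (p i).1.image (fun x => (2 * q + 2) * x + (i + 1)) ∪
    (p i).2.image (fun x => (2 * q + 2) * x + (2 * q + 2 - (i + 1)))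

theorem ruler_unique {N a b r s : ℕ} (hr : r < N) (hs : s < N) (h : N * a + r = N * b + s) :
    a = b ∧ r = s := by
  have h1 := congrArg (· % N) h
  simp only [Nat.mul_add_mod, Nat.mod_eq_of_lt hr, Nat.mod_eq_of_lt hs] at h1
  subst h1
  exact ⟨Nat.eq_of_mul_eq_mul_left (by omega) (Nat.add_right_cancel h), rfl⟩

theorem mem_plainFinset_left (p : Fin q → Finset ℕ × Finset ℕ) (i : Fin q) (x : ℕ) :
    (2 * q + 2) * x + (i + 1) ∈ plainFinset p ↔ x ∈ (p i).1 := by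
  simp only [plainFinset, Finset.mem_biUnion, Finset.mem_univ, true_and, Finset.mem_union,
    Finset.mem_image]
  have hi := i.isLt
  constructor
  · rintro ⟨j, ⟨y, hy, h⟩ | ⟨y, hy, h⟩⟩
    · have hj := j.isLt
      obtain ⟨rfl, h2⟩ := ruler_unique (by omega) (by omega) h
      obtain rfl : j = i := Fin.ext (by omega)
      exact hy
    · have hj := j.isLt
      obtain ⟨-, h2⟩ := ruler_unique (by omega) (by omega) h
      omega
  · exact fun h => ⟨i, Or.inl ⟨x, h, rfl⟩⟩

theorem mem_plainFinset_right (p : Fin q → Finset ℕ × Finset ℕ) (i : Fin q) (x : ℕ) :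
    (2 * q + 2) * x + (2 * q + 2 - (i + 1)) ∈ plainFinset p ↔ x ∈ (p i).2 := by
  simp only [plainFinset, Finset.mem_biUnion, Finset.mem_univ, true_and, Finset.mem_union,
    Finset.mem_image]
  have hi := i.isLt
  constructor
  · rintro ⟨j, ⟨y, hy, h⟩ | ⟨y, hy, h⟩⟩
    · have hj := j.isLt
      obtain ⟨-, h2⟩ := ruler_unique (by omega) (by omega) h
      omega
    · have hj := j.isLt
      obtain ⟨rfl, h2⟩ := ruler_unique (by omega) (by omega) h
      obtain rfl : j = i := Fin.ext (by omega)
      exact hy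
  · exact fun h => ⟨i, Or.inr ⟨x, h, rfl⟩⟩

theorem not_dvd_ruler {r : ℕ} (hr0 : 0 < r) (hr : r < 2 * q + 2) (hr' : r ≠ q + 1) (x : ℕ) :
    ¬ (q + 1) ∣ (2 * q + 2) * x + r := by
  rintro ⟨k, h⟩
  obtain ⟨a, rfl | rfl⟩ : ∃ a, k = 2 * a ∨ k = 2 * a + 1 := ⟨k / 2, by omega⟩
  · have := (ruler_unique (a := x) (b := a) (s := 0) hr (by omega) (by rw [h]; ring)).2
    omega
  · have := (ruler_unique (a := x) (b := a) (s := q + 1) hr (by omega) (by rw [h]; ring)).2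
    omega

theorem exists_ruler {s : ℕ} (hs : ¬ (q + 1) ∣ s) : ∃ (i : Fin q) (x : ℕ),
    s = (2 * q + 2) * x + (i + 1) ∨ s = (2 * q + 2) * x + (2 * q + 2 - (i + 1)) := by
  have h := Nat.div_add_mod s (2 * q + 2)
  have hlt := Nat.mod_lt s (show 0 < 2 * q + 2 by omega)
  have h0 : s % (2 * q + 2) ≠ 0 := fun h0 => hs ⟨2 * (s / (2 * q + 2)), by linarith⟩
  have h1 : s % (2 * q + 2) ≠ q + 1 := fun h1 => hs ⟨2 * (s / (2 * q + 2)) + 1, by linarith⟩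
  by_cases h2 : s % (2 * q + 2) < q + 1
  · exact ⟨⟨s % (2 * q + 2) - 1, by omega⟩, s / (2 * q + 2), Or.inl (by dsimp only; omega)⟩
  · exact ⟨⟨2 * q + 2 - s % (2 * q + 2) - 1, by omega⟩, s / (2 * q + 2),
      Or.inr (by dsimp only; omega)⟩

theorem plainFinset_pos (p : Fin q → Finset ℕ × Finset ℕ) {s : ℕ} (hs : s ∈ plainFinset p) :
    0 < s ∧ ¬ (q + 1) ∣ s := by
  simp only [plainFinset, Finset.mem_biUnion, Finset.mem_univ, true_and, Finset.mem_union,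
    Finset.mem_image] at hs
  obtain ⟨i, ⟨x, -, rfl⟩ | ⟨x, -, rfl⟩⟩ := hs
  · have hi := i.isLt
    exact ⟨by omega, not_dvd_ruler (by omega) (by omega) (by omega) x⟩
  · have hi := i.isLt
    exact ⟨by omega, not_dvd_ruler (by omega) (by omega) (by omega) x⟩

theorem sum_plainFinset {M : Type*} [AddCommMonoid M] (p : Fin q → Finset ℕ × Finset ℕ)
    (F : ℕ → M) : ∑ s ∈ plainFinset p, F s = ∑ i, (∑ x ∈ (p i).1, F ((2 * q + 2) * x + (i + 1))
      + ∑ x ∈ (p i).2, F ((2 * q + 2) * x + (2 * q + 2 - (i + 1)))) := by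
  unfold plainFinset
  rw [Finset.sum_biUnion]
  · refine Finset.sum_congr rfl fun i _ => ?_
    have hi := i.isLt
    rw [Finset.sum_union, Finset.sum_image, Finset.sum_image]
    · intro x _ y _ h
      exact (ruler_unique (by omega) (by omega) h).1
    · intro x _ y _ h
      exact (ruler_unique (by omega) (by omega) h).1
    · rw [Finset.disjoint_left]
      intro s hs hs'
      simp only [Finset.mem_image] at hs hs'
      obtain ⟨x, -, rfl⟩ := hs
      obtain ⟨y, -, h⟩ := hs'
      have := (ruler_unique (by omega) (by omega) h).2
      omega
  · intro i _ j _ hij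
    change Disjoint _ _
    rw [Finset.disjoint_left]
    intro s hs hs'
    simp only [Finset.mem_union, Finset.mem_image] at hs hs'
    have hi := i.isLt
    have hj := j.isLt
    apply hij
    apply Fin.ext
    rcases hs with ⟨x, -, rfl⟩ | ⟨x, -, rfl⟩ <;> rcases hs' with ⟨y, -, h⟩ | ⟨y, -, h⟩ <;>
      have := (ruler_unique (by omega) (by omega) h).2 <;> omega

/-- The places of the uncoloured beads on the rulers `R_{i+1}` and `R_{2n-3-i}`. -/
noncomputable def plainData {A : Beads} (hA : A.IsConfig (q + 2)) (i : Fin q) :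
    Finset ℕ × Finset ℕ :=
  ((Set.Finite.preimage (f := fun x => (2 * q + 2) * x + (i + 1))
      (fun x _ y _ h => (ruler_unique (by have := i.isLt; omega) (by have := i.isLt; omega) h).1)
      hA.plain_finite).toFinset,
    (Set.Finite.preimage (f := fun x => (2 * q + 2) * x + (2 * q + 2 - (i + 1)))
      (fun x _ y _ h => (ruler_unique (by omega) (by omega) h).1) hA.plain_finite).toFinset)

theorem mem_plainData_left {A : Beads} (hA : A.IsConfig (q + 2)) (i : Fin q) (x : ℕ) :
    x ∈ (plainData hA i).1 ↔ (2 * q + 2) * x + (i + 1) ∈ A.plain := by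
  simp [plainData]

theorem mem_plainData_right {A : Beads} (hA : A.IsConfig (q + 2)) (i : Fin q) (x : ℕ) :
    x ∈ (plainData hA i).2 ↔ (2 * q + 2) * x + (2 * q + 2 - (i + 1)) ∈ A.plain := by
  simp [plainData]

theorem coe_plainFinset {A : Beads} (hA : A.IsConfig (q + 2)) :
    (plainFinset (plainData hA) : Set ℕ) = A.plain := by
  ext s
  rw [Finset.mem_coe]
  constructor
  · intro hs
    obtain ⟨i, x, rfl | rfl⟩ := exists_ruler (plainFinset_pos _ hs).2
    · rwa [mem_plainFinset_left, mem_plainData_left] at hs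
    · rwa [mem_plainFinset_right, mem_plainData_right] at hs
  · intro hs
    obtain ⟨i, x, rfl | rfl⟩ := exists_ruler (hA.plain_pos s hs).2
    · rwa [mem_plainFinset_left, mem_plainData_left]
    · rwa [mem_plainFinset_right, mem_plainData_right]

/-- The configuration with given places of the uncoloured beads and given signed multiplicities of
the coloured beads. -/
def beadsOf (p : Fin q → Finset ℕ × Finset ℕ) (g : ℕ →₀ ℤ) : Beads where
  plain := plainFinset p
  coloured c s := if 0 < s ∧ (q + 1) ∣ s then
    (match c with
      | Colour.white => (g (s / (q + 1) - 1)).toNat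
      | Colour.black => (-g (s / (q + 1) - 1)).toNat) else 0

theorem beadsOf_coloured (p : Fin q → Finset ℕ × Finset ℕ) (g : ℕ →₀ ℤ) (k : ℕ) :
    (beadsOf p g).coloured Colour.white ((q + 1) * (k + 1)) = (g k).toNat ∧
      (beadsOf p g).coloured Colour.black ((q + 1) * (k + 1)) = (-g k).toNat := by
  have h : (q + 1) * (k + 1) / (q + 1) - 1 = k := by
    rw [Nat.mul_div_cancel_left _ (Nat.succ_pos q), Nat.add_sub_cancel]
  simp only [beadsOf, h]
  rw [if_pos ⟨by positivity, dvd_mul_right _ _⟩, if_pos ⟨by positivity, dvd_mul_right _ _⟩]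
  exact ⟨rfl, rfl⟩

theorem beadsOf_isConfig (p : Fin q → Finset ℕ × Finset ℕ) (g : ℕ →₀ ℤ) :
    (beadsOf p g).IsConfig (q + 2) := by
  have hcol : ∀ s, (beadsOf p g).total s ≠ 0 → 0 < s ∧ (q + 1) ∣ s := by
    intro s hs
    by_contra h
    apply hs
    simp [Beads.total, beadsOf, if_neg h]
  refine ⟨Finset.finite_toSet _, fun s hs => plainFinset_pos p hs, ?_, hcol, ?_⟩
  · refine (g.support.image fun k => (q + 1) * (k + 1)).finite_toSet.subset fun s hs => ?_
    obtain ⟨h0, k, rfl⟩ := hcol s hs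
    obtain ⟨j, rfl⟩ : ∃ j, k = j + 1 := ⟨k - 1, by
      rcases k with _ | k
      · simp at h0
      · omega⟩
    rw [Set.mem_ofPred_eq, Beads.total, (beadsOf_coloured p g j).1, (beadsOf_coloured p g j).2] at hs
    rw [Finset.coe_image]
    refine ⟨j, ?_, rfl⟩
    rw [Finset.mem_coe, Finsupp.mem_support_iff]
    omega
  · intro s
    by_cases h : 0 < s ∧ (q + 1) ∣ s
    · simp only [beadsOf, if_pos h]
      omega
    · simp [beadsOf, if_neg h]

/-- The code of a configuration. -/
noncomputable def configEquiv :
    {A : Beads // A.IsConfig (q + 2)} ≃ (Fin q → Finset ℕ × Finset ℕ) × (ℕ →₀ ℤ) where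
  toFun A := (plainData A.2, signedMult A.2)
  invFun d := ⟨beadsOf d.1 d.2, beadsOf_isConfig d.1 d.2⟩
  left_inv := by
    rintro ⟨A, hA⟩
    apply Subtype.ext
    apply Beads.ext
    · exact coe_plainFinset hA
    · funext c s
      by_cases h : 0 < s ∧ (q + 1) ∣ s
      · obtain ⟨h0, k, rfl⟩ := h
        obtain ⟨j, rfl⟩ : ∃ j, k = j + 1 := ⟨k - 1, by
          rcases k with _ | k
          · simp at h0
          · omega⟩
        have h1 := beadsOf_coloured (plainData hA) (signedMult hA) j
        rw [signedMult_apply] at h1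
        have h2 := hA.one_colour ((q + 1) * (j + 1))
        cases c
        · exact h1.1.trans (by dsimp only; omega)
        · exact h1.2.trans (by dsimp only; omega)
      · have h1 : A.total s = 0 := by
          by_contra h1
          exact h (hA.coloured_pos s h1)
        rw [Beads.total] at h1
        simp only [beadsOf, if_neg h]
        cases c <;> omega
  right_inv := by
    rintro ⟨p, g⟩
    refine Prod.ext (funext fun i => Prod.ext ?_ ?_) ?_
    · ext x
      rw [mem_plainData_left]
      exact mem_plainFinset_left p i x
    · ext x
      rw [mem_plainData_right]
      exact mem_plainFinset_right p i x
    · ext k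
      rw [signedMult_apply, (beadsOf_coloured p g k).1, (beadsOf_coloured p g k).2]
      dsimp only
      omega

end

/-! ### The classification of Young walls by charges and partitions -/

section

variable {q : ℕ}

/-- A Young wall is determined by its abacus. -/
noncomputable def wallEquiv (hq : 0 < q) :
    YoungWall (q + 2) ≃ {A : Beads // A.IsConfig (q + 2)} where
  toFun Y := ⟨Y.abacus, abacus_isConfig hq Y⟩
  invFun A := wallOf hq A.2
  left_inv := wallOf_abacus hq
  right_inv A := Subtype.ext (abacus_wallOf hq A.2)

/-- Gathering the charges of the rulers, and the partitions. -/
def gatherEquiv (P : Type) : (Fin q → ℤ × P) × ((ℤ × ℤ) × (P × P) × P) ≃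
    (Fin (q + 2) → ℤ) × (Fin (q + 3) → P) where
  toFun d := (Fin.append (fun i => (d.1 i).1) ![d.2.1.1, d.2.1.2],
    Fin.append (fun i => (d.1 i).2) ![d.2.2.1.1, d.2.2.1.2, d.2.2.2])
  invFun e := (fun i => (e.1 (Fin.castAdd 2 i), e.2 (Fin.castAdd 3 i)),
    ((e.1 (Fin.natAdd q 0), e.1 (Fin.natAdd q 1)),
      (e.2 (Fin.natAdd q 0), e.2 (Fin.natAdd q 1)), e.2 (Fin.natAdd q 2)))
  left_inv := by
    rintro ⟨d, ⟨z1, z2⟩, ⟨a, b⟩, c⟩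
    simp only [Fin.append_left, Fin.append_right]
    rfl
  right_inv := by
    rintro ⟨z, l⟩
    refine Prod.ext (funext fun i => ?_) (funext fun i => ?_)
    · refine Fin.addCases (fun i => ?_) (fun i => ?_) i
      · simp only [Fin.append_left]
      · simp only [Fin.append_right]
        fin_cases i <;> rfl
    · refine Fin.addCases (fun i => ?_) (fun i => ?_) i
      · simp only [Fin.append_left]
      · simp only [Fin.append_right]
        fin_cases i <;> rfl

/-- Young walls are classified by the charges and the partitions of their abaci. -/
noncomputable def wallCode (hq : 0 < q) : YoungWall (q + 2) ≃
    (Fin (q + 2) → ℤ) × (Fin (q + 3) → OrdPartition) :=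
  (wallEquiv hq).trans (configEquiv.trans (((Equiv.piCongrRight fun _ => mayaEquiv).prodCongr
    colouredEquiv).trans (gatherEquiv OrdPartition)))

theorem wallCode_eq (hq : 0 < q) (Y : YoungWall (q + 2)) : wallCode hq Y
    = gatherEquiv OrdPartition (fun i => mayaEquiv (plainData (abacus_isConfig hq Y) i),
      colouredEquiv (signedMult (abacus_isConfig hq Y))) := rfl

section

variable (hq : 0 < q) (Y : YoungWall (q + 2))

theorem wallCode_charge_plain (i : Fin q) : (wallCode hq Y).1 (Fin.castAdd 2 i)
    = mayaCharge (plainData (abacus_isConfig hq Y) i) := by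
  rw [← mayaEquiv_fst, wallCode_eq]
  exact Fin.append_left (fun i => (mayaEquiv (plainData (abacus_isConfig hq Y) i)).1) _ i

theorem wallCode_charge_coloured :
    (wallCode hq Y).1 (Fin.natAdd q 0)
      = (colouredEquiv (signedMult (abacus_isConfig hq Y))).1.1 ∧
    (wallCode hq Y).1 (Fin.natAdd q 1)
      = (colouredEquiv (signedMult (abacus_isConfig hq Y))).1.2 := by
  rw [wallCode_eq]
  generalize colouredEquiv (signedMult (abacus_isConfig hq Y)) = d
  have h := Fin.append_right (fun i => (mayaEquiv (plainData (abacus_isConfig hq Y) i)).1)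
    ![d.1.1, d.1.2]
  exact ⟨h 0, h 1⟩

theorem wallCode_partition_plain (i : Fin q) : (wallCode hq Y).2 (Fin.castAdd 3 i)
    = (mayaEquiv (plainData (abacus_isConfig hq Y) i)).2 := by
  rw [wallCode_eq]
  exact Fin.append_left (fun i => (mayaEquiv (plainData (abacus_isConfig hq Y) i)).2) _ i

theorem wallCode_partition_coloured :
    (wallCode hq Y).2 (Fin.natAdd q 0)
      = (colouredEquiv (signedMult (abacus_isConfig hq Y))).2.1.1 ∧
    (wallCode hq Y).2 (Fin.natAdd q 1)
      = (colouredEquiv (signedMult (abacus_isConfig hq Y))).2.1.2 ∧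
    (wallCode hq Y).2 (Fin.natAdd q 2)
      = (colouredEquiv (signedMult (abacus_isConfig hq Y))).2.2 := by
  rw [wallCode_eq]
  generalize colouredEquiv (signedMult (abacus_isConfig hq Y)) = d
  have h := Fin.append_right (fun i => (mayaEquiv (plainData (abacus_isConfig hq Y) i)).2)
    ![d.2.1.1, d.2.1.2, d.2.2]
  exact ⟨h 0, h 1, h 2⟩

/-- The total weight of the partitions of a Young wall. -/
noncomputable def wallWeight : ℕ := ∑ i, ((wallCode hq Y).2 i).weight

theorem wallWeight_eq : wallWeight hq Y
    = ∑ i, (mayaEquiv (plainData (abacus_isConfig hq Y) i)).2.weight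
      + ((colouredEquiv (signedMult (abacus_isConfig hq Y))).2.1.1.weight
      + (colouredEquiv (signedMult (abacus_isConfig hq Y))).2.1.2.weight
      + (colouredEquiv (signedMult (abacus_isConfig hq Y))).2.2.weight) := by
  obtain ⟨h1, h2, h3⟩ := wallCode_partition_coloured hq Y
  rw [wallWeight, Fin.sum_univ_add, Fin.sum_univ_three, h1, h2, h3]
  simp only [wallCode_partition_plain]

end

theorem onRuler_left {A : Beads} (hA : A.IsConfig (q + 2)) (i : Fin q) :
    A.onRuler (q + 2) (i + 1) = (plainData hA i).1.card := by
  have hi := i.isLt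
  rw [Beads.onRuler, ← Set.ncard_coe_finset,
    ← Set.ncard_image_of_injective (f := fun x => (2 * q + 2) * x + (i + 1))
      ((plainData hA i).1 : Set ℕ)
      (fun x y h => (ruler_unique (by omega) (by omega) h).1)]
  congr 1
  ext s
  rw [show 2 * (q + 2) - 2 = 2 * q + 2 by omega]
  simp only [Set.mem_ofPred_eq, Set.mem_image, Finset.mem_coe, mem_plainData_left, Nat.ModEq]
  rw [Nat.mod_eq_of_lt (show (i : ℕ) + 1 < 2 * q + 2 by omega)]
  constructor
  · rintro ⟨h1, h2⟩
    have h := Nat.div_add_mod s (2 * q + 2)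
    rw [h2] at h
    exact ⟨s / (2 * q + 2), by rwa [h], h⟩
  · rintro ⟨x, h1, rfl⟩
    exact ⟨h1, by rw [Nat.mul_add_mod, Nat.mod_eq_of_lt (by omega)]⟩

theorem onRuler_right {A : Beads} (hA : A.IsConfig (q + 2)) (i : Fin q) :
    A.onRuler (q + 2) (2 * q + 2 - (i + 1)) = (plainData hA i).2.card := by
  have hi := i.isLt
  rw [Beads.onRuler, ← Set.ncard_coe_finset,
    ← Set.ncard_image_of_injective (f := fun x => (2 * q + 2) * x + (2 * q + 2 - (i + 1)))
      ((plainData hA i).2 : Set ℕ)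
      (fun x y h => (ruler_unique (by omega) (by omega) h).1)]
  congr 1
  ext s
  rw [show 2 * (q + 2) - 2 = 2 * q + 2 by omega]
  simp only [Set.mem_ofPred_eq, Set.mem_image, Finset.mem_coe, mem_plainData_right, Nat.ModEq]
  rw [Nat.mod_eq_of_lt (show 2 * q + 2 - ((i : ℕ) + 1) < 2 * q + 2 by omega)]
  constructor
  · rintro ⟨h1, h2⟩
    have h := Nat.div_add_mod s (2 * q + 2)
    rw [h2] at h
    exact ⟨s / (2 * q + 2), by rwa [h], h⟩
  · rintro ⟨x, h1, rfl⟩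
    exact ⟨h1, by rw [Nat.mul_add_mod, Nat.mod_eq_of_lt (by omega)]⟩

theorem mayaCharge_plainData {A : Beads} (hA : A.IsConfig (q + 2)) (i : Fin q) :
    mayaCharge (plainData hA i) = (A.onRuler (q + 2) (i + 1) : ℤ)
      - A.onRuler (q + 2) (2 * q + 2 - (i + 1)) := by
  rw [onRuler_left hA, onRuler_right hA, mayaCharge]

/-- The parity of the number of uncoloured beads is that of the sum of the charges. -/
theorem ncard_plain_mod_two {A : Beads} (hA : A.IsConfig (q + 2)) :
    (A.plain.ncard : ℤ) % 2 = (∑ i, mayaCharge (plainData hA i)) % 2 := by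
  have h : A.plain.ncard = ∑ i, ((plainData hA i).1.card + (plainData hA i).2.card) := by
    rw [← coe_plainFinset hA, Set.ncard_coe_finset, Finset.card_eq_sum_ones, sum_plainFinset]
    simp
  rw [h, ← Int.ModEq, Int.modEq_iff_dvd]
  push_cast
  rw [← Finset.sum_sub_distrib]
  refine Finset.dvd_sum fun i _ => ⟨-(plainData hA i).2.card, ?_⟩
  rw [mayaCharge]
  ring

theorem sum_count_mul {A : Beads} (hA : A.IsConfig (q + 2)) {K : ℕ} (hK1 : 1 ≤ K)
    (hK : ∀ v, (q + 1) * (2 * K) ≤ v → A.count v = 0) :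
    ∑ s ∈ Finset.Ico 1 ((q + 1) * (2 * K)), A.count s * s
      = ∑ s ∈ plainFinset (plainData hA), s
        + (q + 1) * ∑ k ∈ Finset.range (2 * K), (k + 1) * (signedMult hA k).natAbs := by
  classical
  have h := Finset.sum_range_eq_add_Ico (fun s => A.count s * s)
    (n := (q + 1) * (2 * K)) (by positivity)
  rw [mul_zero, zero_add] at h
  rw [← h]
  have hpl : ∑ s ∈ Finset.range ((q + 1) * (2 * K)), (if s ∈ A.plain then 1 else 0) * s
      = ∑ s ∈ plainFinset (plainData hA), s := by
    simp only [ite_mul, one_mul, zero_mul]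
    rw [← Finset.sum_filter]
    refine Finset.sum_congr ?_ fun _ _ => rfl
    ext s
    rw [Finset.mem_filter, Finset.mem_range, ← coe_plainFinset hA, Finset.mem_coe]
    refine and_iff_right_of_imp fun hs => ?_
    by_contra hlt
    refine (Beads.count_eq_zero (hK s (not_lt.1 hlt))).1 ?_
    rw [← coe_plainFinset hA]
    exact hs
  have hco : ∑ s ∈ Finset.range ((q + 1) * (2 * K)), A.total s * s
      = (q + 1) * ∑ k ∈ Finset.range (2 * K), (k + 1) * (signedMult hA k).natAbs := by
    rw [sum_range_mul]
    have hrow : ∀ k, ∑ j ∈ Finset.range (q + 1), A.total ((q + 1) * k + j) * ((q + 1) * k + j)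
        = A.total ((q + 1) * k) * ((q + 1) * k) := by
      intro k
      rw [Finset.sum_range_succ', add_zero, Nat.add_eq_right]
      refine Finset.sum_eq_zero fun j hj => ?_
      rw [hA.count_of_not_dvd, zero_mul]
      rw [Finset.mem_range] at hj
      rw [Nat.dvd_iff_mod_eq_zero, level_mod (by omega)]
      omega
    simp only [hrow]
    have hlast : A.total ((q + 1) * (2 * K)) = 0 := by
      have h := hK _ le_rfl
      rwa [hA.count_of_dvd (dvd_mul_right _ _)] at h
    have e := Finset.sum_range_succ (fun k => A.total ((q + 1) * k) * ((q + 1) * k)) (2 * K)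
    rw [hlast, zero_mul, add_zero] at e
    rw [← e, Finset.sum_range_succ', mul_zero, mul_zero, add_zero, Finset.mul_sum]
    refine Finset.sum_congr rfl fun k _ => ?_
    rw [natAbs_signedMult]
    ring
  rw [← hpl, ← hco, ← Finset.sum_add_distrib]
  refine Finset.sum_congr rfl fun s _ => ?_
  rw [← add_mul]
  unfold Beads.count
  congr

theorem sum_plainData {A : Beads} (hA : A.IsConfig (q + 2)) :
    ((∑ s ∈ plainFinset (plainData hA), s : ℕ) : ℤ)
      = ∑ i : Fin q, ((q + 1) * mayaCharge (plainData hA i) ^ 2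
          - (q - i) * mayaCharge (plainData hA i))
        + (2 * q + 2) * ∑ i, ((mayaEquiv (plainData hA i)).2.weight : ℤ) := by
  rw [sum_plainFinset, Finset.mul_sum, ← Finset.sum_add_distrib, Nat.cast_sum]
  refine Finset.sum_congr rfl fun i _ => ?_
  have hi := i.isLt
  have h := two_mul_mayaEnergy (plainData hA i)
  have e1 : ∀ x : ℕ, (((2 * q + 2) * x + (i + 1) : ℕ) : ℤ) = (2 * q + 2) * x + (i + 1) :=
    fun x => by push_cast; ring
  have e2 : ∀ x : ℕ, (((2 * q + 2) * x + (2 * q + 2 - (i + 1)) : ℕ) : ℤ)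
      = (2 * q + 2) * (x + 1) - (i + 1) := fun x => by
    rw [Nat.cast_add, Nat.cast_sub (by omega)]
    push_cast
    ring
  rw [Nat.cast_add, Nat.cast_sum, Nat.cast_sum, Finset.sum_congr rfl fun x _ => e1 x,
    Finset.sum_congr rfl fun x _ => e2 x, Finset.sum_add_distrib, Finset.sum_sub_distrib,
    ← Finset.mul_sum, ← Finset.mul_sum, Finset.sum_const, Finset.sum_const, nsmul_eq_mul,
    nsmul_eq_mul]
  rw [mayaEnergy] at h
  push_cast at h
  have hc : mayaCharge (plainData hA i) = ((plainData hA i).1.card : ℤ) - (plainData hA i).2.card :=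
    rfl
  generalize mayaCharge (plainData hA i) = c at *
  linear_combination (q + 1 : ℤ) * h - (i + 1 : ℤ) * hc

/-- The size of a Young wall in terms of its charges and partitions. -/
theorem size_eq (hq : 2 ≤ q) (Y : YoungWall (q + 2)) : (Y.size : ℤ)
    = (∑ i : Fin (q + 2), if i.val < q
        then ((q : ℤ) + 1) * (wallCode (by omega) Y).1 i ^ 2
          - (q - (i.val : ℤ)) * (wallCode (by omega) Y).1 i
        else (q + 1) * (2 * (wallCode (by omega) Y).1 i ^ 2 + (wallCode (by omega) Y).1 i))
      + (2 * q + 2) * wallWeight (by omega) Y := by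
  have hq0 : 0 < q := by omega
  obtain ⟨K, hK1, hK⟩ := (abacus_isConfig hq0 Y).exists_bound_mul
  have h := size_wallOf hq (abacus_isConfig hq0 Y) (B := (q + 1) * (2 * K))
    (Nat.mul_pos (by omega) (by omega)) hK
  rw [wallOf_abacus, sum_count_mul (abacus_isConfig hq0 Y) hK1 hK] at h
  have h1 := sum_plainData (abacus_isConfig hq0 Y)
  have h2 := colouredEquiv_energy (g := signedMult (abacus_isConfig hq0 Y)) (K := K)
    (fun k hk => by have := signedMult_lt (abacus_isConfig hq0 Y) hK hk; omega)
  have h3 := wallWeight_eq hq0 Y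
  obtain ⟨c1, c2⟩ := wallCode_charge_coloured hq0 Y
  rw [Fin.sum_univ_add, Fin.sum_univ_two, c1, c2]
  simp only [Fin.val_castAdd, Fin.val_natAdd, Fin.is_lt, if_true, wallCode_charge_plain]
  rw [if_neg (by omega), if_neg (by omega), h3, h]
  push_cast at h1 h2 ⊢
  rw [h1, h2]
  ring

end

/-! ### Bar removals preserve the charges and lower the weight -/

section

variable {q : ℕ}

/-- Every level belongs to one class. -/
theorem sum_classCount (G : ℕ → ℕ) (B : ℕ) :
    ∑ i ∈ Finset.Ico 1 (q + 2), classCount q G B i = ∑ v ∈ Finset.Ico 1 B, G v := by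
  unfold classCount
  rw [Finset.sum_comm]
  refine Finset.sum_congr rfl fun v _ => ?_
  have h := levelClass_bounds (q := q) v
  rw [Finset.sum_ite_eq, if_pos (Finset.mem_Ico.2 ⟨h.1, by omega⟩)]

theorem exists_common_bound {A A' : Beads} (hA : A.IsConfig (q + 2)) (hA' : A'.IsConfig (q + 2)) :
    ∃ K, 1 ≤ K ∧ (∀ v, (q + 1) * (2 * K) ≤ v → A.count v = 0) ∧
      ∀ v, (q + 1) * (2 * K) ≤ v → A'.count v = 0 := by
  obtain ⟨K, hK1, hK⟩ := hA.exists_bound_mul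
  obtain ⟨K', -, hK'⟩ := hA'.exists_bound_mul
  refine ⟨K + K', by omega, fun v hv => hK v (le_trans ?_ hv), fun v hv => hK' v (le_trans ?_ hv)⟩
  · exact Nat.mul_le_mul_left _ (by omega)
  · exact Nat.mul_le_mul_left _ (by omega)

/-- A bar removal in terms of the abaci of the two walls. -/
theorem barRemoval_iff (hq : 2 ≤ q) {Y Y' : YoungWall (q + 2)} {A A' : Beads}
    (hA : A.IsConfig (q + 2)) (hA' : A'.IsConfig (q + 2)) (hY : Y.abacus = A)
    (hY' : Y'.abacus = A') {K : ℕ} (hK : ∀ v, (q + 1) * (2 * K) ≤ v → A.count v = 0)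
    (hK' : ∀ v, (q + 1) * (2 * K) ≤ v → A'.count v = 0) : BarRemoval Y Y' ↔
    profileWall q A'.above (A'.upperFirst q) ⊆ profileWall q A.above (A.upperFirst q) ∧
    BlocksConnected (profileWall q A.above (A.upperFirst q)
      \ profileWall q A'.above (A'.upperFirst q)) ∧
    (∀ i, 1 ≤ i → i ≤ q + 1 → classCount q A.above ((q + 1) * (2 * K)) i
      = classCount q A'.above ((q + 1) * (2 * K)) i + 2) ∧
    classDiff q A.above (A.upperFirst q) ((q + 1) * (2 * K)) 1
      = classDiff q A'.above (A'.upperFirst q) ((q + 1) * (2 * K)) 1 ∧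
    classDiff q A.above (A.upperFirst q) ((q + 1) * (2 * K)) (q + 1)
      = classDiff q A'.above (A'.upperFirst q) ((q + 1) * (2 * K)) (q + 1) := by
  obtain rfl : Y = wallOf (by omega) hA :=
    abacus_injective (q := q) (by omega) (hY.trans (abacus_wallOf (by omega) hA).symm)
  obtain rfl : Y' = wallOf (by omega) hA' :=
    abacus_injective (q := q) (by omega) (hY'.trans (abacus_wallOf (by omega) hA').symm)
  rw [← labelCount_eq_add_iff hq hA.isProfile hA'.isProfile
    (fun v hv => Beads.above_eq_zero hK hv) (fun v hv => Beads.above_eq_zero hK' hv)]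
  unfold BarRemoval wallOf
  refine and_congr_right fun h => ?_
  exact isBar_sdiff_iff (hA.isProfile.isYoungWall (by omega) hA.isProper)
    (hA'.isProfile.isYoungWall (by omega) hA'.isProper) h

/-- A bar removal preserves the charges and lowers the total weight of the partitions by `1`. -/
theorem wallCode_of_barRemoval (hq : 2 ≤ q) {Y Y' : YoungWall (q + 2)} (h : BarRemoval Y Y') :
    (wallCode (by omega) Y).1 = (wallCode (by omega) Y').1 ∧
      wallWeight (by omega) Y = wallWeight (by omega) Y' + 1 := by
  have hq0 : 0 < q := by omega
  have hA := abacus_isConfig hq0 Y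
  have hA' := abacus_isConfig hq0 Y'
  obtain ⟨K, hK1, hK, hK'⟩ := exists_common_bound hA hA'
  have hB1 : 1 ≤ (q + 1) * (2 * K) := Nat.mul_pos (by omega) (by omega)
  obtain ⟨-, -, hcount, hdiff1, hdiff2⟩ := (barRemoval_iff hq hA hA' rfl rfl hK hK').1 h
  have hplain : ∀ i, mayaCharge (plainData hA i) = mayaCharge (plainData hA' i) := by
    intro i
    have hi := i.isLt
    have e := classCount_sub_classCount hA hB1 hK (i := i + 1) (by omega) (by omega)
    have e' := classCount_sub_classCount hA' hB1 hK' (i := i + 1) (by omega) (by omega)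
    have c1 := hcount (i + 1) (by omega) (by omega)
    have c2 := hcount (i + 1 + 1) (by omega) (by omega)
    rw [mayaCharge_plainData, mayaCharge_plainData]
    omega
  have hf : (Y.abacus.plain.ncard : ℤ) % 2 = (Y'.abacus.plain.ncard : ℤ) % 2 := by
    rw [ncard_plain_mod_two hA, ncard_plain_mod_two hA', Finset.sum_congr rfl fun i _ => hplain i]
  rw [classDiff_one hq hA hK1 hK, classDiff_one hq hA' hK1 hK'] at hdiff1
  rw [classDiff_last hq hA hK1 hK, classDiff_last hq hA' hK1 hK'] at hdiff2
  simp only [neg_one_pow_eq_ite, Nat.even_iff] at hdiff2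
  have hz : (wallCode (by omega) Y).1 = (wallCode (by omega) Y').1 := by
    obtain ⟨c1, c2⟩ := wallCode_charge_coloured hq0 Y
    obtain ⟨c1', c2'⟩ := wallCode_charge_coloured hq0 Y'
    have key : (colouredEquiv (signedMult hA)).1.1 = (colouredEquiv (signedMult hA')).1.1 ∧
        (colouredEquiv (signedMult hA)).1.2 = (colouredEquiv (signedMult hA')).1.2 := by
      by_cases e : Y.abacus.plain.ncard % 2 = 0
      · have e' : Y'.abacus.plain.ncard % 2 = 0 := by omega
        rw [if_pos e, if_pos e'] at hdiff1 hdiff2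
        omega
      · have e' : ¬ Y'.abacus.plain.ncard % 2 = 0 := by omega
        rw [if_neg e, if_neg e'] at hdiff1 hdiff2
        omega
    funext i
    refine Fin.addCases (fun i => ?_) (fun i => ?_) i
    · rw [wallCode_charge_plain, wallCode_charge_plain]
      exact hplain i
    · fin_cases i
      · exact c1.trans (key.1.trans c1'.symm)
      · exact c2.trans (key.2.trans c2'.symm)
  refine ⟨hz, ?_⟩
  have hsize : Y.size = Y'.size + 2 * (q + 1) := by
    conv_lhs => rw [← wallOf_abacus hq0 Y]
    conv_rhs => rw [← wallOf_abacus hq0 Y']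
    rw [wallOf, wallOf, hA.isProfile.size_eq hq hA.isProper fun v hv => Beads.above_eq_zero hK hv,
      hA'.isProfile.size_eq hq hA'.isProper fun v hv => Beads.above_eq_zero hK' hv,
      ← sum_classCount (q := q) Y.abacus.above, ← sum_classCount (q := q) Y'.abacus.above,
      Finset.sum_congr rfl
        fun i hi => hcount i (Finset.mem_Ico.1 hi).1 (by have := (Finset.mem_Ico.1 hi).2; omega),
      Finset.sum_add_distrib, Finset.sum_const, Nat.card_Ico]
    simp only [smul_eq_mul]
    omega
  have s := size_eq hq Y
  have s' := size_eq hq Y'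
  rw [hz] at s
  rw [hsize] at s
  push_cast at s
  have : (2 * (q : ℤ) + 2) * (wallWeight hq0 Y - (wallWeight hq0 Y' + 1)) = 0 := by linarith
  rcases mul_eq_zero.1 this with h | h <;> omega

end

/-! ### Strips are connected -/

theorem level_cases (q : ℕ) (τ τ' : ℕ → Bool) (b : Block) : level q τ b = level q τ' b ∨
    ∃ k, τ k ≠ τ' k ∧ ((level q τ b = (q + 1) * k ∧ level q τ' b = (q + 1) * k + 1) ∨
      (level q τ b = (q + 1) * k + 1 ∧ level q τ' b = (q + 1) * k)) := by
  unfold level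
  by_cases h : b.piece = Piece.full
  · left
    rw [if_pos h, if_pos h]
  rw [if_neg h, if_neg h]
  by_cases hτ : τ (b.row / q) = τ' (b.row / q)
  · left
    rw [hτ]
  · right
    refine ⟨b.row / q, hτ, ?_⟩
    have hne : half (τ (b.row / q)) ≠ half (τ' (b.row / q)) := fun h => hτ (half_injective h)
    have hnot : half (!τ (b.row / q)) = half (τ' (b.row / q)) := by
      congr 1
      revert hτ
      cases τ (b.row / q) <;> cases τ' (b.row / q) <;> simp
    rcases eq_half_of_ne_full h (τ (b.row / q)) with h1 | h1
    · left
      rw [if_pos h1, if_neg (by rw [h1]; exact hne)]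
      exact ⟨rfl, rfl⟩
    · right
      rw [hnot] at h1
      rw [if_neg (by rw [h1]; exact hne.symm), if_pos h1]
      exact ⟨rfl, rfl⟩

/-- The situation in which the wall with profile `(G', τ')` arises from that with profile `(G, τ)`
by removing a strip that has one or two blocks in each of the levels `lo + 1, …, hi`. -/
structure IsStrip (q : ℕ) (G G' : ℕ → ℕ) (τ τ' : ℕ → Bool) (lo hi : ℕ) : Prop where
  lt : lo < hi
  outside : ∀ v, 1 ≤ v → v ≤ lo ∨ hi < v → G' v = G v
  inside : ∀ v, lo < v → v ≤ hi → G' v < G v ∧ G v ≤ G' v + 2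
  step : ∀ v, lo < v → v + 1 ≤ hi → G v ≤ G (v + 1) + 1
  half_outside : ∀ k, 1 ≤ k → (q + 1) * k ≤ lo ∨ hi < (q + 1) * k →
    τ k = τ' k ∨ G ((q + 1) * k) = G ((q + 1) * k + 1)
  half_last : ∀ k, (q + 1) * k = hi → τ k = τ' k ∨ G' hi = G' (hi + 1)
  half_inside : ∀ k, lo < (q + 1) * k → (q + 1) * k < hi →
    G ((q + 1) * k + 1) = G' ((q + 1) * k + 1) + 1

section

variable {q : ℕ} {G G' : ℕ → ℕ} {τ τ' : ℕ → Bool} {lo hi : ℕ}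

theorem IsStrip.subset (hS : IsStrip q G G' τ τ' lo hi) (hq : 0 < q) (hP : IsProfile q G τ)
    (hP' : IsProfile q G' τ') : profileWall q G' τ' ⊆ profileWall q G τ := by
  have hlt := hS.lt
  refine profileWall_subset hq hP hP' (fun v hv => ?_) fun k hk => ?_
  · by_cases h : lo < v ∧ v ≤ hi
    · exact (hS.inside v h.1 h.2).1.le
    · exact (hS.outside v hv (by omega)).le
  · have hpos : 1 ≤ (q + 1) * k := Nat.mul_pos (Nat.succ_pos q) hk
    by_cases h1 : (q + 1) * k ≤ lo ∨ hi < (q + 1) * k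
    · exact (hS.half_outside k hk h1).imp id fun h => by rw [hS.outside _ hpos h1, h]
    · rcases Nat.lt_or_ge ((q + 1) * k) hi with h2 | h2
      · right
        have h3 := hS.inside ((q + 1) * k) (by omega) (by omega)
        have h4 := hS.step ((q + 1) * k) (by omega) (by omega)
        omega
      · have h3 : (q + 1) * k = hi := by omega
        refine (hS.half_last k h3).imp id fun h => ?_
        rw [h3, h, hS.outside _ (by omega) (Or.inr (Nat.lt_succ_self hi))]

/-- In each level of the strip, the last block of the larger wall at that height is removed, up to
an exchange of half-blocks. -/
theorem IsStrip.exists_removed (hS : IsStrip q G G' τ τ' lo hi) (hq : 0 < q)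
    (hP : IsProfile q G τ) (hP' : IsProfile q G' τ') {u : ℕ} (h1 : lo < u) (h2 : u ≤ hi) :
    ∃ b ∈ profileWall q G τ \ profileWall q G' τ', b.row = rowOf q u ∧ b.col + 1 = G u := by
  have hin := hS.inside u h1 h2
  by_cases hd : (q + 1) ∣ u
  · refine ⟨blockAt q τ (G u - 1) u, ⟨?_, fun h => ?_⟩, rfl, ?_⟩
    · exact (blockAt_mem_profileWall hq).2 (Or.inr (by omega))
    · have hlev := level_cases q τ τ' (blockAt q τ (G u - 1) u)
      rw [level_blockAt hq] at hlev
      rcases hlev with h3 | ⟨k, -, ⟨h3, h4⟩ | ⟨h3, -⟩⟩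
      · rcases h.2 with h5 | h5 <;> rw [← h3] at h5
        · omega
        · change G u - 1 < G' u at h5
          omega
      · rcases h.2 with h5 | h5
        · omega
        · rw [h4, ← h3] at h5
          change G u - 1 < G' (u + 1) at h5
          have := hP'.antitone (Nat.le_succ u)
          rw [Nat.succ_eq_add_one] at this
          omega
      · rw [h3, Nat.dvd_add_right (dvd_mul_right _ _), Nat.dvd_one] at hd
        omega
    · change G u - 1 + 1 = G u
      omega
  · refine ⟨blockAt q τ' (G u - 1) u, ⟨?_, fun h => ?_⟩, rfl, ?_⟩
    · refine ⟨blockAt_inPattern _ _ _, Or.inr ?_⟩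
      change G u - 1 < G _
      have hlev := level_cases q τ τ' (blockAt q τ' (G u - 1) u)
      rw [level_blockAt hq] at hlev
      rcases hlev with h3 | ⟨k, -, ⟨h3, h4⟩ | ⟨-, h4⟩⟩
      · rw [h3]
        omega
      · have := hP.antitone (show level q τ (blockAt q τ' (G u - 1) u) ≤ u by omega)
        omega
      · exact absurd ⟨k, h4⟩ hd
    · rcases (blockAt_mem_profileWall hq).1 h with h5 | h5 <;> omega
    · change G u - 1 + 1 = G u
      omega

/-- The removed blocks of a row lie in the level `u` of the strip, or in the two levels `u - 1`, `u`
of a row of half-blocks; in both cases they occupy at most two neighbouring columns. -/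
theorem IsStrip.level_of_removed (hS : IsStrip q G G' τ τ' lo hi) (hq : 0 < q)
    (hP : IsProfile q G τ) (hP' : IsProfile q G' τ') {b : Block}
    (hb : b ∈ profileWall q G τ \ profileWall q G' τ') :
    ∃ u, lo < u ∧ u ≤ hi ∧ (u = hi ∨ ¬ (q + 1) ∣ u) ∧ b.row = rowOf q u ∧
      (((q + 1) ∣ u - 1 ∧ lo < u - 1 ∧ G u ≤ b.col + 1 ∧ b.col ≤ G u) ∨
        (¬ ((q + 1) ∣ u - 1 ∧ lo < u - 1) ∧ b.col < G u ∧ G u ≤ b.col + 2)) := by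
  obtain ⟨⟨hpat, hv⟩, hb'⟩ := hb
  have hlt := hS.lt
  have hv' : level q τ' b ≠ 0 ∧ G' (level q τ' b) ≤ b.col := by
    refine ⟨fun h => hb' ⟨hpat, Or.inl h⟩, not_lt.1 fun h => hb' ⟨hpat, Or.inr h⟩⟩
  have hv0 : level q τ b ≠ 0 := fun h => hv'.1
    ((level_eq_zero_iff_isGrey hq hP'.grey_first hpat).2
      ((level_eq_zero_iff_isGrey hq hP.grey_first hpat).1 h))
  replace hv := hv.resolve_left hv0
  have hrow := rowOf_level hq τ hpat
  have hrow' := rowOf_level hq τ' hpat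
  have hdvd : ∀ k, ¬ (q + 1) ∣ (q + 1) * k + 1 := fun k h => by
    rw [Nat.dvd_add_right (dvd_mul_right _ _), Nat.dvd_one] at h
    omega
  rcases level_cases q τ τ' b with h | ⟨k, hτ, ⟨h1, h2⟩ | ⟨h1, h2⟩⟩
  · -- the level of the block is the same in both walls
    rw [← h] at hv'
    obtain ⟨v, hvdef⟩ : ∃ v, v = level q τ b := ⟨_, rfl⟩
    rw [← hvdef] at hv hv' hv0 hrow
    have hrange : lo < v ∧ v ≤ hi := by
      by_contra hc
      have := hS.outside v (by omega) (by omega)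
      omega
    have hin := hS.inside v hrange.1 hrange.2
    by_cases hd : (q + 1) ∣ v ∧ v < hi
    · obtain ⟨⟨k, hk⟩, hvhi⟩ := hd
      have e1 := hS.half_inside k (by omega) (by omega)
      have e2 := hS.step v (by omega) (by omega)
      have e3 := hP'.antitone (Nat.le_succ v)
      rw [Nat.succ_eq_add_one] at e3
      rw [← hk] at e1
      refine ⟨v + 1, by omega, by omega, Or.inr (by rw [hk]; exact hdvd k), ?_, Or.inl ?_⟩
      · rw [rowOf_succ hq, if_pos ⟨k, hk⟩, ← hrow, add_zero]
      · exact ⟨⟨k, by omega⟩, by omega, by omega, by omega⟩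
    · refine ⟨v, hrange.1, hrange.2, ?_, hrow.symm, ?_⟩
      · by_cases hvhi : v = hi
        · exact Or.inl hvhi
        · exact Or.inr fun hd' => hd ⟨hd', by omega⟩
      · by_cases hd2 : (q + 1) ∣ v - 1 ∧ lo < v - 1
        · obtain ⟨⟨k, hk⟩, hlo⟩ := hd2
          have e1 := hS.half_inside k (by omega) (by omega)
          rw [← hk, Nat.sub_add_cancel (by omega)] at e1
          exact Or.inl ⟨⟨k, hk⟩, hlo, by omega, by omega⟩
        · exact Or.inr ⟨hd2, by omega, by omega⟩
  · -- the first half-block of its row in the larger wall, the second one in the smaller wall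
    rw [h1] at hv hv0 hrow
    rw [h2] at hv' hrow'
    have hk1 : 1 ≤ k := Nat.pos_of_ne_zero fun h => hv0 (by rw [h, mul_zero])
    obtain ⟨w, hw⟩ : ∃ w, w = (q + 1) * k := ⟨_, rfl⟩
    have hd := hdvd k
    have hout := hS.half_outside k hk1
    have hlast := hS.half_last k
    have hins := hS.half_inside k
    rw [← hw] at hv hv' hv0 hrow hrow' hd hout hlast hins
    have e3 := hP'.antitone (Nat.le_succ w)
    rw [Nat.succ_eq_add_one] at e3
    rcases lt_trichotomy w lo with hc | hc | hc
    · have e1 := (hout (by omega)).resolve_left hτ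
      have e2 := hS.outside (w + 1) (by omega) (by omega)
      omega
    · have e1 := (hout (by omega)).resolve_left hτ
      have e2 := hS.inside (w + 1) (by omega) (by omega)
      exact ⟨w + 1, by omega, by omega, Or.inr hd, hrow'.symm,
        Or.inr ⟨by rintro ⟨-, h⟩; omega, by omega, by omega⟩⟩
    · rcases lt_trichotomy w hi with hc' | hc' | hc'
      · have e1 := hins hc hc'
        have e2 := hS.step w hc hc'
        exact ⟨w + 1, by omega, by omega, Or.inr hd, hrow'.symm,
          Or.inl ⟨⟨k, by omega⟩, by omega, by omega, by omega⟩⟩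
      · have e1 := (hlast hc').resolve_left hτ
        have e2 := hS.inside w (by omega) (by omega)
        rw [← hc'] at e1
        refine ⟨w, by omega, by omega, Or.inl hc', hrow.symm, Or.inr ⟨?_, by omega, by omega⟩⟩
        rintro ⟨⟨j, hj⟩, -⟩
        exact hdvd j ⟨k, by omega⟩
      · have e1 := (hout (by omega)).resolve_left hτ
        have e2 := hS.outside (w + 1) (by omega) (by omega)
        omega
  · -- the second half-block of its row in the larger wall, the first one in the smaller wall
    rw [h1] at hv hv0 hrow
    rw [h2] at hv' hrow'
    have hk1 : 1 ≤ k := Nat.pos_of_ne_zero fun h => hv'.1 (by rw [h, mul_zero])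
    obtain ⟨w, hw⟩ : ∃ w, w = (q + 1) * k := ⟨_, rfl⟩
    have hd := hdvd k
    have hout := hS.half_outside k hk1
    have hlast := hS.half_last k
    have hins := hS.half_inside k
    rw [← hw] at hv hv' hv0 hrow hrow' hd hout hlast hins
    have e3 := hP'.antitone (Nat.le_succ w)
    rw [Nat.succ_eq_add_one] at e3
    by_cases hc : w ≤ lo ∨ hi < w
    · have e1 := (hout hc).resolve_left hτ
      have e2 := hS.outside w (by omega) hc
      omega
    · by_cases hc' : w = hi
      · have e1 := (hlast hc').resolve_left hτ
        have e2 := hS.outside (w + 1) (by omega) (by omega)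
        rw [← hc'] at e1
        omega
      · have e1 := hins (by omega) (by omega)
        exact ⟨w + 1, by omega, by omega, Or.inr hd, hrow.symm,
          Or.inl ⟨⟨k, by omega⟩, by omega, by omega, by omega⟩⟩

theorem Block.Touch.symm {b c : Block} (h : b.Touch c) : c.Touch b :=
  ⟨h.2.1, h.1, h.2.2.2, h.2.2.1⟩

theorem IsStrip.touch_of_row_eq (hS : IsStrip q G G' τ τ' lo hi) (hq : 0 < q)
    (hP : IsProfile q G τ) (hP' : IsProfile q G' τ') {b c : Block}
    (hb : b ∈ profileWall q G τ \ profileWall q G' τ')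
    (hc : c ∈ profileWall q G τ \ profileWall q G' τ') (h : b.row = c.row) : b.Touch c := by
  obtain ⟨u, -, h2, h3, h4, h5⟩ := hS.level_of_removed hq hP hP' hb
  obtain ⟨u', -, h2', h3', h4', h5'⟩ := hS.level_of_removed hq hP hP' hc
  obtain rfl : u = u' := by
    rcases lt_trichotomy u u' with hlt | heq | hlt
    · have := rowOf_lt hq hlt (h3.resolve_left (by omega))
      omega
    · exact heq
    · have := rowOf_lt hq hlt (h3'.resolve_left (by omega))
      omega
  have hcol : b.col ≤ c.col + 1 ∧ c.col ≤ b.col + 1 := by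
    rcases h5 with ⟨a1, a2, a3, a4⟩ | ⟨a1, a2, a3⟩
    · rcases h5' with ⟨-, -, b3, b4⟩ | ⟨b1, -, -⟩
      · omega
      · exact absurd ⟨a1, a2⟩ b1
    · rcases h5' with ⟨b1, b2, -, -⟩ | ⟨-, b3, b4⟩
      · exact absurd ⟨b1, b2⟩ a1
      · omega
  exact ⟨hcol.1, hcol.2, by omega, by omega⟩

theorem IsStrip.connected (hS : IsStrip q G G' τ τ' lo hi) (hq : 0 < q) (hP : IsProfile q G τ)
    (hP' : IsProfile q G' τ') : BlocksConnected (profileWall q G τ \ profileWall q G' τ') := by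
  have hlt := hS.lt
  have : Nonempty Block := ⟨⟨0, 0, Piece.full⟩⟩
  choose! c hc hrow hcol using fun u (hu : lo < u ∧ u ≤ hi) =>
    hS.exists_removed hq hP hP' hu.1 hu.2
  set D := profileWall q G τ \ profileWall q G' τ'
  set R : Block → Block → Prop := fun u v => v ∈ D ∧ u.Touch v
  have hnext : ∀ u, lo < u → u + 1 ≤ hi → (c u).Touch (c (u + 1)) := by
    intro u h1 h2
    have e1 := hS.step u h1 h2
    have e2 := hP.antitone (Nat.le_succ u)
    rw [Nat.succ_eq_add_one] at e2
    have e3 := hcol u ⟨h1, by omega⟩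
    have e4 := hcol (u + 1) ⟨by omega, h2⟩
    have e5 := hrow u ⟨h1, by omega⟩
    have e6 := hrow (u + 1) ⟨by omega, h2⟩
    have e7 := rowOf_succ hq u
    refine ⟨by omega, by omega, ?_, ?_⟩ <;> split_ifs at e7 <;> omega
  have hchain : ∀ d, lo + 1 + d ≤ hi → Relation.ReflTransGen R (c (lo + 1)) (c (lo + 1 + d)) ∧
      Relation.ReflTransGen R (c (lo + 1 + d)) (c (lo + 1)) := by
    intro d
    induction d with
    | zero => exact fun _ => ⟨Relation.ReflTransGen.refl, Relation.ReflTransGen.refl⟩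
    | succ d ih =>
      intro hd
      obtain ⟨h1, h2⟩ := ih (by omega)
      have ht := hnext (lo + 1 + d) (by omega) (by omega)
      exact ⟨h1.tail ⟨hc _ ⟨by omega, by omega⟩, ht⟩,
        h2.head ⟨hc _ ⟨by omega, by omega⟩, ht.symm⟩⟩
  have hbase : ∀ b ∈ D, Relation.ReflTransGen R b (c (lo + 1)) ∧
      Relation.ReflTransGen R (c (lo + 1)) b := by
    intro b hb
    obtain ⟨u, h1, h2, -, h4, -⟩ := hS.level_of_removed hq hP hP' hb
    obtain ⟨d, rfl⟩ : ∃ d, u = lo + 1 + d := ⟨u - (lo + 1), by omega⟩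
    have hu : lo < lo + 1 + d ∧ lo + 1 + d ≤ hi := ⟨h1, h2⟩
    have ht := hS.touch_of_row_eq hq hP hP' hb (hc _ hu) (h4.trans (hrow _ hu).symm)
    obtain ⟨h5, h6⟩ := hchain d h2
    exact ⟨h6.head ⟨hc _ hu, ht⟩, h5.tail ⟨hb, ht.symm⟩⟩
  exact fun b hb b' hb' => (hbase b hb).1.trans (hbase b' hb').2

end

/-! ### Local changes of the coloured beads that preserve the charges -/

/-- The contribution to the charges of `x` beads (black for negative `x`) with `p` coloured beads
beyond them. -/
def rowSign (x : ℤ) (p : ℕ) : ℤ := oddSign (-x * (-1) ^ p)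

theorem rowSign_eq (x : ℤ) (p : ℕ) : rowSign x p =
    if x % 2 = 0 then 0 else if (0 < x ↔ p % 2 = 0) then -1 else 1 := by
  unfold rowSign oddSign
  rw [neg_one_pow_eq_ite]
  simp only [Nat.even_iff]
  by_cases hp : p % 2 = 0
  · simp only [hp, if_true, iff_true]
    split_ifs <;> omega
  · simp only [hp, if_false, iff_false]
    split_ifs <;> omega

/-- For white beads the contribution is a difference of two parities, so that the contributions of
successive rows telescope. -/
theorem rowSign_of_nonneg {x : ℤ} (hx : 0 ≤ x) (p : ℕ) :
    rowSign x p = (p % 2 : ℕ) - ((x.natAbs + p) % 2 : ℕ) := by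
  rw [rowSign_eq]
  split_ifs <;> omega

/-- See `rowSign_of_nonneg`. -/
theorem rowSign_of_nonpos {x : ℤ} (hx : x ≤ 0) (p : ℕ) :
    rowSign x p = ((x.natAbs + p) % 2 : ℕ) - (p % 2 : ℕ) := by
  rw [rowSign_eq]
  split_ifs <;> omega

theorem rowSign_congr {x : ℤ} {p p' : ℕ} (h : p % 2 = p' % 2) : rowSign x p = rowSign x p' := by
  rw [rowSign_eq, rowSign_eq, h]

/-- The sums of two functions that differ in two successive values only agree if they agree on
these. -/
theorem sum_range_eq_of_pair {f f' : ℕ → ℤ} {x K : ℕ} (hK : x + 1 < K)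
    (h : ∀ k, k ≠ x → k ≠ x + 1 → f' k = f k) (hx : f' x + f' (x + 1) = f x + f (x + 1)) :
    ∑ k ∈ Finset.range K, f' k = ∑ k ∈ Finset.range K, f k := by
  have e : ∀ F : ℕ → ℤ, ∑ k ∈ Finset.range K, F k
      = ∑ k ∈ Finset.range x, F k + (F x + F (x + 1)) + ∑ k ∈ Finset.Ico (x + 2) K, F k := by
    intro F
    rw [← Finset.sum_range_add_sum_Ico F (show x + 2 ≤ K by omega), Finset.sum_range_succ,
      Finset.sum_range_succ]
    ring
  have h1 : ∑ k ∈ Finset.range x, f' k = ∑ k ∈ Finset.range x, f k :=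
    Finset.sum_congr rfl fun k hk => by
      rw [Finset.mem_range] at hk
      exact h k (by omega) (by omega)
  have h2 : ∑ k ∈ Finset.Ico (x + 2) K, f' k = ∑ k ∈ Finset.Ico (x + 2) K, f k :=
    Finset.sum_congr rfl fun k hk => by
      rw [Finset.mem_Ico] at hk
      exact h k (by omega) (by omega)
  rw [e, e, hx, h1, h2]

/-- A local change at three successive rows preserves the charges under conditions that involve
these rows only.  The functions `u`, `u'` extend `g`, `g'` by a value for the position `0`. -/
theorem colouredEquiv_charges_congr {g g' : ℕ →₀ ℤ} {u u' : ℕ → ℤ} {a : ℕ}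
    (hu : ∀ k, u (k + 1) = g k) (hu' : ∀ k, u' (k + 1) = g' k)
    (hout : ∀ k, k ≠ a → k ≠ a + 1 → k ≠ a + 2 → u' k = u k)
    (hpar : ((u' a).natAbs + (u' (a + 1)).natAbs + (u' (a + 2)).natAbs) % 2
      = ((u a).natAbs + (u (a + 1)).natAbs + (u (a + 2)).natAbs) % 2)
    (hmid : ∀ p, rowSign (u' (a + 1)) ((u' (a + 2)).natAbs + p)
      = rowSign (u (a + 1)) ((u (a + 2)).natAbs + p))
    (hends : ∀ p, rowSign (u' a) ((u' (a + 1)).natAbs + ((u' (a + 2)).natAbs + p))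
        + rowSign (u' (a + 2)) p
      = rowSign (u a) ((u (a + 1)).natAbs + ((u (a + 2)).natAbs + p)) + rowSign (u (a + 2)) p)
    (hzero : a = 0 → ∀ p : ℕ,
      ((((u' 1).natAbs + ((u' 2).natAbs + p)) % 2 : ℕ) : ℤ)
        - rowSign (u' 0) ((u' 1).natAbs + ((u' 2).natAbs + p))
      = ((((u 1).natAbs + ((u 2).natAbs + p)) % 2 : ℕ) : ℤ)
        - rowSign (u 0) ((u 1).natAbs + ((u 2).natAbs + p))) :
    (colouredEquiv g).1 = (colouredEquiv g').1 := by
  -- the number of coloured beads beyond a row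
  obtain ⟨T, hT0, hT⟩ : ∃ T : ℕ → ℕ, (T 0 = (g 0).natAbs + tailSum g 0) ∧
      ∀ k, T (k + 1) = tailSum g k :=
    ⟨fun k => Nat.casesOn k ((g 0).natAbs + tailSum g 0) (tailSum g), rfl, fun _ => rfl⟩
  obtain ⟨T', hT0', hT'⟩ : ∃ T : ℕ → ℕ, (T 0 = (g' 0).natAbs + tailSum g' 0) ∧
      ∀ k, T (k + 1) = tailSum g' k :=
    ⟨fun k => Nat.casesOn k ((g' 0).natAbs + tailSum g' 0) (tailSum g'), rfl, fun _ => rfl⟩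
  have hrec : ∀ k, T k = (u (k + 1)).natAbs + T (k + 1) := by
    intro k
    rcases k with _ | k
    · rw [hT0, hT, hu]
    · rw [hT, hT, hu, tailSum_succ]
  have hrec' : ∀ k, T' k = (u' (k + 1)).natAbs + T' (k + 1) := by
    intro k
    rcases k with _ | k
    · rw [hT0', hT', hu']
    · rw [hT', hT', hu', tailSum_succ]
  obtain ⟨K, hKa, hK, hK'⟩ : ∃ K, a + 2 ≤ K ∧ (∀ k, g k ≠ 0 → k < 2 * K) ∧
      ∀ k, g' k ≠ 0 → k < 2 * K := by
    refine ⟨g.support.sup id + g'.support.sup id + a + 2, by omega, fun k hk => ?_, fun k hk => ?_⟩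
    · have := Finset.le_sup (f := id) (Finsupp.mem_support_iff.2 hk)
      simp only [id] at this
      omega
    · have := Finset.le_sup (f := id) (Finsupp.mem_support_iff.2 hk)
      simp only [id] at this
      omega
  have htotal : T 0 = ∑ k ∈ Finset.range (2 * K), (g k).natAbs := by
    have := tailSum_add_sum g hK 0
    rw [Finset.range_zero, Finset.sum_empty] at this
    omega
  have htotal' : T' 0 = ∑ k ∈ Finset.range (2 * K), (g' k).natAbs := by
    have := tailSum_add_sum g' hK' 0
    rw [Finset.range_zero, Finset.sum_empty] at this
    omega
  have htail : ∀ k, a + 2 ≤ k → T' k = T k := by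
    intro k hk
    obtain ⟨j, rfl⟩ : ∃ j, k = j + 1 := ⟨k - 1, by omega⟩
    rw [hT, hT']
    unfold tailSum
    have hgg : ∀ i, j < i → g' i = g i := fun i hi => by
      rw [← hu, ← hu']
      exact hout _ (by omega) (by omega) (by omega)
    have hs : g'.support.filter (j < ·) = g.support.filter (j < ·) := by
      ext i
      simp only [Finset.mem_filter, Finsupp.mem_support_iff]
      exact and_congr_left fun hi => by rw [hgg i hi]
    rw [hs]
    refine Finset.sum_congr rfl fun i hi => ?_
    rw [hgg i (Finset.mem_filter.1 hi).2]
  have e2 := htail (a + 2) le_rfl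
  have r0 := hrec a
  have r1 := hrec (a + 1)
  have r0' := hrec' a
  have r1' := hrec' (a + 1)
  rw [show a + 1 + 1 = a + 2 by ring] at r1 r1'
  have hbelow : ∀ d k, k + d + 1 = a → T' k % 2 = T k % 2 := by
    intro d
    induction d with
    | zero =>
      intro k hk
      have s := hrec k
      have s' := hrec' k
      rw [show k + 1 = a by omega] at s s'
      omega
    | succ d ih =>
      intro k hk
      have s := hrec k
      have s' := hrec' k
      have := ih (k + 1) (by omega)
      rw [hout (k + 1) (by omega) (by omega) (by omega)] at s'
      omega
  -- the contributions of the rows; those of the even and of the odd rows are summed separately, so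
  -- the rows `a` and `a + 2` may compensate each other
  obtain ⟨C, hC⟩ : ∃ C : ℕ → ℤ, ∀ k, C k = rowSign (u k) (T k) := ⟨_, fun _ => rfl⟩
  obtain ⟨C', hC'⟩ : ∃ C : ℕ → ℤ, ∀ k, C k = rowSign (u' k) (T' k) := ⟨_, fun _ => rfl⟩
  have hCout : ∀ k, k ≠ a → k ≠ a + 2 → C' k = C k := by
    intro k h1 h2
    rw [hC, hC']
    by_cases h3 : k = a + 1
    · subst h3
      rw [r1, r1', e2]
      exact hmid _
    · rw [hout k h1 h3 h2]
      apply rowSign_congr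
      by_cases h4 : k < a
      · exact hbelow (a - k - 1) k (by omega)
      · rw [htail k (by omega)]
  have hCends : C' a + C' (a + 2) = C a + C (a + 2) := by
    rw [hC, hC', hC, hC', r0', r0, r1, r1', e2]
    exact hends _
  have hCzero : ((T' 0 % 2 : ℕ) : ℤ) - C' 0 = ((T 0 % 2 : ℕ) : ℤ) - C 0 := by
    by_cases ha : a = 0
    · subst ha
      rw [hC, hC', r0', r0, r1, r1', e2]
      exact hzero rfl _
    · rw [hCout 0 (Ne.symm ha) (by omega), hbelow (a - 1) 0 (by omega)]
  have hsum : ∀ e, e ≤ 1 → ∑ b ∈ Finset.range (K + 1), C' (2 * b + e)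
      = ∑ b ∈ Finset.range (K + 1), C (2 * b + e) := by
    intro e he
    by_cases hae : a % 2 = e
    · refine sum_range_eq_of_pair (x := a / 2) (by omega)
        (fun k h1 h2 => hCout _ (by omega) (by omega)) ?_
      rw [show 2 * (a / 2) + e = a by omega, show 2 * (a / 2 + 1) + e = a + 2 by omega]
      exact hCends
    · exact Finset.sum_congr rfl fun k _ => hCout _ (by omega) (by omega)
  have htw : ∀ k, oddSign (twist g k) = C (k + 1) := fun k => by
    rw [hC, twist_apply, rowSign, hu, hT]
  have htw' : ∀ k, oddSign (twist g' k) = C' (k + 1) := fun k => by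
    rw [hC', twist_apply, rowSign, hu', hT']
  obtain ⟨c1, c2⟩ := colouredEquiv_charges hK
  obtain ⟨c1', c2'⟩ := colouredEquiv_charges hK'
  rw [← htotal] at c1
  rw [← htotal'] at c1'
  rw [Finset.sum_congr rfl fun b _ => htw (2 * b + 1)] at c1
  rw [Finset.sum_congr rfl fun b _ => htw' (2 * b + 1)] at c1'
  rw [Finset.sum_congr rfl fun b _ => htw (2 * b)] at c2
  rw [Finset.sum_congr rfl fun b _ => htw' (2 * b)] at c2'
  have s0 := hsum 0 (by omega)
  have s1 := hsum 1 le_rfl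
  rw [Finset.sum_range_succ', Finset.sum_range_succ'] at s0
  rw [Finset.sum_range_succ, Finset.sum_range_succ, hC, hC',
    show u (2 * K + 1) = 0 by
      rw [hu]; by_contra h; exact absurd (hK _ h) (lt_irrefl _),
    show u' (2 * K + 1) = 0 by
      rw [hu']; by_contra h; exact absurd (hK' _ h) (lt_irrefl _)] at s1
  simp only [rowSign_eq, Int.zero_emod, if_true, add_zero] at s1
  simp only [mul_zero, add_zero, show ∀ b, 2 * (b + 1) = 2 * b + 1 + 1 by intro b; ring] at s0
  rw [s1] at c2'
  have h1 : (colouredEquiv g).1.1 + (colouredEquiv g).1.2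
      = (colouredEquiv g').1.1 + (colouredEquiv g').1.2 := by linarith
  have h2 : (colouredEquiv g).1.2 - (colouredEquiv g).1.1
      = (colouredEquiv g').1.2 - (colouredEquiv g').1.1 := by linarith
  exact Prod.ext (by linarith) (by linarith)

/-- The charges are not changed by a `jump`. -/
theorem colouredEquiv_charges_jump {g g' : ℕ →₀ ℤ} {u u' : ℕ → ℤ} {a : ℕ} {ε : ℤ}
    (hu : ∀ k, u (k + 1) = g k) (hu' : ∀ k, u' (k + 1) = g' k) (hu0 : u 0 = 1)
    (hout : ∀ k, k ≠ a → k ≠ a + 2 → u' k = u k) (hmid : u (a + 1) = 0)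
    (hhi : u' (a + 2) = u (a + 2) - ε) (hlo : u' a = u a + ε)
    (hsign : (ε = 1 ∧ 1 ≤ u (a + 2) ∧ 0 ≤ u a) ∨ (ε = -1 ∧ u (a + 2) ≤ -1 ∧ u a ≤ 0)) :
    (colouredEquiv g).1 = (colouredEquiv g').1 := by
  have hmid' : u' (a + 1) = 0 := by rw [hout _ (by omega) (by omega), hmid]
  refine colouredEquiv_charges_congr (a := a) hu hu' (fun k h1 _ h3 => hout k h1 h3) ?_ ?_ ?_ ?_
  · omega
  · intro p
    rw [hmid, hmid', rowSign_eq, rowSign_eq]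
    simp
  · intro p
    rw [hmid, hmid', hhi, hlo]
    rcases hsign with ⟨rfl, h1, h2⟩ | ⟨rfl, h1, h2⟩
    · rw [rowSign_of_nonneg (by omega), rowSign_of_nonneg (by omega), rowSign_of_nonneg (by omega),
        rowSign_of_nonneg (by omega)]
      omega
    · rw [rowSign_of_nonpos (by omega), rowSign_of_nonpos (by omega), rowSign_of_nonpos (by omega),
        rowSign_of_nonpos (by omega)]
      omega
  · rintro rfl p
    rw [zero_add] at *
    rw [hmid, hmid', hhi, hlo, hu0, rowSign_of_nonneg (by omega), rowSign_of_nonneg (by omega)]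
    omega

/-- The charges are not changed by a `swap`. -/
theorem colouredEquiv_charges_swap {g g' : ℕ →₀ ℤ} {u u' : ℕ → ℤ} {a : ℕ} {ε : ℤ}
    (hu : ∀ k, u (k + 1) = g k) (hu' : ∀ k, u' (k + 1) = g' k) (hu0 : u 0 = 1)
    (hout : ∀ k, k ≠ a → k ≠ a + 1 → k ≠ a + 2 → u' k = u k)
    (hmid : u (a + 1) = 1 ∨ u (a + 1) = -1) (hmid' : u' (a + 1) = -u (a + 1))
    (hhi : u' (a + 2) = u (a + 2) - ε) (hlo : u' a = u a - ε)
    (hsign : (ε = 1 ∧ 1 ≤ u (a + 2) ∧ u a ≤ 0) ∨ (ε = -1 ∧ u (a + 2) ≤ -1 ∧ 0 ≤ u a)) :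
    (colouredEquiv g).1 = (colouredEquiv g').1 := by
  refine colouredEquiv_charges_congr (a := a) hu hu' hout ?_ ?_ ?_ ?_
  · omega
  · intro p
    rcases hmid with h | h
    · rw [rowSign_of_nonpos (by omega), rowSign_of_nonneg (by omega)]
      omega
    · rw [rowSign_of_nonneg (by omega), rowSign_of_nonpos (by omega)]
      omega
  · intro p
    rw [hhi, hlo]
    rcases hsign with ⟨rfl, h1, h2⟩ | ⟨rfl, h1, h2⟩
    · rw [rowSign_of_nonpos (by omega), rowSign_of_nonneg (by omega), rowSign_of_nonpos (by omega),
        rowSign_of_nonneg (by omega)]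
      omega
    · rw [rowSign_of_nonneg (by omega), rowSign_of_nonpos (by omega), rowSign_of_nonneg (by omega),
        rowSign_of_nonpos (by omega)]
      omega
  · rintro rfl p
    rw [zero_add] at *
    rw [hlo, hu0, rowSign_of_nonneg (by omega), rowSign_of_nonneg (by omega)]
    omega

/-- The charges are not changed by a `pair`. -/
theorem colouredEquiv_charges_pair {g g' : ℕ →₀ ℤ} {u u' : ℕ → ℤ} {a : ℕ} {ε η : ℤ}
    (hu : ∀ k, u (k + 1) = g k) (hu' : ∀ k, u' (k + 1) = g' k) (hu0 : u 0 = 1)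
    (hout : ∀ k, k ≠ a → k ≠ a + 1 → u' k = u k)
    (hhi : u' (a + 1) = u (a + 1) - 2 * ε) (hlo : u' a = u a + 2 * η)
    (hsign : (ε = 1 ∧ 2 ≤ u (a + 1)) ∨ (ε = -1 ∧ u (a + 1) ≤ -2))
    (hsign' : (η = 1 ∧ 0 ≤ u a) ∨ (η = -1 ∧ u a ≤ 0)) :
    (colouredEquiv g).1 = (colouredEquiv g').1 := by
  have h2 : u' (a + 2) = u (a + 2) := hout _ (by omega) (by omega)
  refine colouredEquiv_charges_congr (a := a) hu hu' (fun k h1 h2 _ => hout k h1 h2) ?_ ?_ ?_ ?_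
  · omega
  · intro p
    rw [h2]
    rcases hsign with ⟨rfl, h1⟩ | ⟨rfl, h1⟩
    · rw [rowSign_of_nonneg (by omega), rowSign_of_nonneg (by omega)]
      omega
    · rw [rowSign_of_nonpos (by omega), rowSign_of_nonpos (by omega)]
      omega
  · intro p
    rw [h2]
    rcases hsign' with ⟨rfl, h1⟩ | ⟨rfl, h1⟩
    · rw [rowSign_of_nonneg (show 0 ≤ u' a by omega), rowSign_of_nonneg h1]
      omega
    · rw [rowSign_of_nonpos (show u' a ≤ 0 by omega), rowSign_of_nonpos h1]
      omega
  · rintro rfl p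
    rw [zero_add] at *
    rw [h2, hlo, hu0, rowSign_of_nonneg (by omega), rowSign_of_nonneg (by omega)]
    omega

/-! ### Moves of uncoloured beads remove bars -/

section

variable {q : ℕ} {A A' : Beads}

theorem Beads.count_of_mem {v : ℕ} (h : v ∈ A.plain) : A.count v = 1 + A.total v := by
  rw [Beads.count, if_pos h]

theorem Beads.count_of_not_mem {v : ℕ} (h : v ∉ A.plain) : A.count v = A.total v := by
  rw [Beads.count, if_neg h, zero_add]

theorem Beads.count_congr {v : ℕ} (h : v ∈ A'.plain ↔ v ∈ A.plain) (ht : A'.total v = A.total v) :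
    A'.count v = A.count v := by
  by_cases hv : v ∈ A.plain
  · rw [Beads.count_of_mem hv, Beads.count_of_mem (h.2 hv), ht]
  · rw [Beads.count_of_not_mem hv, Beads.count_of_not_mem (mt h.1 hv), ht]

/-- The numbers of beads beyond a position, for two configurations, from the numbers of beads at
each position. -/
theorem above_eq_add {n : ℕ} (hA : A.IsConfig n) (hA' : A'.IsConfig n) {D : ℕ → ℕ} {hi : ℕ}
    (hD0 : ∀ v, hi < v → D v = 0)
    (hD : ∀ v, 1 ≤ v → A.count v + D (v + 1) = A'.count v + D v) :
    ∀ v, 1 ≤ v → A.above v = A'.above v + D v := by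
  obtain ⟨B, hB⟩ := hA.exists_bound
  obtain ⟨B', hB'⟩ := hA'.exists_bound
  have key : ∀ d v, 1 ≤ v → B + B' + hi + 1 ≤ v + d → A.above v = A'.above v + D v := by
    intro d
    induction d with
    | zero =>
      intro v _ h
      rw [Beads.above_eq_zero hB (by omega), Beads.above_eq_zero hB' (by omega), hD0 v (by omega)]
    | succ d ih =>
      intro v hv h
      have h1 := ih (v + 1) (by omega) (by omega)
      have h2 := hD v hv
      rw [hA.above_succ v, hA'.above_succ v, h1]
      omega
  exact fun v hv => key (B + B' + hi + 1) v hv (by omega)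

/-- The contribution to a class count of an interval of levels, each with the same number `c` of
blocks. -/
theorem sum_class_interval {i : ℕ} (hi1 : 1 ≤ i) (hi2 : i ≤ q + 1) (c : ℕ) {lo hi B : ℕ}
    (h : lo ≤ hi) (hB : hi < B) :
    (∑ v ∈ Finset.Ico 1 B, if levelClass q v = i then (if lo < v ∧ v ≤ hi then c else 0) else 0)
      + c * classLevels q i lo = c * classLevels q i hi := by
  have h1 : (∑ v ∈ Finset.Ico 1 B,
      if levelClass q v = i then (if lo < v ∧ v ≤ hi then c else 0) else 0)
      = ∑ v ∈ Finset.Ioc lo hi, if levelClass q v = i then c else 0 := by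
    rw [← Finset.sum_subset (s₁ := Finset.Ioc lo hi)]
    · refine Finset.sum_congr rfl fun v hv => ?_
      rw [Finset.mem_Ioc] at hv
      rw [if_pos hv]
    · intro v hv
      rw [Finset.mem_Ioc] at hv
      rw [Finset.mem_Ico]
      omega
    · intro v _ hv
      rw [Finset.mem_Ioc] at hv
      rw [if_neg hv, ite_self]
  rw [h1]
  clear h1 hB
  induction hi, h using Nat.le_induction with
  | base => simp
  | succ k hk ih =>
    rw [Finset.sum_Ioc_succ_top (by omega), classLevels_succ hi1 hi2, mul_add, ← ih]
    split_ifs <;> ring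

theorem classCount_add (hA : ∀ v, 1 ≤ v → A.above v = A'.above v + (D : ℕ → ℕ) v) (B i : ℕ) :
    classCount q A.above B i = classCount q A'.above B i
      + ∑ v ∈ Finset.Ico 1 B, if levelClass q v = i then D v else 0 := by
  unfold classCount
  rw [← Finset.sum_add_distrib]
  refine Finset.sum_congr rfl fun v hv => ?_
  rw [hA v (Finset.mem_Ico.1 hv).1]
  split_ifs <;> rfl

/-- A strip is a bar as soon as each class count drops by `2`, the charges of the coloured beads agree
and the number of uncoloured beads has the same parity: these data determine the label counts. -/
theorem barRemoval_of_strip (hq : 2 ≤ q) (hA : A.IsConfig (q + 2)) (hA' : A'.IsConfig (q + 2))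
    {D : ℕ → ℕ} {lo hi : ℕ} (habove : ∀ v, 1 ≤ v → A.above v = A'.above v + D v)
    (hclass : ∀ B, hi < B → ∀ i, 1 ≤ i → i ≤ q + 1 →
      (∑ v ∈ Finset.Ico 1 B, if levelClass q v = i then D v else 0) = 2)
    (hS : IsStrip q A.above A'.above (A.upperFirst q) (A'.upperFirst q) lo hi)
    (hf : A.plain.ncard % 2 = A'.plain.ncard % 2)
    (hc : (colouredEquiv (signedMult hA)).1 = (colouredEquiv (signedMult hA')).1) :
    BarRemoval (wallOf (by omega) hA) (wallOf (by omega) hA') := by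
  obtain ⟨K, hK1, hK, hK'⟩ := exists_common_bound hA hA'
  rw [barRemoval_iff hq hA hA' (abacus_wallOf _ hA) (abacus_wallOf _ hA') hK hK']
  refine ⟨hS.subset (by omega) hA.isProfile hA'.isProfile,
    hS.connected (by omega) hA.isProfile hA'.isProfile, fun i h1 h2 => ?_, ?_, ?_⟩
  · rw [classCount_add habove, hclass _ ?_ i h1 h2]
    by_contra h
    have h3 := (hS.inside hi hS.lt le_rfl).1
    rw [Beads.above_eq_zero hK (not_lt.1 h)] at h3
    omega
  · rw [classDiff_one hq hA hK1 hK, classDiff_one hq hA' hK1 hK', hf, hc]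
  · rw [classDiff_last hq hA hK1 hK, classDiff_last hq hA' hK1 hK', hc]
    simp only [neg_one_pow_eq_ite, Nat.even_iff, hf]

/-- Sufficient conditions for a strip in terms of beads.  The differences `D` between the two profiles
are `1` or `2` in an interval of levels; the half-block that comes first in a row matters only if the
top of some column separates the two half-blocks of this row. -/
theorem isStrip_of_count (hA : A.IsConfig (q + 2)) (hA' : A'.IsConfig (q + 2))
    {D : ℕ → ℕ} {lo hi : ℕ} (habove : ∀ v, 1 ≤ v → A.above v = A'.above v + D v) (hlt : lo < hi)
    (hout : ∀ v, v ≤ lo ∨ hi < v → D v = 0) (hin : ∀ v, lo < v → v ≤ hi → 1 ≤ D v ∧ D v ≤ 2)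
    (hmid : ∀ k, lo < (q + 1) * k → (q + 1) * k < hi →
      A.total ((q + 1) * k) ≤ 1 ∧ D ((q + 1) * k + 1) = 1)
    (hτ : ∀ k, 1 ≤ k → (q + 1) * k ≤ lo ∨ hi < (q + 1) * k →
      A.upperFirst q k = A'.upperFirst q k ∨ A.total ((q + 1) * k) = 0)
    (hlast : ∀ k, (q + 1) * k = hi → A.upperFirst q k = A'.upperFirst q k ∨ A'.total hi = 0) :
    IsStrip q A.above A'.above (A.upperFirst q) (A'.upperFirst q) lo hi where
  lt := hlt
  outside v hv h := by rw [habove v hv, hout v h, add_zero]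
  inside v h1 h2 := by
    rw [habove v (by omega)]
    have := hin v h1 h2
    omega
  step v h1 h2 := by
    by_cases hd : (q + 1) ∣ v
    · obtain ⟨k, rfl⟩ := hd
      have := (hmid k h1 h2).1
      rw [hA.above_succ, hA.count_of_dvd (dvd_mul_right _ _)]
      omega
    · exact hA.isProper v hd
  half_outside k hk h := by
    refine (hτ k hk h).imp id fun h0 => ?_
    rw [hA.above_succ, hA.count_of_dvd (dvd_mul_right _ _), h0, zero_add]
  half_last k hk := by
    refine (hlast k hk).imp id fun h0 => ?_
    rw [hA'.above_succ, hA'.count_of_dvd ⟨k, hk.symm⟩, h0, zero_add]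
  half_inside k h1 h2 := by rw [habove _ (by omega), (hmid k h1 h2).2]

theorem upperFirst_congr {k : ℕ} (hb : A.coloured Colour.black ((q + 1) * k) = 0
      ↔ A'.coloured Colour.black ((q + 1) * k) = 0)
    (hs : A.shorter ((q + 1) * k) % 2 = A'.shorter ((q + 1) * k) % 2) :
    A.upperFirst q k = A'.upperFirst q k := by
  unfold Beads.upperFirst
  rw [decide_eq_decide, Nat.odd_iff, Nat.odd_iff]
  simp only [hb]
  split_ifs <;> omega

/-- If two configurations have the same coloured beads, the parities of the numbers of uncoloured
beads below a position are related by the numbers of columns beyond it. -/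
theorem shorter_of_coloured_eq (hA : A.IsConfig (q + 2)) (hA' : A'.IsConfig (q + 2))
    (h : A'.coloured = A.coloured) {k : ℕ} (hk : 1 ≤ k) :
    A.above ((q + 1) * k + 1) + A.shorter ((q + 1) * k) + A'.plain.ncard
      = A'.above ((q + 1) * k + 1) + A'.shorter ((q + 1) * k) + A.plain.ncard := by
  obtain ⟨j, rfl⟩ : ∃ j, k = j + 1 := ⟨k - 1, by omega⟩
  have h1 := above_add_shorter hA j
  have h2 := above_add_shorter hA' j
  have h3 : signedMult hA' = signedMult hA := by
    ext k
    rw [signedMult_apply, signedMult_apply, h]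
  rw [h3] at h2
  omega

theorem signedMult_congr (hA : A.IsConfig (q + 2)) (hA' : A'.IsConfig (q + 2))
    (h : A'.coloured = A.coloured) : signedMult hA' = signedMult hA := by
  ext k
  rw [signedMult_apply, signedMult_apply, h]

theorem classLevels_add (i t : ℕ) :
    classLevels q i (t + (2 * q + 2)) = classLevels q i t + 2 := by
  unfold classLevels
  rw [Nat.add_div_right _ (by omega), Nat.add_mod_right]
  ring

theorem isConfig_of_plain {p : Set ℕ} (hA : A.IsConfig (q + 2)) (hp : p.Finite)
    (hpos : ∀ s ∈ p, 0 < s ∧ ¬ (q + 1) ∣ s) : Beads.IsConfig (q + 2) ⟨p, A.coloured⟩ :=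
  ⟨hp, hpos, hA.coloured_finite, hA.coloured_pos, hA.one_colour⟩

/-- A `slide` removes a bar. -/
theorem barRemoval_slide (hq : 2 ≤ q) (hA : A.IsConfig (q + 2)) {t : ℕ} (ht : 0 < t)
    (hmem : t + (2 * q + 2) ∈ A.plain) (hnot : t ∉ A.plain)
    (hmid : ∀ k, (q + 1) ∣ k → t < k → k < t + (2 * q + 2) → A.total k ≤ 1) :
    ∃ hA' : Beads.IsConfig (q + 2) ⟨insert t (A.plain \ {t + (2 * q + 2)}), A.coloured⟩,
      BarRemoval (wallOf (by omega) hA) (wallOf (by omega) hA') := by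
  have hhi := (hA.plain_pos _ hmem).2
  have hlo : ¬ (q + 1) ∣ t := fun h => hhi ((Nat.dvd_add_right h).2 ⟨2, by ring⟩)
  have hA' : Beads.IsConfig (q + 2) ⟨insert t (A.plain \ {t + (2 * q + 2)}), A.coloured⟩ := by
    refine isConfig_of_plain hA ((hA.plain_finite.sdiff).insert t) fun s hs => ?_
    rcases hs with rfl | hs
    · exact ⟨ht, hlo⟩
    · exact hA.plain_pos s hs.1
  refine ⟨hA', ?_⟩
  set A' : Beads := ⟨insert t (A.plain \ {t + (2 * q + 2)}), A.coloured⟩ with hA'def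
  obtain ⟨D, hD⟩ : ∃ D : ℕ → ℕ, ∀ v, D v = if t < v ∧ v ≤ t + (2 * q + 2) then 1 else 0 :=
    ⟨_, fun _ => rfl⟩
  have hcount : ∀ v, 1 ≤ v → A.count v + D (v + 1) = A'.count v + D v := by
    intro v _
    have ht : A'.total v = A.total v := rfl
    rw [hD, hD]
    have hm : v ∈ A'.plain ↔ v = t ∨ (v ∈ A.plain ∧ v ≠ t + (2 * q + 2)) := Iff.rfl
    by_cases h1 : v = t
    · subst h1
      rw [Beads.count_of_not_mem hnot, Beads.count_of_mem (hm.2 (Or.inl rfl)), ht,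
        if_pos (by omega), if_neg (by omega)]
      ring
    · by_cases h2 : v = t + (2 * q + 2)
      · rw [Beads.count_of_mem (h2 ▸ hmem : v ∈ A.plain), Beads.count_of_not_mem fun h => by
            rcases hm.1 h with h | h
            exacts [h1 h, h.2 h2], ht, if_neg (by omega), if_pos (by omega)]
        ring
      · rw [Beads.count_congr (by rw [hm]; tauto) ht]
        split_ifs <;> omega
  have habove := above_eq_add hA hA' (hi := t + (2 * q + 2))
    (fun v hv => by rw [hD]; exact if_neg (by omega)) hcount
  have hf : A'.plain.ncard = A.plain.ncard := Set.ncard_exchange hnot hmem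
  have hS : IsStrip q A.above A'.above (A.upperFirst q) (A'.upperFirst q) t (t + (2 * q + 2)) := by
    refine isStrip_of_count hA hA' habove (by omega) (fun v hv => ?_) (fun v h1 h2 => ?_)
      (fun k h1 h2 => ?_) (fun k hk h => ?_) (fun k hk => ?_)
    · rw [hD]; exact if_neg (by omega)
    · rw [hD, if_pos ⟨h1, h2⟩]; omega
    · rw [hD, if_pos (by omega)]
      exact ⟨hmid _ (dvd_mul_right _ _) h1 h2, rfl⟩
    · left
      apply upperFirst_congr (A := A) (A' := A') Iff.rfl
      have e1 := shorter_of_coloured_eq hA hA' rfl hk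
      have hne : (q + 1) * k ≠ t := fun h => hlo ⟨k, h.symm⟩
      have e2 := habove ((q + 1) * k + 1) (by omega)
      rw [hD, if_neg (by omega)] at e2
      omega
    · exact absurd ⟨k, hk.symm⟩ hhi
  refine barRemoval_of_strip hq hA hA' habove (fun B hB i h1 h2 => ?_) hS (by rw [hf]) ?_
  · have e := sum_class_interval (q := q) h1 h2 1 (lo := t) (hi := t + (2 * q + 2)) (by omega) hB
    rw [classLevels_add, one_mul, one_mul] at e
    simp only [hD]
    omega
  · rw [signedMult_congr hA hA' rfl]

/-- A `cancel` removes a bar. -/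
theorem barRemoval_cancel (hq : 2 ≤ q) (hA : A.IsConfig (q + 2)) {s t : ℕ} (hs : s ∈ A.plain)
    (ht : t ∈ A.plain) (hst : s < t) (hsum : s + t = 2 * q + 2) (hmid : A.total (q + 1) ≤ 1) :
    ∃ hA' : Beads.IsConfig (q + 2) ⟨A.plain \ {s, t}, A.coloured⟩,
      BarRemoval (wallOf (by omega) hA) (wallOf (by omega) hA') := by
  have hs0 := (hA.plain_pos s hs).1
  have hA' : Beads.IsConfig (q + 2) ⟨A.plain \ {s, t}, A.coloured⟩ :=
    isConfig_of_plain hA hA.plain_finite.sdiff fun s hs => hA.plain_pos s hs.1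
  refine ⟨hA', ?_⟩
  set A' : Beads := ⟨A.plain \ {s, t}, A.coloured⟩ with hA'def
  obtain ⟨D, hD⟩ : ∃ D : ℕ → ℕ, ∀ v, D v = (if 0 < v ∧ v ≤ t then 1 else 0)
    + if 0 < v ∧ v ≤ s then 1 else 0 := ⟨_, fun _ => rfl⟩
  have hcount : ∀ v, 1 ≤ v → A.count v + D (v + 1) = A'.count v + D v := by
    intro v hv
    have ht' : A'.total v = A.total v := rfl
    rw [hD, hD]
    have hm : v ∈ A'.plain ↔ v ∈ A.plain ∧ ¬ (v = s ∨ v = t) := Iff.rfl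
    by_cases h1 : v = s ∨ v = t
    · have hvA : v ∈ A.plain := by rcases h1 with rfl | rfl <;> assumption
      rw [Beads.count_of_mem hvA, Beads.count_of_not_mem fun h => (hm.1 h).2 h1, ht']
      rcases h1 with rfl | rfl <;> split_ifs <;> omega
    · rw [Beads.count_congr (by rw [hm]; tauto) ht']
      split_ifs <;> omega
  have habove := above_eq_add hA hA' (hi := t)
    (fun v hv => by rw [hD, if_neg (by omega), if_neg (by omega)]) hcount
  have hf : A'.plain.ncard + 2 = A.plain.ncard := by
    have h := Set.ncard_sdiff_add_ncard_of_subset (s := {s, t}) (t := A.plain)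
      (by rintro x (rfl | rfl) <;> assumption) hA.plain_finite
    rwa [Set.ncard_pair hst.ne] at h
  have hnd : ∀ k, (q + 1) * k ≠ t := fun k h => (hA.plain_pos t ht).2 ⟨k, h.symm⟩
  have hS : IsStrip q A.above A'.above (A.upperFirst q) (A'.upperFirst q) 0 t := by
    refine isStrip_of_count hA hA' habove (by omega) (fun v hv => ?_) (fun v h1 h2 => ?_)
      (fun k h1 h2 => ?_) (fun k hk h => ?_) (fun k hk => absurd hk (hnd k))
    · rw [hD, if_neg (by omega), if_neg (by omega)]
    · rw [hD, if_pos (by omega)]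
      split_ifs <;> omega
    · obtain rfl : k = 1 := by
        have h3 : 0 < k := Nat.pos_of_mul_pos_left h1
        by_contra hne
        have := Nat.mul_le_mul_left (q + 1) (show 2 ≤ k by omega)
        omega
      rw [hD, if_pos (by omega), if_neg (by omega), mul_one]
      exact ⟨hmid, rfl⟩
    · left
      apply upperFirst_congr (A := A) (A' := A') Iff.rfl
      have e1 := shorter_of_coloured_eq hA hA' rfl hk
      have hpos : 0 < (q + 1) * k := Nat.mul_pos (by omega) hk
      have e2 := habove ((q + 1) * k + 1) (by omega)
      rw [hD, if_neg (by omega), if_neg (by omega)] at e2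
      omega
  refine barRemoval_of_strip hq hA hA' habove (fun B hB i h1 h2 => ?_) hS (by omega) ?_
  · have e := sum_class_interval (q := q) h1 h2 1 (lo := 0) (hi := t) (by omega) hB
    have e' := sum_class_interval (q := q) h1 h2 1 (lo := 0) (hi := s) (by omega)
      (show s < B by omega)
    have e0 : classLevels q i s + classLevels q i t = 2 := by
      unfold classLevels
      rw [Nat.div_eq_of_lt (by omega), Nat.div_eq_of_lt (by omega), Nat.mod_eq_of_lt (by omega),
        Nat.mod_eq_of_lt (by omega)]
      split_ifs <;> omega
    have e1 : classLevels q i 0 = 0 := by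
      unfold classLevels
      rw [Nat.zero_div, Nat.zero_mod]
      split_ifs <;> omega
    rw [e1] at e e'
    rw [Finset.sum_congr rfl fun v _ => show _ = (if levelClass q v = i then
        (if 0 < v ∧ v ≤ t then 1 else 0) else 0) + (if levelClass q v = i then
        (if 0 < v ∧ v ≤ s then 1 else 0) else 0) by rw [hD]; split_ifs <;> rfl,
      Finset.sum_add_distrib]
    omega
  · rw [signedMult_congr hA hA' rfl]

end

/-! ### Moves of one coloured bead remove bars -/

section

variable {q : ℕ} {A A' : Beads}

theorem isConfig_of_coloured (hA : A.IsConfig (q + 2)) (hp : A'.plain = A.plain) {S : Set ℕ}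
    (hS : S.Finite) (hSd : ∀ v ∈ S, (q + 1) ∣ v)
    (hout : ∀ v, v ∉ S → ∀ d, A'.coloured d v = A.coloured d v)
    (hz : ∀ d, A'.coloured d 0 = 0)
    (hone : ∀ v ∈ S, A'.coloured Colour.white v = 0 ∨ A'.coloured Colour.black v = 0) :
    A'.IsConfig (q + 2) where
  plain_finite := hp ▸ hA.plain_finite
  plain_pos := hp ▸ hA.plain_pos
  coloured_finite := (hA.coloured_finite.union hS).subset fun v hv => by
    by_cases h : v ∈ S
    · exact Or.inr h
    · left
      rw [Set.mem_ofPred_eq, Beads.total, hout v h, hout v h] at hv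
      exact hv
  coloured_pos v hv := by
    refine ⟨Nat.pos_of_ne_zero ?_, ?_⟩
    · rintro rfl
      rw [Beads.total, hz, hz] at hv
      exact hv rfl
    · by_cases h : v ∈ S
      · exact hSd v h
      · rw [Beads.total, hout v h, hout v h] at hv
        exact (hA.coloured_pos v hv).2
  one_colour v := by
    by_cases h : v ∈ S
    · exact hone v h
    · rw [hout v h, hout v h]
      exact hA.one_colour v

theorem mul_succ_ne {a b : ℕ} (h : a ≠ b) : (q + 1) * a ≠ (q + 1) * b :=
  fun e => h (Nat.eq_of_mul_eq_mul_left (Nat.succ_pos q) e)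

/-- The signed number of beads at position `(q + 1) k`, where `z` stands for the invisible beads at
position `0`. -/
def signedAt (q : ℕ) (A : Beads) (z : ℤ) (k : ℕ) : ℤ :=
  if k = 0 then z
  else (A.coloured Colour.white ((q + 1) * k) : ℤ) - A.coloured Colour.black ((q + 1) * k)

theorem signedAt_succ (hA : A.IsConfig (q + 2)) (z : ℤ) (k : ℕ) :
    signedAt q A z (k + 1) = signedMult hA k := by
  rw [signedAt, if_neg (Nat.succ_ne_zero k), signedMult_apply]

/-- The moves `jump` and `swap` displace one bead by `2n - 2` positions. -/
theorem barRemoval_of_one_bead (hq : 2 ≤ q) (hA : A.IsConfig (q + 2)) (hA' : A'.IsConfig (q + 2))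
    (hp : A'.plain = A.plain) {a : ℕ}
    (hout : ∀ v, v ≠ (q + 1) * a → v ≠ (q + 1) * (a + 1) → v ≠ (q + 1) * (a + 2) →
      ∀ d, A'.coloured d v = A.coloured d v)
    (hlo : a ≠ 0 → A'.total ((q + 1) * a) = A.total ((q + 1) * a) + 1)
    (hmid : A'.total ((q + 1) * (a + 1)) = A.total ((q + 1) * (a + 1)))
    (hmid1 : A.total ((q + 1) * (a + 1)) ≤ 1)
    (hhi : A'.total ((q + 1) * (a + 2)) + 1 = A.total ((q + 1) * (a + 2)))
    (hloc : A.total ((q + 1) * a) = 0 ∨ (A.coloured Colour.black ((q + 1) * a) = 0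
      ↔ A'.coloured Colour.black ((q + 1) * a) = 0))
    (hhic : A'.total ((q + 1) * (a + 2)) = 0 ∨ (A.coloured Colour.black ((q + 1) * (a + 2)) = 0
      ↔ A'.coloured Colour.black ((q + 1) * (a + 2)) = 0))
    (hc : (colouredEquiv (signedMult hA)).1 = (colouredEquiv (signedMult hA')).1) :
    BarRemoval (wallOf (by omega) hA) (wallOf (by omega) hA') := by
  obtain ⟨t, ht⟩ : ∃ t, t = (q + 1) * a := ⟨_, rfl⟩
  have e1 : (q + 1) * (a + 1) = t + (q + 1) := by rw [ht]; ring
  have e2 : (q + 1) * (a + 2) = t + (2 * q + 2) := by rw [ht]; ring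
  -- the displaced bead adds one block to each of the `2n - 2` levels that it passes
  obtain ⟨D, hD⟩ : ∃ D : ℕ → ℕ, ∀ v, D v = if t < v ∧ v ≤ t + (2 * q + 2) then 1 else 0 :=
    ⟨_, fun _ => rfl⟩
  have hshort : ∀ v, A'.shorter v = A.shorter v := fun v => by rw [Beads.shorter, Beads.shorter, hp]
  have hcount : ∀ v, 1 ≤ v → A.count v + D (v + 1) = A'.count v + D v := by
    intro v hv
    have hpl : ∀ n m, A'.total v + n = A.total v + m → A'.count v + n = A.count v + m := by
      intro n m h
      by_cases hv : v ∈ A.plain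
      · rw [Beads.count_of_mem hv, Beads.count_of_mem (hp ▸ hv : v ∈ A'.plain)]
        omega
      · rw [Beads.count_of_not_mem hv, Beads.count_of_not_mem (hp ▸ hv : v ∉ A'.plain)]
        omega
    refine (hpl _ _ ?_).symm
    rw [hD, hD]
    by_cases h1 : v = (q + 1) * a
    · have ha : a ≠ 0 := by
        rintro rfl
        rw [mul_zero] at h1
        omega
      rw [h1, hlo ha, ← ht, if_neg (by omega), if_pos (by omega)]
    · by_cases h2 : v = (q + 1) * (a + 2)
      · rw [h2, ← hhi, e2, if_pos (by omega), if_neg (by omega)]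
      · have : A'.total v = A.total v := by
          by_cases h3 : v = (q + 1) * (a + 1)
          · rw [h3, hmid]
          · rw [Beads.total, hout v h1 h3 h2, hout v h1 h3 h2, Beads.total]
        rw [this]
        split_ifs <;> omega
  have habove := above_eq_add hA hA' (hi := t + (2 * q + 2))
    (fun v hv => by rw [hD]; exact if_neg (by omega)) hcount
  have hS : IsStrip q A.above A'.above (A.upperFirst q) (A'.upperFirst q) t (t + (2 * q + 2)) := by
    refine isStrip_of_count hA hA' habove (by omega) (fun v hv => ?_) (fun v h1 h2 => ?_)
      (fun k h1 h2 => ?_) (fun k hk h => ?_) (fun k hk => ?_)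
    · rw [hD]; exact if_neg (by omega)
    · rw [hD, if_pos ⟨h1, h2⟩]; omega
    · rw [hD, if_pos (by omega)]
      rw [ht] at h1
      rw [← e2] at h2
      have h3 := Nat.lt_of_mul_lt_mul_left h1
      have h4 := Nat.lt_of_mul_lt_mul_left h2
      obtain rfl : k = a + 1 := by omega
      exact ⟨hmid1, rfl⟩
    · by_cases hka : k = a
      · subst hka
        exact hloc.symm.imp (fun h => upperFirst_congr h (by rw [hshort])) id
      · left
        have h1 := mul_succ_ne (q := q) hka
        refine upperFirst_congr ?_ (by rw [hshort])
        rw [hout _ h1 (by omega) (by omega)]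
    · obtain rfl : k = a + 2 := by
        rw [← e2] at hk
        exact Nat.eq_of_mul_eq_mul_left (Nat.succ_pos q) hk
      rw [← hk]
      exact hhic.symm.imp (fun h => upperFirst_congr h (by rw [hshort])) id
  refine barRemoval_of_strip hq hA hA' habove (fun B hB i h1 h2 => ?_) hS (by rw [hp]) hc
  have e := sum_class_interval (q := q) h1 h2 1 (lo := t) (hi := t + (2 * q + 2)) (by omega) hB
  rw [classLevels_add, one_mul, one_mul] at e
  simp only [hD]
  omega

/-- A `jump` removes a bar. -/
theorem barRemoval_jump (hq : 2 ≤ q) (hA : A.IsConfig (q + 2)) {c : Colour} {a : ℕ}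
    (hhi : 1 ≤ A.coloured c ((q + 1) * (a + 2))) (hmid : A.total ((q + 1) * (a + 1)) = 0)
    (hacc : A.Accepts c ((q + 1) * a)) :
    ∃ hA' : Beads.IsConfig (q + 2)
      ((A.take c ((q + 1) * (a + 2)) 1).put c ((q + 1) * a) 1),
      BarRemoval (wallOf (by omega) hA) (wallOf (by omega) hA') := by
  set A' := (A.take c ((q + 1) * (a + 2)) 1).put c ((q + 1) * a) 1 with hA'def
  have hne : (q + 1) * (a + 2) ≠ (q + 1) * a := mul_succ_ne (by omega)
  have hne1 : (q + 1) * (a + 1) ≠ (q + 1) * a := mul_succ_ne (by omega)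
  have hne2 : (q + 1) * (a + 1) ≠ (q + 1) * (a + 2) := mul_succ_ne (by omega)
  have hother : c.other ≠ c := by cases c <;> simp [Colour.other]
  have ho : ∀ v, A'.coloured c.other v = A.coloured c.other v := by
    intro v
    simp [hA'def, Beads.put, Beads.take, hother]
  have hc2 : A'.coloured c ((q + 1) * (a + 2)) = A.coloured c ((q + 1) * (a + 2)) - 1 := by
    simp only [hA'def, Beads.put, Beads.take]
    rw [if_neg fun h => hne h.2.1, if_pos ⟨trivial, trivial⟩]
  have hc0 : a ≠ 0 → A'.coloured c ((q + 1) * a) = A.coloured c ((q + 1) * a) + 1 := by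
    intro ha
    simp only [hA'def, Beads.put, Beads.take]
    rw [if_pos ⟨trivial, trivial, Nat.mul_ne_zero (by omega) ha⟩, if_neg fun h => hne h.2.symm]
  have hcz : a = 0 → A'.coloured c ((q + 1) * a) = A.coloured c ((q + 1) * a) := by
    rintro rfl
    simp only [hA'def, Beads.put, Beads.take]
    rw [if_neg fun h => h.2.2 (mul_zero _), if_neg fun h => hne h.2.symm]
  have hout : ∀ v, v ≠ (q + 1) * a → v ≠ (q + 1) * (a + 2) →
      ∀ d, A'.coloured d v = A.coloured d v := by
    intro v h1 h2 d
    simp only [hA'def, Beads.put, Beads.take]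
    rw [if_neg fun h => h1 h.2.1, if_neg fun h => h2 h.2]
  have hone2 := hA.one_colour ((q + 1) * (a + 2))
  have hz := hA.coloured_zero
  have hA' : A'.IsConfig (q + 2) := by
    refine isConfig_of_coloured hA rfl (S := {(q + 1) * a, (q + 1) * (a + 2)}) (by simp)
      (by rintro v (rfl | rfl) <;> exact dvd_mul_right _ _) (fun v hv => ?_) (fun d => ?_) ?_
    · simp only [Set.mem_insert_iff, Set.mem_singleton_iff, not_or] at hv
      exact hout v hv.1 hv.2
    · by_cases ha : a = 0
      · have h1 := hcz ha
        have h2 := ho 0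
        rw [ha, mul_zero] at h1
        rw [hz] at h1 h2
        cases c <;> cases d <;> assumption
      · rw [hout 0 (Nat.mul_ne_zero (by omega) ha).symm (by simp), hz]
    · rintro v (rfl | rfl)
      · have h1 := hacc.1
        have h2 := ho ((q + 1) * a)
        rw [h1] at h2
        cases c
        · exact Or.inr h2
        · exact Or.inl h2
      · have h2 := ho ((q + 1) * (a + 2))
        cases c <;> simp only [Colour.other] at h2 <;> omega
  refine ⟨hA', barRemoval_of_one_bead hq hA hA' rfl (a := a) (fun v h1 _ h3 => hout v h1 h3)
    ?_ ?_ (by omega) ?_ ?_ ?_ ?_⟩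
  · intro ha
    have h1 := hc0 ha
    have h2 := ho ((q + 1) * a)
    unfold Beads.total
    cases c <;> simp only [Colour.other] at h2 <;> omega
  · rw [Beads.total, hout _ hne1 hne2, hout _ hne1 hne2, Beads.total]
  · have h2 := ho ((q + 1) * (a + 2))
    unfold Beads.total
    cases c <;> simp only [Colour.other] at h2 <;> omega
  · have h1 := hacc.1
    have h2 := ho ((q + 1) * a)
    by_cases ha : a = 0
    · left
      rw [ha, mul_zero, Beads.total, hz, hz]
    · have h3 := hc0 ha
      unfold Beads.total
      cases c <;> simp only [Colour.other] at h1 h2 <;> omega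
  · have h2 := ho ((q + 1) * (a + 2))
    unfold Beads.total
    cases c <;> simp only [Colour.other] at h2 <;> omega
  · have hε : ∃ ε : ℤ, (c = Colour.white ∧ ε = 1) ∨ (c = Colour.black ∧ ε = -1) := by
      cases c <;> simp
    obtain ⟨ε, hε⟩ := hε
    -- a bead moved to position `0` disappears, so the value of `u'` there is the one the moved bead
    -- and the invisible white bead would give together
    refine colouredEquiv_charges_jump (a := a) (ε := ε) (u := signedAt q A 1)
      (u' := signedAt q A' (if a = 0 then 1 + ε else 1)) (signedAt_succ hA 1) (signedAt_succ hA' _)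
      rfl (fun k h1 h2 => ?_) ?_ ?_ ?_ ?_
    · unfold signedAt
      by_cases hk : k = 0
      · rw [if_pos hk, if_pos hk, if_neg (by omega)]
      · rw [if_neg hk, if_neg hk, hout _ (mul_succ_ne h1) (mul_succ_ne h2),
          hout _ (mul_succ_ne h1) (mul_succ_ne h2)]
    · rw [signedAt, if_neg (by omega)]
      rw [Beads.total] at hmid
      omega
    · rw [signedAt, signedAt, if_neg (by omega), if_neg (by omega)]
      have h2 := ho ((q + 1) * (a + 2))
      rcases hε with ⟨rfl, rfl⟩ | ⟨rfl, rfl⟩ <;> simp only [Colour.other] at h2 <;> omega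
    · rw [signedAt, signedAt]
      by_cases ha : a = 0
      · rw [if_pos ha, if_pos ha, if_pos ha]
      · rw [if_neg ha, if_neg ha]
        have h2 := ho ((q + 1) * a)
        have h3 := hc0 ha
        rcases hε with ⟨rfl, rfl⟩ | ⟨rfl, rfl⟩ <;> simp only [Colour.other] at h2 <;> omega
    · rw [signedAt, signedAt, if_neg (by omega)]
      have h1 := hacc.1
      by_cases ha : a = 0
      · rw [if_pos ha]
        have h3 := hacc.2 (by rw [ha, mul_zero])
        rcases hε with ⟨rfl, rfl⟩ | ⟨rfl, rfl⟩
        · omega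
        · cases h3
      · rw [if_neg ha]
        rcases hε with ⟨rfl, rfl⟩ | ⟨rfl, rfl⟩ <;> simp only [Colour.other] at h1 <;> omega

end

/-! ### Moves of two coloured beads remove bars -/

section

variable {q : ℕ} {A : Beads}

/-- A `swap` removes a bar. -/
theorem barRemoval_swap (hq : 2 ≤ q) (hA : A.IsConfig (q + 2)) {c d : Colour} {a : ℕ}
    (hhi : 1 ≤ A.coloured c ((q + 1) * (a + 2))) (hmid : A.total ((q + 1) * (a + 1)) = 1)
    (hmidd : A.coloured d ((q + 1) * (a + 1)) = 1) (hacc : A.Accepts c.other ((q + 1) * a)) :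
    ∃ hA' : Beads.IsConfig (q + 2) ((((A.take c ((q + 1) * (a + 2)) 1).put c.other
      ((q + 1) * a) 1).take d ((q + 1) * (a + 1)) 1).put d.other ((q + 1) * (a + 1)) 1),
      BarRemoval (wallOf (by omega) hA) (wallOf (by omega) hA') := by
  set A' := (((A.take c ((q + 1) * (a + 2)) 1).put c.other
      ((q + 1) * a) 1).take d ((q + 1) * (a + 1)) 1).put d.other ((q + 1) * (a + 1)) 1 with hA'def
  have hne : (q + 1) * (a + 2) ≠ (q + 1) * a := mul_succ_ne (by omega)
  have hne1 : (q + 1) * (a + 1) ≠ (q + 1) * a := mul_succ_ne (by omega)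
  have hne2 : (q + 1) * (a + 1) ≠ (q + 1) * (a + 2) := mul_succ_ne (by omega)
  have hm0 : (q + 1) * (a + 1) ≠ 0 := Nat.mul_ne_zero (by omega) (by omega)
  have hother : ∀ c : Colour, c.other ≠ c := by intro c; cases c <;> simp [Colour.other]
  have hval : ∀ e v, A'.coloured e v =
      if e = d.other ∧ v = (q + 1) * (a + 1) then A.coloured e v + 1
      else if e = d ∧ v = (q + 1) * (a + 1) then A.coloured e v - 1
      else if e = c.other ∧ v = (q + 1) * a ∧ a ≠ 0 then A.coloured e v + 1
      else if e = c ∧ v = (q + 1) * (a + 2) then A.coloured e v - 1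
      else A.coloured e v := by
    intro e v
    have ha : (q + 1) * a ≠ 0 ↔ a ≠ 0 := by simp
    simp only [hA'def, Beads.put, Beads.take, ha]
    by_cases h1 : v = (q + 1) * (a + 1)
    · subst h1
      simp only [hne1, hne2, hm0, and_false, false_and, if_false, and_true, ne_eq, not_false_eq_true]
      by_cases h2 : e = d.other
      · rw [if_pos h2, if_pos h2, if_neg (h2 ▸ hother d)]
      · rw [if_neg h2, if_neg h2]
    · simp only [h1, and_false, false_and, if_false]
      by_cases h2 : v = (q + 1) * (a + 2)
      · subst h2
        simp only [hne, and_false, false_and, if_false]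
      · simp only [h2, and_false, if_false]
  have hmidc : A'.coloured d ((q + 1) * (a + 1)) = 0 ∧
      A'.coloured d.other ((q + 1) * (a + 1)) = 1 ∧ A.coloured d.other ((q + 1) * (a + 1)) = 0 := by
    have h0 : A.coloured d.other ((q + 1) * (a + 1)) = 0 := by
      rw [Beads.total] at hmid
      cases d <;> simp only [Colour.other] <;> omega
    rw [hval, hval, if_neg fun h => hother d h.1.symm, if_pos ⟨rfl, rfl⟩, if_pos ⟨rfl, rfl⟩]
    omega
  have hhic : A'.coloured c ((q + 1) * (a + 2)) = A.coloured c ((q + 1) * (a + 2)) - 1 ∧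
      A'.coloured c.other ((q + 1) * (a + 2)) = A.coloured c.other ((q + 1) * (a + 2)) := by
    rw [hval, hval, if_neg fun h => hne2 h.2.symm, if_neg fun h => hne2 h.2.symm,
      if_neg fun h => hne h.2.1, if_pos ⟨rfl, rfl⟩, if_neg fun h => hne2 h.2.symm,
      if_neg fun h => hne2 h.2.symm, if_neg fun h => hne h.2.1, if_neg fun h => hother c h.1]
    exact ⟨rfl, rfl⟩
  have hloc : A'.coloured c ((q + 1) * a) = A.coloured c ((q + 1) * a) := by
    rw [hval, if_neg fun h => hne1 h.2.symm, if_neg fun h => hne1 h.2.symm,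
      if_neg fun h => hother c h.1.symm, if_neg fun h => hne h.2.symm]
  have hlo : a ≠ 0 → A'.coloured c.other ((q + 1) * a) = A.coloured c.other ((q + 1) * a) + 1 := by
    intro ha
    rw [hval, if_neg fun h => hne1 h.2.symm, if_neg fun h => hne1 h.2.symm,
      if_pos ⟨rfl, rfl, ha⟩]
  have hlo0 : a = 0 → A'.coloured c.other ((q + 1) * a) = A.coloured c.other ((q + 1) * a) := by
    intro ha
    rw [hval, if_neg fun h => hne1 h.2.symm, if_neg fun h => hne1 h.2.symm,
      if_neg fun h => h.2.2 ha, if_neg fun h => hne h.2.symm]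
  have hout : ∀ v, v ≠ (q + 1) * a → v ≠ (q + 1) * (a + 1) → v ≠ (q + 1) * (a + 2) →
      ∀ d, A'.coloured d v = A.coloured d v := by
    intro v h1 h2 h3 d
    rw [hval, if_neg fun h => h2 h.2, if_neg fun h => h2 h.2, if_neg fun h => h1 h.2.1,
      if_neg fun h => h3 h.2]
  have hone2 := hA.one_colour ((q + 1) * (a + 2))
  have hz := hA.coloured_zero
  have hacc1 : A.coloured c ((q + 1) * a) = 0 := by
    have h := hacc.1
    cases c <;> exact h
  have hA' : A'.IsConfig (q + 2) := by
    refine isConfig_of_coloured hA rfl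
      (S := {(q + 1) * a, (q + 1) * (a + 1), (q + 1) * (a + 2)}) (by simp)
      (by rintro v (rfl | rfl | rfl) <;> exact dvd_mul_right _ _) (fun v hv => ?_) (fun e => ?_) ?_
    · simp only [Set.mem_insert_iff, Set.mem_singleton_iff, not_or] at hv
      exact hout v hv.1 hv.2.1 hv.2.2
    · by_cases ha : a = 0
      · have h1 := hlo0 ha
        have h2 := hloc
        rw [ha, mul_zero] at h1 h2
        rw [hz] at h1 h2
        cases c <;> cases e <;> assumption
      · rw [hout 0 (Nat.mul_ne_zero (by omega) ha).symm hm0.symm (by simp), hz]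
    · rintro v (rfl | rfl | rfl)
      · rw [hacc1] at hloc
        cases c
        · exact Or.inl hloc
        · exact Or.inr hloc
      · cases d
        · exact Or.inl hmidc.1
        · exact Or.inr hmidc.1
      · cases c <;> simp only [Colour.other] at hhic <;> omega
  refine ⟨hA', barRemoval_of_one_bead hq hA hA' rfl (a := a) hout ?_ ?_ hmid.le ?_ ?_ ?_ ?_⟩
  · intro ha
    have h1 := hlo ha
    unfold Beads.total
    cases c <;> simp only [Colour.other] at h1 <;> omega
  · rw [hmid, Beads.total]
    cases d <;> simp only [Colour.other] at hmidc <;> omega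
  · unfold Beads.total
    cases c <;> simp only [Colour.other] at hhic <;> omega
  · by_cases ha : a = 0
    · left
      rw [ha, mul_zero, Beads.total, hz, hz]
    · have h1 := hlo ha
      unfold Beads.total
      cases c <;> simp only [Colour.other] at h1 <;> omega
  · unfold Beads.total
    cases c <;> simp only [Colour.other] at hhic <;> omega
  · obtain ⟨ε, hε⟩ : ∃ ε : ℤ, (c = Colour.white ∧ ε = 1) ∨ (c = Colour.black ∧ ε = -1) := by
      cases c <;> simp
    -- the value of `u'` at `0` is the one the moved bead would give there
    refine colouredEquiv_charges_swap (a := a) (ε := ε) (u := signedAt q A 1)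
      (u' := signedAt q A' (if a = 0 then 1 - ε else 1)) (signedAt_succ hA 1) (signedAt_succ hA' _)
      rfl (fun k h1 h2 h3 => ?_) ?_ ?_ ?_ ?_ ?_
    · unfold signedAt
      by_cases hk : k = 0
      · rw [if_pos hk, if_pos hk, if_neg (by omega)]
      · rw [if_neg hk, if_neg hk, hout _ (mul_succ_ne h1) (mul_succ_ne h2) (mul_succ_ne h3),
          hout _ (mul_succ_ne h1) (mul_succ_ne h2) (mul_succ_ne h3)]
    · rw [signedAt, if_neg (by omega)]
      cases d <;> simp only [Colour.other] at hmidc <;> omega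
    · rw [signedAt, signedAt, if_neg (by omega), if_neg (by omega)]
      cases d <;> simp only [Colour.other] at hmidc <;> omega
    · rw [signedAt, signedAt, if_neg (by omega), if_neg (by omega)]
      rcases hε with ⟨rfl, rfl⟩ | ⟨rfl, rfl⟩ <;> simp only [Colour.other] at hhic <;> omega
    · rw [signedAt, signedAt]
      by_cases ha : a = 0
      · rw [if_pos ha, if_pos ha, if_pos ha]
      · rw [if_neg ha, if_neg ha]
        have h3 := hlo ha
        rcases hε with ⟨rfl, rfl⟩ | ⟨rfl, rfl⟩ <;> simp only [Colour.other] at h3 <;> omega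
    · rw [signedAt, signedAt, if_neg (by omega)]
      by_cases ha : a = 0
      · rw [if_pos ha]
        have h3 := hacc.2 (by rw [ha, mul_zero])
        rcases hε with ⟨rfl, rfl⟩ | ⟨rfl, rfl⟩
        · cases h3
        · omega
      · rw [if_neg ha]
        rcases hε with ⟨rfl, rfl⟩ | ⟨rfl, rfl⟩ <;> omega

/-- Each class has one level in each interval of `n - 1` levels that starts after a coloured
position. -/
theorem classLevels_add_half {i a : ℕ} (h1 : 1 ≤ i) (h2 : i ≤ q + 1) :
    classLevels q i ((q + 1) * (a + 1)) = classLevels q i ((q + 1) * a) + 1 := by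
  have key : ∀ b, classLevels q i ((q + 1) * (2 * b)) = 2 * b ∧
      classLevels q i ((q + 1) * (2 * b + 1)) = 2 * b + 1 := by
    intro b
    rw [show (q + 1) * (2 * b + 1) = (2 * q + 2) * b + (q + 1) by ring,
      show (q + 1) * (2 * b) = (2 * q + 2) * b by ring]
    unfold classLevels
    rw [Nat.mul_mod_right, Nat.mul_div_cancel_left _ (by omega), Nat.mul_add_mod,
      Nat.mul_add_div (by omega), Nat.div_eq_of_lt (by omega : q + 1 < 2 * q + 2),
      Nat.mod_eq_of_lt (by omega : q + 1 < 2 * q + 2)]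
    constructor <;> split_ifs <;> omega
  obtain ⟨b, rfl | rfl⟩ : ∃ b, a = 2 * b ∨ a = 2 * b + 1 := ⟨a / 2, by omega⟩
  · rw [(key b).1, (key b).2]
  · rw [show 2 * b + 1 + 1 = 2 * (b + 1) by ring, (key b).2, (key (b + 1)).1]
    ring

/-- A `pair` removes a bar. -/
theorem barRemoval_pair (hq : 2 ≤ q) (hA : A.IsConfig (q + 2)) {c d : Colour} {a : ℕ}
    (hhi : 2 ≤ A.coloured c ((q + 1) * (a + 1))) (hacc : A.Accepts d ((q + 1) * a)) :
    ∃ hA' : Beads.IsConfig (q + 2)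
      ((A.take c ((q + 1) * (a + 1)) 2).put d ((q + 1) * a) 2),
      BarRemoval (wallOf (by omega) hA) (wallOf (by omega) hA') := by
  set A' := (A.take c ((q + 1) * (a + 1)) 2).put d ((q + 1) * a) 2 with hA'def
  have hne : (q + 1) * (a + 1) ≠ (q + 1) * a := mul_succ_ne (by omega)
  have hm0 : (q + 1) * (a + 1) ≠ 0 := Nat.mul_ne_zero (by omega) (by omega)
  have hother : ∀ c : Colour, c.other ≠ c := by intro c; cases c <;> simp [Colour.other]
  have hval : ∀ e v, A'.coloured e v =
      if e = d ∧ v = (q + 1) * a ∧ a ≠ 0 then A.coloured e v + 2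
      else if e = c ∧ v = (q + 1) * (a + 1) then A.coloured e v - 2
      else A.coloured e v := by
    intro e v
    have ha : (q + 1) * a ≠ 0 ↔ a ≠ 0 := by simp
    simp only [hA'def, Beads.put, Beads.take, ha]
    by_cases h1 : v = (q + 1) * (a + 1)
    · subst h1
      simp only [hne, and_false, false_and, if_false]
    · simp only [h1, and_false, if_false]
  have hhic : A'.coloured c ((q + 1) * (a + 1)) = A.coloured c ((q + 1) * (a + 1)) - 2 ∧
      A'.coloured c.other ((q + 1) * (a + 1)) = A.coloured c.other ((q + 1) * (a + 1)) := by
    rw [hval, hval, if_neg fun h => hne h.2.1, if_pos ⟨rfl, rfl⟩, if_neg fun h => hne h.2.1,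
      if_neg fun h => hother c h.1]
    exact ⟨rfl, rfl⟩
  have hloo : A'.coloured d.other ((q + 1) * a) = A.coloured d.other ((q + 1) * a) := by
    rw [hval, if_neg fun h => hother d h.1, if_neg fun h => hne h.2.symm]
  have hlo : a ≠ 0 → A'.coloured d ((q + 1) * a) = A.coloured d ((q + 1) * a) + 2 := by
    intro ha
    rw [hval, if_pos ⟨rfl, rfl, ha⟩]
  have hlo0 : a = 0 → A'.coloured d ((q + 1) * a) = A.coloured d ((q + 1) * a) := by
    intro ha
    rw [hval, if_neg fun h => h.2.2 ha, if_neg fun h => hne h.2.symm]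
  have hout : ∀ v, v ≠ (q + 1) * a → v ≠ (q + 1) * (a + 1) →
      ∀ d, A'.coloured d v = A.coloured d v := by
    intro v h1 h2 d
    rw [hval, if_neg fun h => h1 h.2.1, if_neg fun h => h2 h.2]
  have hone1 := hA.one_colour ((q + 1) * (a + 1))
  have hz := hA.coloured_zero
  have hacc1 := hacc.1
  have hA' : A'.IsConfig (q + 2) := by
    refine isConfig_of_coloured hA rfl
      (S := {(q + 1) * a, (q + 1) * (a + 1)}) (by simp)
      (by rintro v (rfl | rfl) <;> exact dvd_mul_right _ _) (fun v hv => ?_) (fun e => ?_) ?_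
    · simp only [Set.mem_insert_iff, Set.mem_singleton_iff, not_or] at hv
      exact hout v hv.1 hv.2
    · by_cases ha : a = 0
      · have h1 := hlo0 ha
        have h2 := hloo
        rw [ha, mul_zero] at h1 h2
        rw [hz] at h1 h2
        cases d <;> cases e <;> assumption
      · rw [hout 0 (Nat.mul_ne_zero (by omega) ha).symm hm0.symm, hz]
    · rintro v (rfl | rfl)
      · rw [hacc1] at hloo
        cases d
        · exact Or.inr hloo
        · exact Or.inl hloo
      · cases c <;> simp only [Colour.other] at hhic <;> omega
  refine ⟨hA', ?_⟩
  obtain ⟨t, ht⟩ : ∃ t, t = (q + 1) * a := ⟨_, rfl⟩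
  have e1 : (q + 1) * (a + 1) = t + (q + 1) := by rw [ht]; ring
  have hlot : a ≠ 0 → A'.total t = A.total t + 2 := by
    intro ha
    have h1 := hlo ha
    rw [ht, Beads.total, Beads.total]
    cases d <;> simp only [Colour.other] at hloo <;> omega
  have hhit : A'.total (t + (q + 1)) + 2 = A.total (t + (q + 1)) := by
    rw [← e1, Beads.total, Beads.total]
    cases c <;> simp only [Colour.other] at hhic <;> omega
  -- the two displaced beads add two blocks to each of the `n - 1` levels that they pass
  obtain ⟨D, hD⟩ : ∃ D : ℕ → ℕ, ∀ v, D v = if t < v ∧ v ≤ t + (q + 1) then 2 else 0 :=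
    ⟨_, fun _ => rfl⟩
  have hshort : ∀ v, A'.shorter v = A.shorter v := fun _ => rfl
  have hcount : ∀ v, 1 ≤ v → A.count v + D (v + 1) = A'.count v + D v := by
    intro v hv
    have hpl : ∀ n m, A'.total v + n = A.total v + m → A'.count v + n = A.count v + m := by
      intro n m h
      by_cases hv : v ∈ A.plain
      · rw [Beads.count_of_mem hv, Beads.count_of_mem (show v ∈ A'.plain from hv)]
        omega
      · rw [Beads.count_of_not_mem hv, Beads.count_of_not_mem (show v ∉ A'.plain from hv)]
        omega
    refine (hpl _ _ ?_).symm
    rw [hD, hD]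
    by_cases h1 : v = t
    · have ha : a ≠ 0 := by
        rintro rfl
        rw [mul_zero] at ht
        omega
      rw [h1, hlot ha, if_neg (by omega), if_pos (by omega)]
    · by_cases h2 : v = t + (q + 1)
      · rw [h2, ← hhit, if_pos (by omega), if_neg (by omega)]
      · have : A'.total v = A.total v := by
          rw [Beads.total, hout v (by omega) (by omega), hout v (by omega) (by omega), Beads.total]
        rw [this]
        split_ifs <;> omega
  have habove := above_eq_add hA hA' (hi := t + (q + 1))
    (fun v hv => by rw [hD]; exact if_neg (by omega)) hcount
  have hS : IsStrip q A.above A'.above (A.upperFirst q) (A'.upperFirst q) t (t + (q + 1)) := by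
    refine isStrip_of_count hA hA' habove (by omega) (fun v hv => ?_) (fun v h1 h2 => ?_)
      (fun k h1 h2 => ?_) (fun k hk h => ?_) (fun k hk => ?_)
    · rw [hD]; exact if_neg (by omega)
    · rw [hD, if_pos ⟨h1, h2⟩]; omega
    · rw [ht] at h1
      rw [← e1] at h2
      have h3 := Nat.lt_of_mul_lt_mul_left h1
      have h4 := Nat.lt_of_mul_lt_mul_left h2
      omega
    · by_cases hka : k = a
      · subst hka
        have h1 := hlo (by omega)
        have : A.total ((q + 1) * k) = 0 ∨ (A.coloured Colour.black ((q + 1) * k) = 0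
            ↔ A'.coloured Colour.black ((q + 1) * k) = 0) := by
          unfold Beads.total
          cases d <;> simp only [Colour.other] at hloo hacc1 <;> omega
        exact this.symm.imp (fun h => upperFirst_congr h rfl) id
      · left
        refine upperFirst_congr ?_ rfl
        rw [hout _ (mul_succ_ne hka) (by omega)]
    · obtain rfl : k = a + 1 := by
        rw [← e1] at hk
        exact Nat.eq_of_mul_eq_mul_left (Nat.succ_pos q) hk
      have : A'.total ((q + 1) * (a + 1)) = 0 ∨ (A.coloured Colour.black ((q + 1) * (a + 1)) = 0
          ↔ A'.coloured Colour.black ((q + 1) * (a + 1)) = 0) := by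
        unfold Beads.total
        cases c <;> simp only [Colour.other] at hhic <;> omega
      rw [← hk]
      exact this.symm.imp (fun h => upperFirst_congr h rfl) id
  refine barRemoval_of_strip hq hA hA' habove (fun B hB i h1 h2 => ?_) hS rfl ?_
  · have e := sum_class_interval (q := q) h1 h2 2 (lo := t) (hi := t + (q + 1)) (by omega) hB
    rw [← e1, classLevels_add_half h1 h2, e1, ← ht] at e
    simp only [hD]
    omega
  · obtain ⟨ε, hε⟩ : ∃ ε : ℤ, (c = Colour.white ∧ ε = 1) ∨ (c = Colour.black ∧ ε = -1) := by
      cases c <;> simp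
    obtain ⟨η, hη⟩ : ∃ η : ℤ, (d = Colour.white ∧ η = 1) ∨ (d = Colour.black ∧ η = -1) := by
      cases d <;> simp
    -- the value of `u'` at `0` is the one the moved beads would give there
    refine colouredEquiv_charges_pair (a := a) (ε := ε) (η := η) (u := signedAt q A 1)
      (u' := signedAt q A' (if a = 0 then 1 + 2 * η else 1)) (signedAt_succ hA 1)
      (signedAt_succ hA' _) rfl (fun k h1 h2 => ?_) ?_ ?_ ?_ ?_
    · unfold signedAt
      by_cases hk : k = 0
      · rw [if_pos hk, if_pos hk, if_neg (by omega)]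
      · rw [if_neg hk, if_neg hk, hout _ (mul_succ_ne h1) (mul_succ_ne h2),
          hout _ (mul_succ_ne h1) (mul_succ_ne h2)]
    · rw [signedAt, signedAt, if_neg (by omega), if_neg (by omega)]
      rcases hε with ⟨rfl, rfl⟩ | ⟨rfl, rfl⟩ <;> simp only [Colour.other] at hhic <;> omega
    · rw [signedAt, signedAt]
      by_cases ha : a = 0
      · rw [if_pos ha, if_pos ha, if_pos ha]
      · rw [if_neg ha, if_neg ha]
        have h3 := hlo ha
        rcases hη with ⟨rfl, rfl⟩ | ⟨rfl, rfl⟩ <;> simp only [Colour.other] at hloo <;> omega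
    · rw [signedAt, if_neg (by omega)]
      rcases hε with ⟨rfl, rfl⟩ | ⟨rfl, rfl⟩ <;> omega
    · rw [signedAt]
      by_cases ha : a = 0
      · rw [if_pos ha]
        have h3 := hacc.2 (by rw [ha, mul_zero])
        rcases hη with ⟨rfl, rfl⟩ | ⟨rfl, rfl⟩
        · omega
        · cases h3
      · rw [if_neg ha]
        rcases hη with ⟨rfl, rfl⟩ | ⟨rfl, rfl⟩ <;> simp only [Colour.other] at hacc1 <;> omega

end

/-! ### Final configurations have weight zero -/

section

variable {q : ℕ} {A A' : Beads}

/-- Every move on the abacus is a bar removal. -/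
theorem AbacusMove.exists_barRemoval (hq : 2 ≤ q) (hA : A.IsConfig (q + 2))
    (h : AbacusMove (q + 2) A A') : ∃ hA' : A'.IsConfig (q + 2),
      BarRemoval (wallOf (by omega) hA) (wallOf (by omega) hA') := by
  have hdvd : ∀ {t s : ℕ}, (q + 1) ∣ s → A.total (t + s) ≠ 0 → ∃ a, t = (q + 1) * a :=
    fun hs h => (Nat.dvd_add_left hs).1 (hA.coloured_pos _ h).2
  have hcol : ∀ {c : Colour} {s : ℕ}, 1 ≤ A.coloured c s → A.total s ≠ 0 := by
    intro c s h
    rw [Beads.total]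
    cases c <;> omega
  cases h with
  | slide t h1 h2 h3 h4 =>
    exact barRemoval_slide hq hA h1 h2 h3 h4
  | cancel s t h1 h2 h3 h4 h5 =>
    exact barRemoval_cancel hq hA h1 h2 h3 h4 h5
  | jump c t h1 h2 h3 =>
    obtain ⟨a, rfl⟩ := hdvd ⟨2, by omega⟩ (hcol h1)
    have e : (q + 1) * a + (2 * (q + 2) - 2) = (q + 1) * (a + 2) := by
      rw [show 2 * (q + 2) - 2 = (q + 1) * 2 by omega, ← mul_add]
    rw [e] at h1 ⊢
    exact barRemoval_jump hq hA h1 h2 h3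
  | swap c d t h1 h2 h3 h4 =>
    obtain ⟨a, rfl⟩ := hdvd ⟨2, by omega⟩ (hcol h1)
    have e : (q + 1) * a + (2 * (q + 2) - 2) = (q + 1) * (a + 2) := by
      rw [show 2 * (q + 2) - 2 = (q + 1) * 2 by omega, ← mul_add]
    rw [e] at h1 ⊢
    exact barRemoval_swap hq hA h1 h2 h3 h4
  | pair c d t h1 h2 =>
    obtain ⟨a, rfl⟩ := hdvd ⟨1, by omega⟩ (hcol (by omega : 1 ≤ A.coloured c (t + (q + 2 - 1))))
    exact barRemoval_pair hq hA h1 h2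

/-- Two beads at the same position could move by `pair`. -/
theorem Beads.IsFinal.total_le (hA : A.IsConfig (q + 2)) (hF : A.IsFinal (q + 2)) (v : ℕ) :
    A.total v ≤ 1 := by
  by_contra h
  obtain ⟨h0, hdvd⟩ := hA.coloured_pos v (by omega)
  obtain ⟨k, rfl⟩ : (q + 1) ∣ v := hdvd
  obtain ⟨a, rfl⟩ : ∃ a, k = a + 1 := ⟨k - 1, by
    rcases k with _ | k
    · simp at h0
    · omega⟩
  obtain ⟨c, hc⟩ : ∃ c, 2 ≤ A.coloured c ((q + 1) * a + (q + 2 - 1)) := by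
    have h1 := hA.one_colour ((q + 1) * (a + 1))
    rw [Beads.total] at h
    rw [show (q + 1) * a + (q + 2 - 1) = (q + 1) * (a + 1) by rw [mul_add, mul_one]; omega]
    rcases h1 with h1 | h1
    · exact ⟨Colour.black, by omega⟩
    · exact ⟨Colour.white, by omega⟩
  -- every position accepts some colour
  obtain ⟨d, hd⟩ : ∃ d, A.Accepts d ((q + 1) * a) := by
    by_cases h1 : A.coloured Colour.black ((q + 1) * a) = 0
    · exact ⟨Colour.white, h1, fun _ => rfl⟩
    · refine ⟨Colour.black, (hA.one_colour _).resolve_right h1, fun h2 => absurd ?_ h1⟩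
      rw [h2, hA.coloured_zero]
  exact hF _ (AbacusMove.pair A c d _ hc hd)

theorem Beads.IsFinal.mem_plain (hA : A.IsConfig (q + 2)) (hF : A.IsFinal (q + 2)) {t : ℕ}
    (ht : 0 < t) (h : t + (2 * q + 2) ∈ A.plain) : t ∈ A.plain := by
  by_contra hn
  exact hF _ (AbacusMove.slide A t ht h hn fun k _ _ _ => hF.total_le hA k)

theorem Beads.IsFinal.plain_weight (hA : A.IsConfig (q + 2)) (hF : A.IsFinal (q + 2))
    (i : Fin q) : (mayaEquiv (plainData hA i)).2.weight = 0 := by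
  have hi := i.isLt
  refine mayaEquiv_weight_eq_zero (fun x hx => ?_) (fun x hx => ?_) ?_
  · rw [mem_plainData_left] at hx ⊢
    exact hF.mem_plain hA (by omega) (by convert hx using 1; ring)
  · rw [mem_plainData_right] at hx ⊢
    refine hF.mem_plain hA (by omega) ?_
    rw [mul_add, mul_one] at hx
    convert hx using 1
    ring
  · rw [mem_plainData_left, mem_plainData_right, mul_zero, zero_add, zero_add]
    rintro ⟨h1, h2⟩
    exact hF _ (AbacusMove.cancel A _ _ h1 h2 (by omega) (by omega) (hF.total_le hA _))

/-- If neither `jump` nor `swap` is possible, the colours of beads two coloured positions apart are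
forced, which is the criterion `colouredEquiv_weights_eq_zero`. -/
theorem Beads.IsFinal.coloured_weight (hA : A.IsConfig (q + 2)) (hF : A.IsFinal (q + 2)) :
    (colouredEquiv (signedMult hA)).2.1.1.weight = 0 ∧
      (colouredEquiv (signedMult hA)).2.1.2.weight = 0 ∧
      (colouredEquiv (signedMult hA)).2.2.weight = 0 := by
  have h1 : ∀ k, (signedMult hA k).natAbs ≤ 1 := fun k => by
    rw [natAbs_signedMult]
    exact hF.total_le hA _
  have hcol : ∀ k, signedMult hA k ≠ 0 → ∃ (c : Colour) (ε : ℤ),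
      ((c = Colour.white ∧ ε = 1) ∨ (c = Colour.black ∧ ε = -1)) ∧ signedMult hA k = ε ∧
      A.coloured c ((q + 1) * (k + 1)) = 1 ∧ A.total ((q + 1) * (k + 1)) = 1 := by
    intro k hk
    have h2 := natAbs_signedMult hA k
    have h3 := h1 k
    have h4 := hA.one_colour ((q + 1) * (k + 1))
    rw [Beads.total] at h2 ⊢
    rw [signedMult_apply] at hk h2 h3 ⊢
    by_cases hb : A.coloured Colour.black ((q + 1) * (k + 1)) = 0
    · exact ⟨Colour.white, 1, Or.inl ⟨rfl, rfl⟩, by omega, by omega, by omega⟩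
    · exact ⟨Colour.black, -1, Or.inr ⟨rfl, rfl⟩, by omega, by omega, by omega⟩
  have hzero : ∀ k, signedMult hA k = 0 → A.total ((q + 1) * (k + 1)) = 0 := fun k hk => by
    rw [← natAbs_signedMult hA, hk, Int.natAbs_zero]
  have e : ∀ a, (q + 1) * a + (2 * (q + 2) - 2) = (q + 1) * (a + 2) := fun a => by
    rw [show 2 * (q + 2) - 2 = (q + 1) * 2 by omega, ← mul_add]
  have hnojump : ∀ a c, A.coloured c ((q + 1) * (a + 2)) = 1 → A.total ((q + 1) * (a + 1)) = 0 →
      ¬ A.Accepts c ((q + 1) * a) := fun a c h2 h3 h4 =>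
    hF _ (AbacusMove.jump A c ((q + 1) * a) (by rw [e, h2]) h3 h4)
  have hnoswap : ∀ a c d, A.coloured c ((q + 1) * (a + 2)) = 1 →
      A.total ((q + 1) * (a + 1)) = 1 → A.coloured d ((q + 1) * (a + 1)) = 1 →
      ¬ A.Accepts c.other ((q + 1) * a) := fun a c d h2 h3 h4 h5 =>
    hF _ (AbacusMove.swap A c d ((q + 1) * a) (by rw [e, h2]) h3 h4 h5)
  refine colouredEquiv_weights_eq_zero h1 ?_ ?_ ?_ ?_
  · intro k hk hk0
    obtain ⟨c, ε, hε, h2, h3, -⟩ := hcol (k + 2) hk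
    have h4 := hnojump (k + 1) c h3 (hzero _ hk0)
    have h5 := hA.one_colour ((q + 1) * (k + 1))
    have h6 := h1 k
    rw [h2]
    by_contra hne
    refine h4 ⟨?_, fun h => absurd h (Nat.mul_ne_zero (by omega) (by omega))⟩
    rw [signedMult_apply] at hne h6
    rcases hε with ⟨rfl, rfl⟩ | ⟨rfl, rfl⟩ <;> simp only [Colour.other] <;> omega
  · intro k hk hk0
    obtain ⟨c, ε, hε, h2, h3, -⟩ := hcol (k + 2) hk
    obtain ⟨d, -, -, -, h7, h8⟩ := hcol (k + 1) hk0
    have h4 := hnoswap (k + 1) c d h3 h8 h7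
    have h5 := hA.one_colour ((q + 1) * (k + 1))
    have h6 := h1 k
    rw [h2]
    by_contra hne
    refine h4 ⟨?_, fun h => absurd h (Nat.mul_ne_zero (by omega) (by omega))⟩
    rw [signedMult_apply] at hne h6
    rcases hε with ⟨rfl, rfl⟩ | ⟨rfl, rfl⟩ <;> simp only [Colour.other] <;> omega
  · intro hk hk0
    obtain ⟨c, ε, hε, h2, h3, -⟩ := hcol 1 hk
    have h4 := hnojump 0 c h3 (hzero _ hk0)
    rcases hε with ⟨rfl, rfl⟩ | ⟨rfl, rfl⟩
    · refine absurd ⟨?_, fun _ => rfl⟩ h4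
      rw [mul_zero, hA.coloured_zero]
    · exact h2
  · intro hk hk0
    obtain ⟨c, ε, hε, h2, h3, -⟩ := hcol 1 hk
    obtain ⟨d, -, -, -, h7, h8⟩ := hcol 0 hk0
    have h4 := hnoswap 0 c d h3 h8 h7
    rcases hε with ⟨rfl, rfl⟩ | ⟨rfl, rfl⟩
    · exact h2
    · refine absurd ⟨?_, fun _ => rfl⟩ h4
      rw [mul_zero, hA.coloured_zero]

end

section

variable {q : ℕ}

theorem wallWeight_eq_zero_of_isFinal (hq : 0 < q) {Y : YoungWall (q + 2)}
    (h : Y.abacus.IsFinal (q + 2)) : wallWeight hq Y = 0 := by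
  have hA := abacus_isConfig hq Y
  obtain ⟨h1, h2, h3⟩ := h.coloured_weight hA
  rw [wallWeight_eq, h1, h2, h3, Finset.sum_eq_zero fun i _ => h.plain_weight hA i]

theorem exists_barRemoval_of_move (hq : 2 ≤ q) {Y : YoungWall (q + 2)} {A : Beads}
    (h : AbacusMove (q + 2) Y.abacus A) : ∃ Y', Y'.abacus = A ∧ BarRemoval Y Y' := by
  have hq0 : 0 < q := by omega
  obtain ⟨hA', h1⟩ := h.exists_barRemoval hq (abacus_isConfig hq0 Y)
  rw [wallOf_abacus] at h1
  exact ⟨_, abacus_wallOf hq0 hA', h1⟩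

theorem isCore_of_wallWeight_eq_zero (hq : 2 ≤ q) {Y : YoungWall (q + 2)}
    (h : wallWeight (by omega) Y = 0) : Y.IsCore := fun Y' h' => by
  have := (wallCode_of_barRemoval hq h').2
  omega

theorem isFinal_of_isCore (hq : 2 ≤ q) {Y : YoungWall (q + 2)} (h : Y.IsCore) :
    Y.abacus.IsFinal (q + 2) := fun A hA => by
  obtain ⟨Y', -, h'⟩ := exists_barRemoval_of_move hq hA
  exact h Y' h'

theorem isCore_iff_isFinal (hq : 2 ≤ q) (Y : YoungWall (q + 2)) :
    Y.IsCore ↔ Y.abacus.IsFinal (q + 2) :=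
  ⟨isFinal_of_isCore hq, fun h =>
    isCore_of_wallWeight_eq_zero hq (wallWeight_eq_zero_of_isFinal (by omega) h)⟩

theorem isCore_iff_wallWeight_eq_zero (hq : 2 ≤ q) (Y : YoungWall (q + 2)) :
    Y.IsCore ↔ wallWeight (by omega) Y = 0 :=
  ⟨fun h => wallWeight_eq_zero_of_isFinal (by omega) (isFinal_of_isCore hq h),
    isCore_of_wallWeight_eq_zero hq⟩

end

/-! ### Cores -/

section

variable {q : ℕ}

theorem plainData_congr {A A' : Beads} (hA : A.IsConfig (q + 2)) (hA' : A'.IsConfig (q + 2))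
    (h : A.plain = A'.plain) (i : Fin q) : plainData hA i = plainData hA' i := by
  refine Prod.ext (Finset.ext fun x => ?_) (Finset.ext fun x => ?_)
  · rw [mem_plainData_left, mem_plainData_left, h]
  · rw [mem_plainData_right, mem_plainData_right, h]

theorem mayaEquiv_empty : mayaCharge (∅, ∅) = 0 ∧ (mayaEquiv (∅, ∅)).2.weight = 0 :=
  ⟨by simp [mayaCharge], mayaEquiv_weight_eq_zero (by simp) (by simp) (by simp)⟩

theorem colouredEquiv_zero : (colouredEquiv 0).1.1 = 0 ∧ (colouredEquiv 0).1.2 = 0 ∧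
    (colouredEquiv 0).2.1.1.weight = 0 ∧ (colouredEquiv 0).2.1.2.weight = 0 ∧
    (colouredEquiv 0).2.2.weight = 0 := by
  have h := colouredEquiv_energy (g := 0) (K := 0) (by simp)
  rw [mul_zero, Finset.range_zero, Finset.sum_empty, Nat.cast_zero] at h
  -- each charge contributes the nonnegative integer `2 z ^ 2 + z` to the energy
  have hz : ∀ z : ℤ, 0 ≤ 2 * z ^ 2 + z := fun z => by nlinarith [sq_nonneg z, Int.le_self_sq (-z)]
  have hz0 : ∀ z : ℤ, 2 * z ^ 2 + z = 0 → z = 0 := fun z h => by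
    have : z * (2 * z + 1) = 0 := by linear_combination h
    rcases mul_eq_zero.1 this with h | h <;> omega
  have h1 := hz (colouredEquiv 0).1.1
  have h2 := hz (colouredEquiv 0).1.2
  exact ⟨hz0 _ (by omega), hz0 _ (by omega), by omega, by omega, by omega⟩

section

variable (hq : 0 < q) {Y Y' : YoungWall (q + 2)}

theorem wallCode_congr_plain (h : Y.abacus.plain = Y'.abacus.plain) (i : Fin q) :
    (wallCode hq Y).1 (Fin.castAdd 2 i) = (wallCode hq Y').1 (Fin.castAdd 2 i) ∧
      (wallCode hq Y).2 (Fin.castAdd 3 i) = (wallCode hq Y').2 (Fin.castAdd 3 i) := by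
  rw [wallCode_charge_plain, wallCode_charge_plain, wallCode_partition_plain,
    wallCode_partition_plain,
    plainData_congr (abacus_isConfig hq Y) (abacus_isConfig hq Y') h]
  exact ⟨rfl, rfl⟩

theorem wallCode_congr_coloured (h : Y.abacus.coloured = Y'.abacus.coloured) :
    (∀ i, (wallCode hq Y).1 (Fin.natAdd q i) = (wallCode hq Y').1 (Fin.natAdd q i)) ∧
      ∀ i, (wallCode hq Y).2 (Fin.natAdd q i) = (wallCode hq Y').2 (Fin.natAdd q i) := by
  have hs := signedMult_congr (abacus_isConfig hq Y') (abacus_isConfig hq Y) h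
  obtain ⟨a1, a2⟩ := wallCode_charge_coloured hq Y
  obtain ⟨a3, a4, a5⟩ := wallCode_partition_coloured hq Y
  obtain ⟨b1, b2⟩ := wallCode_charge_coloured hq Y'
  obtain ⟨b3, b4, b5⟩ := wallCode_partition_coloured hq Y'
  rw [hs] at a1 a2 a3 a4 a5
  exact ⟨Fin.forall_fin_two.2 ⟨a1.trans b1.symm, a2.trans b2.symm⟩,
    Fin.forall_fin_succ.2 ⟨a3.trans b3.symm,
      Fin.forall_fin_two.2 ⟨a4.trans b4.symm, a5.trans b5.symm⟩⟩⟩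

theorem wallCode_of_plain_eq_empty (h : Y.abacus.plain = ∅) (i : Fin q) :
    (wallCode hq Y).1 (Fin.castAdd 2 i) = 0 ∧
      ((wallCode hq Y).2 (Fin.castAdd 3 i)).weight = 0 := by
  have hp : plainData (abacus_isConfig hq Y) i = (∅, ∅) := by
    refine Prod.ext (Finset.ext fun x => ?_) (Finset.ext fun x => ?_)
    · simp [mem_plainData_left, h]
    · simp [mem_plainData_right, h]
  rw [wallCode_charge_plain, wallCode_partition_plain, hp]
  exact mayaEquiv_empty

theorem wallCode_of_coloured_eq_zero (h : Y.abacus.coloured = fun _ _ => 0) :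
    (∀ i, (wallCode hq Y).1 (Fin.natAdd q i) = 0) ∧
      ∀ i, ((wallCode hq Y).2 (Fin.natAdd q i)).weight = 0 := by
  have hs : signedMult (abacus_isConfig hq Y) = 0 := by
    ext k
    rw [signedMult_apply, h]
    simp
  obtain ⟨a1, a2⟩ := wallCode_charge_coloured hq Y
  obtain ⟨a3, a4, a5⟩ := wallCode_partition_coloured hq Y
  rw [hs] at a1 a2 a3 a4 a5
  obtain ⟨b1, b2, b3, b4, b5⟩ := colouredEquiv_zero
  exact ⟨Fin.forall_fin_two.2 ⟨a1.trans b1, a2.trans b2⟩,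
    Fin.forall_fin_succ.2 ⟨(congrArg _ a3).trans b3,
      Fin.forall_fin_two.2 ⟨(congrArg _ a4).trans b4, (congrArg _ a5).trans b5⟩⟩⟩

end

theorem Beads.IsConfig.plainPart {n : ℕ} {A : Beads} (hA : A.IsConfig n) :
    A.plainPart.IsConfig n where
  plain_finite := hA.plain_finite
  plain_pos := hA.plain_pos
  coloured_finite := by simp [Beads.plainPart, Beads.total]
  coloured_pos s hs := absurd rfl hs
  one_colour _ := Or.inl rfl

theorem Beads.IsConfig.colouredPart {n : ℕ} {A : Beads} (hA : A.IsConfig n) :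
    A.colouredPart.IsConfig n where
  plain_finite := Set.finite_empty
  plain_pos s hs := absurd hs (Set.notMem_empty s)
  coloured_finite := hA.coloured_finite
  coloured_pos := hA.coloured_pos
  one_colour := hA.one_colour

end

section

variable {q : ℕ}

theorem RemovesBars.wallCode_eq (hq : 2 ≤ q) {k : ℕ} {Y Y' : YoungWall (q + 2)}
    (h : RemovesBars k Y Y') : (wallCode (by omega) Y).1 = (wallCode (by omega) Y').1 ∧
      wallWeight (by omega) Y = wallWeight (by omega) Y' + k := by
  induction h with
  | zero Y => exact ⟨rfl, rfl⟩
  | succ h _ ih =>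
    obtain ⟨h1, h2⟩ := wallCode_of_barRemoval hq h
    exact ⟨h1.trans ih.1, by omega⟩

theorem RemovesBars.reflTransGen {n k : ℕ} {Y Y' : YoungWall n} (h : RemovesBars k Y Y') :
    Relation.ReflTransGen BarRemoval Y Y' := by
  induction h with
  | zero Y => exact .refl
  | succ h _ ih => exact .head h ih

theorem exists_removesBars_of_reflTransGen {n : ℕ} {Y Y' : YoungWall n}
    (h : Relation.ReflTransGen BarRemoval Y Y') : ∃ k, RemovesBars k Y Y' := by
  induction h using Relation.ReflTransGen.head_induction_on with
  | refl => exact ⟨0, .zero _⟩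
  | head h _ ih =>
    obtain ⟨k, hk⟩ := ih
    exact ⟨k + 1, .succ h hk⟩

theorem exists_reflTransGen_of_moves (hq : 2 ≤ q) {Y : YoungWall (q + 2)} {A : Beads}
    (h : Relation.ReflTransGen (AbacusMove (q + 2)) Y.abacus A) :
    ∃ Y', Y'.abacus = A ∧ Relation.ReflTransGen BarRemoval Y Y' := by
  induction h with
  | refl => exact ⟨Y, rfl, .refl⟩
  | tail _ h ih =>
    obtain ⟨Z, rfl, hZ⟩ := ih
    obtain ⟨Y', hY', h'⟩ := exists_barRemoval_of_move hq h
    exact ⟨Y', hY', hZ.tail h'⟩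

/-- As long as the weight is positive, some move is possible, and it lowers the weight by one. -/
theorem exists_core_of_wallWeight (hq : 2 ≤ q) (k : ℕ) : ∀ Y : YoungWall (q + 2),
    wallWeight (by omega) Y = k → ∃ C : YoungWall (q + 2), C.IsCore ∧ RemovesBars k Y C ∧
      Relation.ReflTransGen (AbacusMove (q + 2)) Y.abacus C.abacus := by
  induction k with
  | zero => exact fun Y h => ⟨Y, isCore_of_wallWeight_eq_zero hq h, .zero Y, .refl⟩
  | succ k ih =>
    intro Y h
    have hF : ¬ Y.abacus.IsFinal (q + 2) := fun hF => by
      have := wallWeight_eq_zero_of_isFinal (by omega) hF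
      omega
    obtain ⟨A, hA⟩ := not_forall_not.1 hF
    obtain ⟨Y', rfl, hY'⟩ := exists_barRemoval_of_move hq hA
    obtain ⟨C, hC, h1, h2⟩ := ih Y' (by have := (wallCode_of_barRemoval hq hY').2; omega)
    exact ⟨C, hC, .succ hY' h1, .head hA h2⟩

theorem YoungWall.IsCore.partition_weight (hq : 2 ≤ q) {Y : YoungWall (q + 2)} (h : Y.IsCore)
    (i : Fin (q + 3)) : ((wallCode (by omega) Y).2 i).weight = 0 :=
  Finset.sum_eq_zero_iff.1 ((isCore_iff_wallWeight_eq_zero hq Y).1 h) i (Finset.mem_univ i)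

/-- The cores are parametrized by the charges of their abaci: their partitions are empty. -/
noncomputable def coreEquiv (hq : 2 ≤ q) : CoreWall (q + 2) ≃ (Fin (q + 2) → ℤ) where
  toFun C := (wallCode (by omega) C.1).1
  invFun z := ⟨(wallCode (by omega)).symm (z, fun _ => ⟨0, default⟩),
    (isCore_iff_wallWeight_eq_zero hq _).2 (by
      rw [wallWeight, Equiv.apply_symm_apply]
      exact Finset.sum_eq_zero fun _ _ => rfl)⟩
  left_inv C := Subtype.ext ((Equiv.symm_apply_eq _).2 (Prod.ext rfl (funext fun i =>
    ordPartition_eq_of_weight_eq_zero rfl (C.2.partition_weight hq i))))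
  right_inv z := congrArg Prod.fst ((wallCode (by omega)).apply_symm_apply _)

/-- The core of a Young wall: the core with the same charges. -/
noncomputable def wallCore (hq : 2 ≤ q) (Y : YoungWall (q + 2)) : CoreWall (q + 2) :=
  (coreEquiv hq).symm (wallCode (by omega) Y).1

theorem wallCode_wallCore (hq : 2 ≤ q) (Y : YoungWall (q + 2)) :
    (wallCode (by omega) (wallCore hq Y).1).1 = (wallCode (by omega) Y).1 :=
  (coreEquiv hq).apply_symm_apply _

theorem eq_wallCore_iff (hq : 2 ≤ q) (Y : YoungWall (q + 2)) (C : CoreWall (q + 2)) :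
    C = wallCore hq Y ↔ (wallCode (by omega) C.1).1 = (wallCode (by omega) Y).1 :=
  (coreEquiv hq).eq_symm_apply

theorem removesBars_iff (hq : 2 ≤ q) (Y : YoungWall (q + 2)) (k : ℕ) (C : CoreWall (q + 2)) :
    RemovesBars k Y C.1 ↔ C = wallCore hq Y ∧ k = wallWeight (by omega) Y := by
  refine ⟨fun h => ?_, ?_⟩
  · obtain ⟨h1, h2⟩ := h.wallCode_eq hq
    rw [(isCore_iff_wallWeight_eq_zero hq C.1).1 C.2] at h2
    exact ⟨(eq_wallCore_iff hq Y C).2 h1.symm, by omega⟩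
  · rintro ⟨rfl, rfl⟩
    obtain ⟨C, hC, h, -⟩ := exists_core_of_wallWeight hq _ Y rfl
    have h1 : (⟨C, hC⟩ : CoreWall (q + 2)) = wallCore hq Y :=
      (eq_wallCore_iff hq Y _).2 (h.wallCode_eq hq).1.symm
    rwa [← h1]

theorem reflTransGen_barRemoval_iff (hq : 2 ≤ q) (Y : YoungWall (q + 2)) (C : CoreWall (q + 2)) :
    Relation.ReflTransGen BarRemoval Y C.1 ↔ C = wallCore hq Y := by
  refine ⟨fun h => ?_, fun h => ?_⟩
  · obtain ⟨k, hk⟩ := exists_removesBars_of_reflTransGen h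
    exact ((removesBars_iff hq Y k C).1 hk).1
  · exact ((removesBars_iff hq Y _ C).2 ⟨h, rfl⟩).reflTransGen

theorem reflTransGen_move_iff (hq : 2 ≤ q) (Y : YoungWall (q + 2)) (A : Beads) :
    (Relation.ReflTransGen (AbacusMove (q + 2)) Y.abacus A ∧ A.IsFinal (q + 2)) ↔
      A = (wallCore hq Y).1.abacus := by
  constructor
  · rintro ⟨h, hF⟩
    obtain ⟨Y', rfl, h'⟩ := exists_reflTransGen_of_moves hq h
    rw [← (reflTransGen_barRemoval_iff hq Y ⟨Y', (isCore_iff_isFinal hq Y').2 hF⟩).1 h']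
  · rintro rfl
    refine ⟨?_, (isCore_iff_isFinal hq _).1 (wallCore hq Y).2⟩
    obtain ⟨C, hC, h, h'⟩ := exists_core_of_wallWeight hq _ Y rfl
    rwa [← ((removesBars_iff hq Y _ ⟨C, hC⟩).1 h).1]

/-- The uncoloured beads of a core form a core, since their charges and partitions are those of the
core with zeros in the coloured places; similarly for the coloured beads. -/
theorem isDecomp_wallCore (hq : 2 ≤ q) {Y Y₁ Y₂ : YoungWall (q + 2)} (h : IsDecomp Y Y₁ Y₂) :
    IsDecomp (wallCore hq Y).1 (wallCore hq Y₁).1 (wallCore hq Y₂).1 := by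
  have hq0 : 0 < q := by omega
  obtain ⟨h1, h2⟩ := h
  have hC := abacus_isConfig hq0 (wallCore hq Y).1
  have hw := (wallCore hq Y).2.partition_weight hq
  have hc : ∀ i, _ := congrFun (wallCode_wallCore hq Y)
  constructor
  · have e := abacus_wallOf hq0 hC.plainPart
    have p1 := wallCode_congr_plain hq0 (Y' := (wallCore hq Y).1) (congrArg Beads.plain e :)
    have p2 := wallCode_of_coloured_eq_zero hq0 (congrArg Beads.coloured e)
    have p3 := wallCode_congr_plain hq0 (Y' := Y) (congrArg Beads.plain h1 :)
    have p4 := wallCode_of_coloured_eq_zero hq0 (congrArg Beads.coloured h1)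
    have hK : (wallOf hq0 hC.plainPart).IsCore := by
      refine (isCore_iff_wallWeight_eq_zero hq _).2 (Finset.sum_eq_zero fun i _ => ?_)
      refine Fin.addCases (fun i => ?_) (fun i => p2.2 i) i
      rw [(p1 i).2, hw]
    rw [← e, ← (eq_wallCore_iff hq Y₁ ⟨_, hK⟩).2]
    refine funext fun i => Fin.addCases (fun i => ?_) (fun i => ?_) i
    · rw [(p1 i).1, (p3 i).1, hc]
    · rw [p2.1 i, p4.1 i]
  · have e := abacus_wallOf hq0 hC.colouredPart
    have p1 := wallCode_of_plain_eq_empty hq0 (congrArg Beads.plain e)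
    have p2 := wallCode_congr_coloured hq0 (Y' := (wallCore hq Y).1)
      (congrArg Beads.coloured e :)
    have p3 := wallCode_of_plain_eq_empty hq0 (congrArg Beads.plain h2)
    have p4 := wallCode_congr_coloured hq0 (Y' := Y) (congrArg Beads.coloured h2 :)
    have hK : (wallOf hq0 hC.colouredPart).IsCore := by
      refine (isCore_iff_wallWeight_eq_zero hq _).2 (Finset.sum_eq_zero fun i _ => ?_)
      refine Fin.addCases (fun i => (p1 i).2) (fun i => ?_) i
      rw [p2.2 i, hw]
    rw [← e, ← (eq_wallCore_iff hq Y₂ ⟨_, hK⟩).2]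
    refine funext fun i => Fin.addCases (fun i => ?_) (fun i => ?_) i
    · rw [(p1 i).1, (p3 i).1]
    · rw [p2.1 i, p4.1 i, hc]

/-- A Young wall is determined by its partitions and its core. -/
noncomputable def partitionsCoreEquiv (hq : 2 ≤ q) :
    YoungWall (q + 2) ≃ (Fin (q + 3) → OrdPartition) × CoreWall (q + 2) :=
  (wallCode (by omega)).trans
    ((Equiv.prodComm _ _).trans ((Equiv.refl _).prodCongr (coreEquiv hq).symm))

theorem partition_of_isDecomp (hq : 2 ≤ q) {Y Y₁ Y₂ : YoungWall (q + 2)} (h : IsDecomp Y Y₁ Y₂)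
    (i : Fin (q + 3)) :
    if i.val < q then
      (wallCode (by omega) Y₁).2 i = (wallCode (by omega) Y).2 i ∧
        ((wallCode (by omega) Y₂).2 i).weight = 0
    else
      (wallCode (by omega) Y₂).2 i = (wallCode (by omega) Y).2 i ∧
        ((wallCode (by omega) Y₁).2 i).weight = 0 := by
  have hq0 : 0 < q := by omega
  obtain ⟨h1, h2⟩ := h
  refine Fin.addCases (fun i => ?_) (fun i => ?_) i
  · rw [if_pos (by rw [Fin.val_castAdd]; exact i.isLt)]
    exact ⟨(wallCode_congr_plain hq0 (Y' := Y) (congrArg Beads.plain h1 :) i).2,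
      (wallCode_of_plain_eq_empty hq0 (congrArg Beads.plain h2) i).2⟩
  · rw [if_neg (by rw [Fin.val_natAdd]; omega)]
    exact ⟨(wallCode_congr_coloured hq0 (Y' := Y) (congrArg Beads.coloured h2 :)).2 i,
      (wallCode_of_coloured_eq_zero hq0 (congrArg Beads.coloured h1)).2 i⟩

theorem coreEquiv_plain (hq : 2 ≤ q) (C : CoreWall (q + 2)) (i : Fin (q + 2)) (hi : i.val < q) :
    coreEquiv hq C i = (C.1.abacus.onRuler (q + 2) (i.val + 1) : ℤ)
      - (C.1.abacus.onRuler (q + 2) (2 * q + 2 - (i.val + 1)) : ℤ) := by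
  have h := wallCode_charge_plain (by omega) C.1 ⟨i, hi⟩
  rw [mayaCharge_plainData] at h
  exact h

theorem coreEquiv_coloured (hq : 2 ≤ q) {C C' : CoreWall (q + 2)}
    (h : C.1.abacus.colouredPart = C'.1.abacus.colouredPart) (i : Fin (q + 2)) (hi : q ≤ i.val) :
    coreEquiv hq C i = coreEquiv hq C' i := by
  have h1 := (wallCode_congr_coloured (by omega) (Y := C.1) (Y' := C'.1)
    (congrArg Beads.coloured h :)).1 ⟨i - q, by have := i.isLt; omega⟩
  rw [show Fin.natAdd q ⟨i - q, _⟩ = i from Fin.ext (Nat.add_sub_cancel' hi)] at h1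
  exact h1

theorem size_core (hq : 2 ≤ q) (C : CoreWall (q + 2)) : (C.1.size : ℤ) = ∑ i : Fin (q + 2),
    if i.val < q then ((q : ℤ) + 1) * coreEquiv hq C i ^ 2 - (q - (i.val : ℤ)) * coreEquiv hq C i
    else (q + 1) * (2 * coreEquiv hq C i ^ 2 + coreEquiv hq C i) := by
  rw [size_eq hq, (isCore_iff_wallWeight_eq_zero hq C.1).1 C.2, Nat.cast_zero, mul_zero, add_zero]
  rfl

end

theorem proposition3p1 (n : ℕ) (hn : 4 ≤ n) :
    -- the abacus encodes Young walls faithfully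
    Set.BijOn (fun Y : YoungWall n => Y.abacus) Set.univ {A | A.IsConfig n} ∧
    ∃ core : YoungWall n → CoreWall n,
      -- any complete sequence of bar removals starting from `Y` ends in `core Y`
      (∀ (Y : YoungWall n) (C : CoreWall n),
        Relation.ReflTransGen BarRemoval Y C.1 ↔ C = core Y) ∧
      -- description on the abacus: each move is a bar removal, the cores are the final
      -- configurations, and any complete sequence of moves leads to the core
      (∀ (Y : YoungWall n) (A : Beads), AbacusMove n Y.abacus A →
        ∃ Y' : YoungWall n, Y'.abacus = A ∧ BarRemoval Y Y') ∧
      (∀ Y : YoungWall n, Y.IsCore ↔ Y.abacus.IsFinal n) ∧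
      (∀ (Y : YoungWall n) (A : Beads),
        (Relation.ReflTransGen (AbacusMove n) Y.abacus A ∧ A.IsFinal n) ↔
          A = (core Y).1.abacus) ∧
      -- compatibility with the decomposition into full and non-full columns
      (∀ Y Y₁ Y₂ : YoungWall n, IsDecomp Y Y₁ Y₂ →
        IsDecomp (core Y).1 (core Y₁).1 (core Y₂).1) ∧
      -- the bijection with `𝒫^(n+1) × 𝒞`
      (∃ e : YoungWall n ≃ (Fin (n + 1) → OrdPartition) × CoreWall n,
        (∀ Y, (e Y).2 = core Y) ∧
        (∀ (Y : YoungWall n) (k : ℕ) (C : CoreWall n),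
          RemovesBars k Y C.1 ↔ C = core Y ∧ k = ∑ i, ((e Y).1 i).weight) ∧
        (∀ Y Y₁ Y₂ : YoungWall n, IsDecomp Y Y₁ Y₂ → ∀ i : Fin (n + 1),
          if i.val < n - 2 then
            (e Y₁).1 i = (e Y).1 i ∧ ((e Y₂).1 i).weight = 0
          else
            (e Y₂).1 i = (e Y).1 i ∧ ((e Y₁).1 i).weight = 0)) ∧
      -- the bijection of the cores with `ℤ^n`
      (∃ ζ : CoreWall n ≃ (Fin n → ℤ),
        (∀ (C : CoreWall n) (i : Fin n), i.val < n - 2 →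
          ζ C i = (C.1.abacus.onRuler n (i.val + 1) : ℤ)
            - (C.1.abacus.onRuler n (2 * n - 2 - (i.val + 1)) : ℤ)) ∧
        (∀ C C' : CoreWall n, C.1.abacus.colouredPart = C'.1.abacus.colouredPart →
          ∀ i : Fin n, n - 2 ≤ i.val → ζ C i = ζ C' i) ∧
        (∀ C : CoreWall n, (C.1.size : ℤ) = ∑ i : Fin n,
          if i.val < n - 2 then
            ((n : ℤ) - 1) * (ζ C i) ^ 2 - ((n : ℤ) - 2 - (i.val : ℤ)) * ζ C i
          else
            ((n : ℤ) - 1) * (2 * (ζ C i) ^ 2 + ζ C i))) := by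
  obtain ⟨q, rfl⟩ : ∃ q, n = q + 2 := ⟨n - 2, by omega⟩
  have hq : 2 ≤ q := by omega
  have hq0 : 0 < q := by omega
  refine ⟨abacus_bijOn hq0, wallCore hq, reflTransGen_barRemoval_iff hq,
    fun Y A h => exists_barRemoval_of_move hq h, isCore_iff_isFinal hq,
    reflTransGen_move_iff hq, fun Y Y₁ Y₂ h => isDecomp_wallCore hq h,
    ⟨partitionsCoreEquiv hq, fun Y => rfl, removesBars_iff hq,
      fun Y Y₁ Y₂ h i => partition_of_isDecomp hq h i⟩,
    ⟨coreEquiv hq, coreEquiv_plain hq, fun C C' h i hi => coreEquiv_coloured hq h i hi,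
      fun C => ?_⟩⟩
  rw [size_core hq C]
  refine Finset.sum_congr rfl fun i _ => ?_
  rw [show ((q + 2 : ℕ) : ℤ) = q + 2 by push_cast; rfl,
    show (q : ℤ) + 2 - 1 = q + 1 by ring, show (q : ℤ) + 2 - 2 = q by ring]
  rfl
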